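/- **Setting.** Let $\gamma^1,\dots,\gamma^4$ be complex $4\times4$ matrices with $\gamma^i\gamma^j+\gamma^j\gamma^i=2\delta^{ij}$, and let $\gamma^5=\gamma^1\gamma^2\gamma^3\gamma^4$. For real $m_0,m$, the Green function of free overlap fermions on the momentum torus $\mathcal M=(\mathbb R/2\pi\mathbb Z)^4$ is $$\mathcal G(p)=\frac1{\sum_i g^i(p)\gamma^i-im},\qquad g^i(p)=2m_0\sin p^i\,\frac{A(p)+\sqrt{A(p)^2+\sum_k\sin^2p^k}}{\sum_k\sin^2p^k},\qquad A(p)=-m_0+\sum_i(1-\cos p^i),$$ where, at points at which all $\sin p^k$ vanish and $A<0$, $g^i$ is defined by continuity as $0$. A *zero* (*pole*) of $\mathcal G$ is a point at which $\mathcal G\to0$ ($\mathcal G^{-1}\to 0$). Put $$\tilde{\mathcal N}_4=\frac1{48\pi^2}\,\mathrm{Tr}\,\gamma^5\!\int_{\mathcal M} d\mathcal G^{-1}\wedge d\mathcal G\wedge d\mathcal G^{-1}\wedge d\mathcal G,\qquad \tilde{\mathcal N}_5=\frac{3}{4\pi^2\,4!}\,\epsilon_{abcde}\int_{\mathcal M}\hat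 g^a\,d\hat g^b\wedge d\hat g^c\wedge d\hat g^d\wedge d\hat g^e,$$ with $\hat g=(g^1,g^2,g^3,g^4,m)/\sqrt{\sum_i (g^i)^2+m^2}$, and $$\mathcal N_5=\frac1{2\pi^3\,5!\,i}\,\mathrm{Tr}\int_{\mathcal M\times\mathbb R}(G\,dG^{-1})^{\wedge5},\qquad G^{-1}(p,p_5)=p_5\gamma^5+\mathcal G^{-1}(p).$$ The orientations are $dp^1\wedge\dots\wedge dp^4$ and $dp^1\wedge\dots\wedge dp^4\wedge dp_5$. In each integral open vicinities of the zeros and poles of $\mathcal G$ are removed from $\mathcal M$, and the limit is taken as the vicinities shrink; an invariant is *well defined* if the integrands make sense away from the zeros and poles, the integrals converge absolutely, and the limit exists independently of the shape of the vicinities. **Statement.** (1) Let $m\neq0$ and $m_0\notin\{0,2,4,6,8\}$. Then $\tilde{\mathcal N}_4$, $\tilde{\mathcal N}_5$ and $\mathcal N_5$ are well defined, $\mathcal N_5=\tilde{\mathcal N}_5$, and $$\tilde{\mathcal N}_5=-\tfrac12\,\mathrm{sign}(m)\sum_{k=0}^4(-1)^k\binom4k\,\mathrm{sign}(2k-m_0),\qquad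 \tilde{\mathcal N}_4=\tilde{\mathcal N}_5\,\mathrm{sign}(m)=-\tfrac12\sum_{k=0}^4(-1)^k\binom4k\,\mathrm{sign}(2k-m_0).$$ Explicitly, $\tilde{\mathcal N}_4=0,\,1,\,-3,\,3,\,-1,\,0$ for $m_0<0$, $0<m_0<2$, $2<m_0<4$, $4<m_0<6$, $6<m_0<8$, $m_0>8$ respectively, and $\tilde{\mathcal N}_5=\mathrm{sign}(m)\,\tilde{\mathcal N}_4$. (2) Let $m\in\mathbb R$ be arbitrary and $m_0=2k$ with $k\in\{1,2,3,4\}$. Among the points $p_n=(\pi n_1,\pi n_2,\pi n_3,\pi n_4)$, $n_i\in\{0,1\}$, exactly $\binom4k$ satisfy $A(p_n)=0$. At each of these, $\mathcal G(p)$ has no limit as $p\to p_n$; neither $\mathcal G$ nor $\mathcal G^{-1}$ is analytic in a vicinity of $p_n$, whatever value is assigned to it at $p_n$ (so $p_n$ represents a generalized unparticle); and the propagator has there the fermionic unparticle form $$\mathcal G(p_n+\delta p)-\frac{1/(2m_0)}{\sum_i(-1)^{n_i}\frac{\delta p^i}{|\delta p|}\gamma^i-i\frac{m}{2m_0}}\;\longrightarrow\;0\qquad(\delta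 p\to0,\ \delta p\ne0),\qquad |\delta p|=\Big(\sum_i(\delta p^i)^2\Big)^{1/2}.$$ -/

import Mathlib

open Filter Topology MeasureTheory

noncomputable section

namespace OverlapFermion

/-- Four-momenta `p = (p¹, p², p³, p⁴)`, in lattice units. -/
abbrev Mom : Type := Fin 4 → ℝ

/-- Matrices acting on spinor indices. -/
abbrev SpinMat : Type := Matrix (Fin 4) (Fin 4) ℂ

/-- The Euclidean Dirac algebra `γⁱγʲ + γʲγⁱ = 2 δⁱʲ`. -/
def IsEuclideanGamma (γ : Fin 4 → SpinMat) : Prop :=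
  ∀ i j, γ i * γ j + γ j * γ i = if i = j then 2 else 0

/-- `γ⁵ = γ¹γ²γ³γ⁴`. -/
def gamma5 (γ : Fin 4 → SpinMat) : SpinMat := γ 0 * γ 1 * γ 2 * γ 3

/-- The Brillouin zone: a period cell of the momentum torus `(ℝ / 2πℤ)⁴`. -/
def brillouinZone : Set Mom := Set.Icc (fun _ => -Real.pi) (fun _ => Real.pi)

/-! ### Green functions -/

/-- The Green function `𝒢(p) = 1 / (gⁱ(p) γⁱ - i m(p))`. -/
def green (γ : Fin 4 → SpinMat) (g : Mom → Fin 4 → ℝ) (m : Mom → ℝ) (p : Mom) : SpinMat :=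
  (∑ i, (g p i : ℂ) • γ i - (Complex.I * (m p : ℂ)) • (1 : SpinMat))⁻¹

/-- `z` is a zero of the Green function. -/
def IsGreenZero (G : Mom → SpinMat) (z : Mom) : Prop :=
  Tendsto G (𝓝[≠] z) (𝓝 0)

/-- `z` is a pole of the Green function (a zero of its inverse). -/
def IsGreenPole (G : Mom → SpinMat) (z : Mom) : Prop :=
  Tendsto (fun p => (G p)⁻¹) (𝓝[≠] z) (𝓝 0)

/-- All zeros and poles of the Green function. -/
def zerosAndPoles (G : Mom → SpinMat) : Set Mom :=
  {z | IsGreenZero G z ∨ IsGreenPole G z}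

/-- The point `q` represents a generalized unparticle: neither `𝒢` nor `𝒢⁻¹` is analytic in a
vicinity of `q`, whatever value is assigned to it at `q` itself. -/
def IsGeneralizedUnparticle (G : Mom → SpinMat) (q : Mom) : Prop :=
  (¬ ∃ F : Mom → SpinMat, (∀ i j, AnalyticAt ℝ (fun p => F p i j) q) ∧ F =ᶠ[𝓝[≠] q] G) ∧
  (¬ ∃ F : Mom → SpinMat, (∀ i j, AnalyticAt ℝ (fun p => F p i j) q) ∧
      F =ᶠ[𝓝[≠] q] fun p => (G p)⁻¹)

/-! ### Differential forms in coordinates -/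

/-- The `μ`-th partial derivative of a real function on `ℝⁿ`. -/
def partialReal {n : ℕ} (μ : Fin n) (f : (Fin n → ℝ) → ℝ) (p : Fin n → ℝ) : ℝ :=
  lineDeriv ℝ f p (Pi.single μ 1)

/-- The `μ`-th partial derivative of a matrix valued function on `ℝⁿ`, taken entrywise. -/
def partialMat {n : ℕ} (μ : Fin n) (X : (Fin n → ℝ) → SpinMat) (p : Fin n → ℝ) : SpinMat :=
  Matrix.of fun i j => lineDeriv ℝ (fun q => X q i j) p (Pi.single μ 1)

/-- The coefficient of `dp¹∧dp²∧dp³∧dp⁴` in `Tr γ⁵ d𝒢⁻¹∧d𝒢∧d𝒢⁻¹∧d𝒢`. -/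
def form4 (γ : Fin 4 → SpinMat) (G : Mom → SpinMat) (p : Mom) : ℂ :=
  ∑ σ : Equiv.Perm (Fin 4), ((Equiv.Perm.sign σ : ℤ) : ℂ) *
    Matrix.trace (gamma5 γ * (partialMat (σ 0) (fun q => (G q)⁻¹) p * partialMat (σ 1) G p *
      partialMat (σ 2) (fun q => (G q)⁻¹) p * partialMat (σ 3) G p))

/-- The inverse of the five-dimensional Green function, `G⁻¹(p, p₅) = p₅ γ⁵ + 𝒢⁻¹(p)`; the
coordinates on `ℝ⁵` are `(p¹, p², p³, p⁴, p₅)`. -/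
def greenInv5 (γ : Fin 4 → SpinMat) (G : Mom → SpinMat) (q : Fin 5 → ℝ) : SpinMat :=
  (q 4 : ℂ) • gamma5 γ + (G (fun i => q i.castSucc))⁻¹

/-- The coefficient of `dp¹∧dp²∧dp³∧dp⁴∧dp₅` in
`Tr G dG⁻¹∧G dG⁻¹∧G dG⁻¹∧G dG⁻¹∧G dG⁻¹`. -/
def form5 (γ : Fin 4 → SpinMat) (G : Mom → SpinMat) (q : Fin 5 → ℝ) : ℂ :=
  ∑ σ : Equiv.Perm (Fin 5), ((Equiv.Perm.sign σ : ℤ) : ℂ) *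
    Matrix.trace (List.ofFn fun i : Fin 5 =>
      (greenInv5 γ G q)⁻¹ * partialMat (σ i) (greenInv5 γ G) q).prod

/-- The unit vector `ĝ = (g¹, g², g³, g⁴, m) / √(gᵃgᵃ + m²)`. -/
def ghat (g : Mom → Fin 4 → ℝ) (m : Mom → ℝ) (a : Fin 5) (p : Mom) : ℝ :=
  (Fin.snoc (g p) (m p) : Fin 5 → ℝ) a / Real.sqrt (∑ i, g p i ^ 2 + m p ^ 2)

/-- The coefficient of `dp¹∧dp²∧dp³∧dp⁴` in `ε_{abcde} ĝᵃ dĝᵇ∧dĝᶜ∧dĝᵈ∧dĝᵉ`. -/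
def formSphere (g : Mom → Fin 4 → ℝ) (m : Mom → ℝ) (p : Mom) : ℝ :=
  ∑ σ : Equiv.Perm (Fin 5), ((Equiv.Perm.sign σ : ℤ) : ℝ) * (ghat g m (σ 0) p *
    ∑ τ : Equiv.Perm (Fin 4), ((Equiv.Perm.sign τ : ℤ) : ℝ) *
      ∏ i : Fin 4, partialReal (τ i) (ghat g m (σ i.succ)) p)

/-! ### The topological invariants -/

/-- `J U → L` as the open vicinity `U` of `S` shrinks to `S`, whatever its shape. -/
def LimitOfShrinkingVicinities {V : Type*} [NormedAddCommGroup V] (S : Set Mom)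
    (J : Set Mom → V) (L : V) : Prop :=
  ∀ ε > 0, ∃ r > 0, ∀ U : Set Mom, IsOpen U → S ⊆ U → U ⊆ Metric.thickening r S →
    ‖J U - L‖ < ε

/-- The derivatives in the forms below make sense: `𝒢` and `𝒢⁻¹` are differentiable away from the
zeros and poles. -/
def IsRegular (G : Mom → SpinMat) : Prop :=
  ∀ p ∉ zerosAndPoles G, ∀ i j, DifferentiableAt ℝ (fun q => G q i j) p ∧
    DifferentiableAt ℝ (fun q => (G q)⁻¹ i j) p

/-- `Ñ₄` is well defined and has the value `N`: with vicinities `U` of the zeros and poles of `𝒢`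
removed from the Brillouin zone `ℳ`,
`(1 / 48π²) Tr γ⁵ ∫_{ℳ \ U} d𝒢⁻¹∧d𝒢∧d𝒢⁻¹∧d𝒢` converges absolutely and tends to `N` as `U`
shrinks. -/
def HasN4 (γ : Fin 4 → SpinMat) (G : Mom → SpinMat) (N : ℝ) : Prop :=
  IsRegular G ∧
  (∀ U : Set Mom, IsOpen U → zerosAndPoles G ⊆ U →
    IntegrableOn (form4 γ G) (brillouinZone \ U)) ∧
  LimitOfShrinkingVicinities (zerosAndPoles G)
    (fun U => (1 / (48 * (Real.pi : ℂ) ^ 2)) * ∫ p in brillouinZone \ U, form4 γ G p) (N : ℂ)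

/-- `(1 / 2π³ 5! i) Tr ∫ (G dG⁻¹)^{∧5}` over `(ℳ \ U) × ℝ`, where `U` is a vicinity of the zeros and
poles, converges absolutely and tends to `N` as `U` shrinks. -/
def HasN5 (γ : Fin 4 → SpinMat) (G : Mom → SpinMat) (N : ℝ) : Prop :=
  IsRegular G ∧
  (∀ U : Set Mom, IsOpen U → zerosAndPoles G ⊆ U →
    IntegrableOn (form5 γ G) {q | (fun i : Fin 4 => q i.castSucc) ∈ brillouinZone \ U}) ∧
  LimitOfShrinkingVicinities (zerosAndPoles G)
    (fun U => (1 / (2 * (Real.pi : ℂ) ^ 3 * (Nat.factorial 5 : ℂ) * Complex.I)) *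
      ∫ q in {q : Fin 5 → ℝ | (fun i : Fin 4 => q i.castSucc) ∈ brillouinZone \ U},
        form5 γ G q) (N : ℂ)

/-- `(3 / 4π² 4!) ε_{abcde} ∫ ĝᵃ dĝᵇ∧dĝᶜ∧dĝᵈ∧dĝᵉ` over `ℳ \ U`, where `U` is a vicinity of the
zeros and poles of `𝒢 = 1 / (gⁱγⁱ - i m)`, converges absolutely and tends to `N` as `U` shrinks. -/
def HasN5Sphere (γ : Fin 4 → SpinMat) (g : Mom → Fin 4 → ℝ) (m : Mom → ℝ) (N : ℝ) : Prop :=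
  (∀ p ∉ zerosAndPoles (green γ g m), ∀ a, DifferentiableAt ℝ (ghat g m a) p) ∧
  (∀ U : Set Mom, IsOpen U → zerosAndPoles (green γ g m) ⊆ U →
    IntegrableOn (formSphere g m) (brillouinZone \ U)) ∧
  LimitOfShrinkingVicinities (zerosAndPoles (green γ g m))
    (fun U => 3 / (4 * Real.pi ^ 2 * (Nat.factorial 4 : ℝ)) *
      ∫ p in brillouinZone \ U, formSphere g m p) N

/-! ### Free overlap fermions -/

/-- `A(p) = -m₀ + ∑ᵢ (1 - cos pⁱ)`. -/
def overlapA (m₀ : ℝ) (p : Mom) : ℝ := -m₀ + ∑ i, (1 - Real.cos (p i))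

/-- `gⁱ(p) = 2 m₀ sin pⁱ (A + √(A² + ∑ₖ sin² pᵏ)) / ∑ₖ sin² pᵏ`. Where all `sin pᵏ` vanish the
value is `0`; this is the limit when `A < 0`. -/
def overlapG (m₀ : ℝ) (p : Mom) (i : Fin 4) : ℝ :=
  2 * m₀ * Real.sin (p i) *
    ((overlapA m₀ p + Real.sqrt (overlapA m₀ p ^ 2 + ∑ k, Real.sin (p k) ^ 2)) /
      ∑ k, Real.sin (p k) ^ 2)

/-- The Green function of free overlap fermions with bare mass parameters `m₀` and `m`. -/
def overlapGreen (γ : Fin 4 → SpinMat) (m₀ m : ℝ) : Mom → SpinMat :=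
  green γ (overlapG m₀) (fun _ => m)

/-- The points `p_n = (π n₁, π n₂, π n₃, π n₄)`, `nᵢ ∈ {0, 1}`. -/
def corner (n : Fin 4 → Fin 2) : Mom := fun i => Real.pi * ((n i : ℕ) : ℝ)

/-- The unparticle propagator near `p_n`, as a function of `δp = p - p_n`:
`(1 / 2m₀) / (∑ᵢ (-1)^{nᵢ} (δpⁱ / |δp|) γⁱ - i m / 2m₀)`, with the Euclidean length `|δp|`. -/
def unparticlePropagator (γ : Fin 4 → SpinMat) (m₀ m : ℝ) (n : Fin 4 → Fin 2) (δ : Mom) :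
    SpinMat :=
  (1 / (2 * (m₀ : ℂ))) •
    (∑ i, (((-1 : ℝ) ^ (n i : ℕ) * (δ i / Real.sqrt (∑ k, δ k ^ 2)) : ℝ) : ℂ) • γ i
      - (Complex.I * (m : ℂ) / (2 * (m₀ : ℂ))) • (1 : SpinMat))⁻¹

end OverlapFermion

end

open Filter Topology MeasureTheory

noncomputable section

namespace OverlapFermion


/-! ### Clifford algebra -/

/-! The Clifford algebra turns all three integrands into one Jacobian. With J = ∂g they are 96 m²
det J/(g² + m²)³, 480 i m det J/(g² + m² + p₅²)³ and 24 m det J/(g² + m²)^{5/2} (`form4_eq`,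
`form5_eq`, `formSphere_eq`). Since ∫ dx/(a² + x²)³ = 3π/(8a⁵), the third is, up to a constant, the
second integrated over p₅, so the two versions of 𝒩₅ agree. Everything then follows from the
integral of det J/(g² + w)³ for all w > 0 (`integral_density`): w = m² gives Ñ₄, and integration
over w = m² + p₅² gives 𝒩₅.

That integral is π²/(2w) times the degree of g as a map into ℝ⁴ ∪ {∞}. On ℝ⁴ the form d⁴y/(y² + w)³
is the differential of (1/4w)(y²/(y² + w))² times the angular 3-form, and for y = g(p) the direction
y/|y| is that of ± sin p. Put s = ∑ sin² pᵏ and Φ = ¼(g²/(g² + w))². The pullback is the field Φ sin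
pⁱ ∏_{j≠i} cos pʲ / s², whose divergence is w times the density wherever s ≠ 0. A smooth cutoff in
τs removes the singularities at s = 0, and the total flux through the period cell vanishes
(`integral_density_cutoff`). The term in which the derivative falls on the cutoff is Φ · 2τ² e^{-τs}
∏ cos pᵏ; for τ → ∞ it concentrates at the 16 corners with masses ±2π²
(`tendsto_integral_prim_heatKernel`). There Φ = 1/4 if A > 0 (g infinite, a zero of 𝒢) and Φ = 0 if
A < 0 (g = 0), whence the alternating sum of signs.

For m₀ outside {0, 2, 4, 6, 8} the root R = √(A² + s) is bounded below, and the density is at most a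
constant over s, which is integrable in four dimensions. The zeros of 𝒢 lie in the null set s = 0,
so excising vicinities of them changes nothing in the limit.

For m₀ = 2k and a corner with A = 0, A is of second order in δp while R is asymptotic to |δp|. Hence
gⁱ is asymptotic to 2m₀(-1)^{nᵢ} δpⁱ/|δp| (`tendsto_overlapG_sub_radialField`), a field of constant
nonzero length that is odd in δp, so neither 𝒢 nor 𝒢⁻¹ can have a limit. -/

/-- The Clifford relations for a family of `n` matrices. -/
def IsClifford {n : ℕ} (Γ : Fin n → SpinMat) : Prop :=
  ∀ i j, Γ i * Γ j + Γ j * Γ i = if i = j then 2 else 0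

theorem IsClifford.anticomm {n : ℕ} {Γ : Fin n → SpinMat} (h : IsClifford Γ) {i j : Fin n}
    (hij : i ≠ j) : Γ i * Γ j = -(Γ j * Γ i) := by
  have := h i j
  rw [if_neg hij] at this
  exact eq_neg_of_add_eq_zero_left this

theorem IsClifford.sq {n : ℕ} {Γ : Fin n → SpinMat} (h : IsClifford Γ) (i : Fin n) :
    Γ i * Γ i = 1 := by
  have h1 := h i i
  rw [if_pos rfl] at h1
  have h2 : (2 : ℂ) • (Γ i * Γ i) = (2 : ℂ) • (1 : SpinMat) := by
    rw [two_smul, two_smul, h1, one_add_one_eq_two]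
  exact smul_right_injective _ (two_ne_zero) h2

/-- Conjugation by the involution `u` preserves the trace and flips the sign of `X`. With
`SemiconjBy`, the sign of a long product is assembled factor by factor through `mul_right`. -/
theorem trace_eq_zero_of_anticomm {u X : SpinMat} (hu : u * u = 1) (h : SemiconjBy u X (-X)) :
    X.trace = 0 := by
  have h1 : (u * X * u).trace = X.trace := by
    rw [mul_assoc, Matrix.trace_mul_comm, mul_assoc, hu, mul_one]
  have h2 : (u * X * u).trace = -X.trace := by
    rw [h.eq, mul_assoc, hu, mul_one, Matrix.trace_neg]
  rw [h1] at h2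
  exact self_eq_neg.1 h2

theorem IsClifford.semiconj {n : ℕ} {Γ : Fin n → SpinMat} (h : IsClifford Γ) {i j : Fin n}
    (hij : i ≠ j) : SemiconjBy (Γ i) (Γ j) (-Γ j) := by
  rw [SemiconjBy, neg_mul]; exact h.anticomm hij

/-- `v̸ = vᵃ Γₐ`. -/
def slash {n : ℕ} (Γ : Fin n → SpinMat) : (Fin n → ℂ) →ₗ[ℂ] SpinMat :=
  Fintype.linearCombination ℂ Γ

theorem slash_apply {n : ℕ} (Γ : Fin n → SpinMat) (v : Fin n → ℂ) :
    slash Γ v = ∑ i, v i • Γ i := Fintype.linearCombination_apply ℂ Γ v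

theorem slash_single {n : ℕ} (Γ : Fin n → SpinMat) (i : Fin n) :
    slash Γ (Pi.single i 1) = Γ i := by
  simp [slash]

theorem slash_anticomm {n : ℕ} {Γ : Fin n → SpinMat} (h : IsClifford Γ) (v w : Fin n → ℂ) :
    slash Γ v * slash Γ w + slash Γ w * slash Γ v = (2 * ∑ i, v i * w i) • (1 : SpinMat) := by
  simp only [slash_apply, Finset.sum_mul_sum]
  rw [Finset.sum_comm (f := fun i j => w i • Γ i * v j • Γ j), ← Finset.sum_add_distrib]
  have : ∀ i j, v i • Γ i * w j • Γ j + w j • Γ j * v i • Γ i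
      = (v i * w j) • (if i = j then (2 : SpinMat) else 0) := by
    intro i j
    rw [← h i j, smul_mul_smul_comm, smul_mul_smul_comm, mul_comm (w j), smul_add]
  simp only [← Finset.sum_add_distrib, this]
  have h2 : (2 : SpinMat) = (2 : ℂ) • 1 := by
    rw [two_smul, one_add_one_eq_two]
  simp only [smul_ite, smul_zero, Finset.sum_ite_eq, Finset.mem_univ, if_true]
  rw [h2, Finset.mul_sum, Finset.sum_smul]
  refine Finset.sum_congr rfl fun i _ => ?_
  rw [smul_smul]; congr 1; ring

theorem slash_sq {n : ℕ} {Γ : Fin n → SpinMat} (h : IsClifford Γ) (v : Fin n → ℂ) :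
    slash Γ v * slash Γ v = (∑ i, v i * v i) • (1 : SpinMat) := by
  have h1 := slash_anticomm h v v
  rw [← two_smul ℂ, mul_smul] at h1
  exact smul_right_injective _ (two_ne_zero) h1

/-- `(x̸ + c) v̸ (x̸ + c) = -(x² - c²) v̸ + 2 ⟨x, v⟩ (x̸ + c)`. -/
theorem sandwich {n : ℕ} {Γ : Fin n → SpinMat} (h : IsClifford Γ) (x v : Fin n → ℂ) (c : ℂ) :
    (slash Γ x + c • 1) * slash Γ v * (slash Γ x + c • 1)
      = (-(∑ i, x i * x i - c ^ 2)) • slash Γ v + (2 * ∑ i, x i * v i) • (slash Γ x + c • 1) := by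
  have h1 := slash_anticomm h x v
  have h2 := slash_sq h x
  have h3 : slash Γ x * slash Γ v = (2 * ∑ i, x i * v i) • (1 : SpinMat)
      - slash Γ v * slash Γ x := eq_sub_of_add_eq h1
  have h4 : (slash Γ x + c • 1) * slash Γ v = (2 * ∑ i, x i * v i) • (1 : SpinMat)
      + slash Γ v * (c • 1 - slash Γ x) := by
    rw [add_mul, h3, mul_sub]; simp; abel
  have h5 : (c • 1 - slash Γ x) * (slash Γ x + c • 1)
      = (-(∑ i, x i * x i - c ^ 2)) • (1 : SpinMat) := by
    rw [sub_mul, mul_add, mul_add, h2]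
    simp only [smul_mul_assoc, mul_smul_comm, one_mul, mul_one, smul_smul]
    module
  rw [h4, add_mul, mul_assoc, h5]; simp [add_comm]

theorem slash_sub_mul {n : ℕ} {Γ : Fin n → SpinMat} (h : IsClifford Γ) (x : Fin n → ℂ) (c : ℂ) :
    (slash Γ x - c • 1) * (slash Γ x + c • 1) = (∑ i, x i * x i - c ^ 2) • (1 : SpinMat) := by
  rw [sub_mul, mul_add, mul_add, slash_sq h]
  simp only [smul_mul_assoc, mul_smul_comm, one_mul, mul_one, smul_smul]
  module

theorem slash_sub_inv {n : ℕ} {Γ : Fin n → SpinMat} (h : IsClifford Γ) (x : Fin n → ℂ) (c : ℂ)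
    (hR : ∑ i, x i * x i - c ^ 2 ≠ 0) :
    (slash Γ x - c • 1)⁻¹ = (∑ i, x i * x i - c ^ 2)⁻¹ • (slash Γ x + c • 1) := by
  apply Matrix.inv_eq_right_inv
  rw [Matrix.mul_smul, slash_sub_mul h, smul_smul, inv_mul_cancel₀ hR, one_smul]

/-! ### Antisymmetrized sums -/

-- The claim is multiplicative in σ, so adjacent transpositions suffice. The family `a` is
-- generalized in the induction because the second factor acts on the permuted family.
open Equiv in
theorem prod_perm_four {a : Fin 4 → SpinMat} (ha : ∀ i j, i ≠ j → a i * a j = -(a j * a i))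
    (σ : Perm (Fin 4)) :
    a (σ 0) * a (σ 1) * a (σ 2) * a (σ 3)
      = ((Perm.sign σ : ℤ) : ℂ) • (a 0 * a 1 * a 2 * a 3) := by
  have hσ : σ ∈ Submonoid.closure (Set.range fun i : Fin 3 ↦ swap i.castSucc i.succ) := by
    rw [Perm.mclosure_swap_castSucc_succ]; trivial
  induction hσ using Submonoid.closure_induction generalizing a with
  | one => simp
  | mul σ τ _ _ h1 h2 =>
    have := h2 (a := fun i => a (σ i)) fun i j hij => ha _ _ (σ.injective.ne hij)
    simp only [Perm.mul_apply, Perm.sign_mul] at this ⊢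
    rw [this, h1 ha, smul_smul]; push_cast; rw [mul_comm]
  | mem σ h =>
    obtain ⟨i, rfl⟩ := h
    have h' : ∀ i j, i ≠ j → ∀ z, a i * (a j * z) = -(a j * (a i * z)) := by
      intro i j hij z
      rw [← mul_assoc, ha i j hij, neg_mul, mul_assoc]
    have hs : ((Perm.sign (swap i.castSucc i.succ) : ℤ) : ℂ) = -1 := by
      rw [Perm.sign_swap (by simp [Fin.ext_iff])]; simp
    simp only [hs]
    fin_cases i <;> simp [swap_apply_def, mul_assoc]
    · exact h' 1 0 (by decide) _
    · rw [h' 2 1 (by decide)]; simp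
    · rw [ha 3 2 (by decide)]; simp

open Equiv in
theorem prod_perm_five {a : Fin 5 → SpinMat} (ha : ∀ i j, i ≠ j → a i * a j = -(a j * a i))
    (σ : Perm (Fin 5)) :
    a (σ 0) * a (σ 1) * a (σ 2) * a (σ 3) * a (σ 4)
      = ((Perm.sign σ : ℤ) : ℂ) • (a 0 * a 1 * a 2 * a 3 * a 4) := by
  have hσ : σ ∈ Submonoid.closure (Set.range fun i : Fin 4 ↦ swap i.castSucc i.succ) := by
    rw [Perm.mclosure_swap_castSucc_succ]; trivial
  induction hσ using Submonoid.closure_induction generalizing a with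
  | one => simp
  | mul σ τ _ _ h1 h2 =>
    have := h2 (a := fun i => a (σ i)) fun i j hij => ha _ _ (σ.injective.ne hij)
    simp only [Perm.mul_apply, Perm.sign_mul] at this ⊢
    rw [this, h1 ha, smul_smul]; push_cast; rw [mul_comm]
  | mem σ h =>
    obtain ⟨i, rfl⟩ := h
    have h' : ∀ i j, i ≠ j → ∀ z, a i * (a j * z) = -(a j * (a i * z)) := by
      intro i j hij z
      rw [← mul_assoc, ha i j hij, neg_mul, mul_assoc]
    have hs : ((Perm.sign (swap i.castSucc i.succ) : ℤ) : ℂ) = -1 := by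
      rw [Perm.sign_swap (by simp [Fin.ext_iff])]; simp
    simp only [hs]
    fin_cases i <;> simp [swap_apply_def, mul_assoc]
    · exact h' 1 0 (by decide) _
    · rw [h' 2 1 (by decide)]; simp
    · rw [h' 3 2 (by decide)]; simp
    · rw [ha 4 3 (by decide)]; simp

/-- The terms of σ and σ∘(i j) cancel. This removes every contribution symmetric in two slots. -/
theorem sum_sign_mul_eq_zero {n : ℕ} {i j : Fin n} (hij : i ≠ j) (h : Equiv.Perm (Fin n) → ℂ)
    (hh : ∀ σ, h (σ * Equiv.swap i j) = h σ) :
    ∑ σ : Equiv.Perm (Fin n), ((Equiv.Perm.sign σ : ℤ) : ℂ) * h σ = 0 := by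
  have h1 := Equiv.sum_comp (Equiv.mulRight (Equiv.swap i j))
    (fun σ : Equiv.Perm (Fin n) => ((Equiv.Perm.sign σ : ℤ) : ℂ) * h σ)
  simp only [Equiv.coe_mulRight, hh, Equiv.Perm.sign_mul, Equiv.Perm.sign_swap hij] at h1
  simp only [mul_neg, mul_one, Units.val_neg, Int.cast_neg, neg_mul, Finset.sum_neg_distrib] at h1
  exact self_eq_neg.1 h1.symm

/-- The left side does not depend on `j`, and summing it over the four values of `j` gives 4! ∑ f;
hence 24/4 = 6. -/
theorem sum_perm_apply (f : Fin 4 → ℂ) (j : Fin 4) :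
    ∑ σ : Equiv.Perm (Fin 4), f (σ j) = 6 * ∑ i, f i := by
  have h1 : ∀ k, ∑ σ : Equiv.Perm (Fin 4), f (σ k) = ∑ σ : Equiv.Perm (Fin 4), f (σ j) := by
    intro k
    rw [← Equiv.sum_comp (Equiv.mulRight (Equiv.swap k j))]
    simp
  have h2 : ∑ k, ∑ σ : Equiv.Perm (Fin 4), f (σ k) = 24 * ∑ i, f i := by
    rw [Finset.sum_comm]
    simp only [Equiv.sum_comp]
    simp [Fintype.card_perm, Nat.factorial]
  simp only [h1] at h2
  simp at h2
  linear_combination (1 / 4) * h2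

/-- Alternating n-forms on an n-dimensional space are multiples of the determinant. Thus a
top-degree form needs evaluation only on the basis, that is, on the gamma matrices themselves; the
map p ↦ g(p) enters through its Jacobian alone. -/
theorem alternatization_eq_det {n : ℕ} (f : MultilinearMap ℂ (fun _ : Fin n => Fin n → ℂ) ℂ)
    (J : Fin n → Fin n → ℂ) :
    ∑ σ : Equiv.Perm (Fin n), ((Equiv.Perm.sign σ : ℤ) : ℂ) * f (fun i => J (σ i))
      = (Matrix.of J).det * ∑ σ : Equiv.Perm (Fin n),
          ((Equiv.Perm.sign σ : ℤ) : ℂ) * f (fun i => Pi.single (σ i) 1) := by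
  have h1 : ∀ v : Fin n → Fin n → ℂ, MultilinearMap.alternatization f v
      = ∑ σ : Equiv.Perm (Fin n), ((Equiv.Perm.sign σ : ℤ) : ℂ) * f (fun i => v (σ i)) := by
    intro v
    rw [MultilinearMap.alternatization_apply]
    refine Finset.sum_congr rfl fun σ _ => ?_
    simp [Units.smul_def, MultilinearMap.domDomCongr_apply]
  have h2 : ∀ v : Fin n → Fin n → ℂ, MultilinearMap.alternatization f v
      = (Matrix.of v).det * MultilinearMap.alternatization f (fun i => Pi.single i 1) := by
    intro v
    have h3 : (⇑(Pi.basisFun ℂ (Fin n)) : Fin n → Fin n → ℂ) = fun i => Pi.single i 1 := by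
      ext i; simp
    conv_lhs => rw [AlternatingMap.eq_smul_basis_det (Pi.basisFun ℂ (Fin n))
      (MultilinearMap.alternatization f)]
    rw [AlternatingMap.smul_apply, Pi.basisFun_det_apply, smul_eq_mul, mul_comm, h3]
  rw [← h1 J, h2 J, h1]

/-- The relation M a M = -R a + 2yM is applied so that each of the last three terms is visibly
symmetric in two slots (2 and 3, 0 and 4, 0 and 2) and dies under antisymmetrization, while the two
four-factor traces vanish outright. Only the R² term with all five factors survives. -/
theorem trace_sandwich_five {M a₀ a₁ a₂ a₃ a₄ : SpinMat} {R y₀ y₂ y₃ y₄ : ℂ}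
    (h₀ : M * a₀ * M = (-R) • a₀ + (2 * y₀) • M) (h₂ : M * a₂ * M = (-R) • a₂ + (2 * y₂) • M)
    (h₃ : M * a₃ * M = (-R) • a₃ + (2 * y₃) • M) (h₄ : M * a₄ * M = (-R) • a₄ + (2 * y₄) • M) :
    (M * a₀ * (M * a₁) * (M * a₂) * (M * a₃) * (M * a₄)).trace
      = R ^ 2 * (a₀ * a₁ * a₂ * a₃ * M * a₄).trace + 2 * R ^ 2 * y₂ * (a₀ * a₁ * a₃ * a₄).trace
        + 2 * R ^ 2 * y₀ * (a₁ * a₂ * a₃ * a₄).trace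
        - 4 * R * (y₂ * y₃ * (a₀ * a₁ * M * a₄).trace) - 4 * R * (y₀ * y₄ * (a₁ * a₂ * a₃ * M).trace)
        + 4 * (y₀ * y₂ * (M * a₁ * M * a₃ * M * a₄).trace) := by
  have e1 : M * a₀ * (M * a₁) * (M * a₂) * (M * a₃) * (M * a₄)
      = (M * a₀ * M) * a₁ * (M * a₂ * M) * a₃ * M * a₄ := by simp only [mul_assoc]
  have e2 : (M * a₀ * M) * a₁ * (M * a₂ * M) * a₃ * M * a₄
      = R ^ 2 • (a₀ * a₁ * a₂ * a₃ * M * a₄) - (2 * R * y₂) • (a₀ * a₁ * (M * a₃ * M) * a₄)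
        - (2 * R * y₀) • (M * (a₁ * a₂ * a₃ * M * a₄))
        + (4 * y₀ * y₂) • (M * a₁ * M * a₃ * M * a₄) := by
    rw [h₀, h₂]
    simp only [add_mul, mul_add, smul_mul_assoc, mul_smul_comm, smul_add, smul_smul, mul_assoc]
    module
  have e3 : (M * (a₁ * a₂ * a₃ * M * a₄)).trace = (a₁ * a₂ * a₃ * (M * a₄ * M)).trace := by
    rw [Matrix.trace_mul_comm]; simp only [mul_assoc]
  rw [e1, e2]
  simp only [Matrix.trace_add, Matrix.trace_sub, Matrix.trace_smul, smul_eq_mul, e3]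
  rw [h₃, h₄]
  simp only [add_mul, mul_add, smul_mul_assoc, mul_smul_comm, Matrix.trace_add, Matrix.trace_smul,
    smul_eq_mul]
  ring

theorem trace_four {a₀ a₁ a₂ a₃ : SpinMat} (hs : a₀ * a₀ = 1) (h₁ : SemiconjBy a₀ a₁ (-a₁))
    (h₂ : SemiconjBy a₀ a₂ (-a₂)) (h₃ : SemiconjBy a₀ a₃ (-a₃)) :
    (a₀ * a₁ * a₂ * a₃).trace = 0 := by
  have h₀ : SemiconjBy a₀ a₀ a₀ := rfl
  refine trace_eq_zero_of_anticomm hs ?_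
  simpa using ((h₀.mul_right h₁).mul_right h₂).mul_right h₃

/-- The antisymmetrized trace entering `(G dG⁻¹)^{∧5}`. -/
theorem sum_sign_trace_five {Γ : Fin 5 → SpinMat} (h : IsClifford Γ)
    (hprod : Γ 0 * Γ 1 * Γ 2 * Γ 3 * Γ 4 = 1) (x : Fin 5 → ℂ) (c : ℂ) :
    ∑ σ : Equiv.Perm (Fin 5), ((Equiv.Perm.sign σ : ℤ) : ℂ) *
      ((slash Γ x + c • 1) * Γ (σ 0) * ((slash Γ x + c • 1) * Γ (σ 1)) *
        ((slash Γ x + c • 1) * Γ (σ 2)) * ((slash Γ x + c • 1) * Γ (σ 3)) *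
        ((slash Γ x + c • 1) * Γ (σ 4))).trace
      = 480 * c * (∑ i, x i * x i - c ^ 2) ^ 2 := by
  set M := slash Γ x + c • 1 with hM
  set R := ∑ i, x i * x i - c ^ 2 with hR
  have hS : ∀ i, M * Γ i * M = (-R) • Γ i + (2 * x i) • M := by
    intro i
    have := sandwich h x (Pi.single i 1) c
    have e : ∑ k, x k * (Pi.single i 1 : _ → ℂ) k = x i := by simp [Pi.single_apply]
    rwa [slash_single, e] at this
  have hsc : ∀ σ : Equiv.Perm (Fin 5), ∀ i j, i ≠ j →
      SemiconjBy (Γ (σ i)) (Γ (σ j)) (-Γ (σ j)) := fun σ i j hij =>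
    h.semiconj (σ.injective.ne hij)
  have key : ∀ σ : Equiv.Perm (Fin 5),
      (Γ (σ 0) * Γ (σ 1) * Γ (σ 2) * Γ (σ 3) * M * Γ (σ 4)).trace
        = 4 * c * ((Equiv.Perm.sign σ : ℤ) : ℂ) := by
    intro σ
    -- The conjugating matrix occurs exactly once among the six factors, so it passes the other five
    -- with total sign -1. If Γ e repeats Γ (σ 0), then Γ (σ 1) takes over this role.
    have h6 : ∀ e, (Γ (σ 0) * Γ (σ 1) * Γ (σ 2) * Γ (σ 3) * Γ e * Γ (σ 4)).trace = 0 := by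
      intro e
      by_cases he : e = σ 0
      · refine trace_eq_zero_of_anticomm (u := Γ (σ 1)) (h.sq _) ?_
        subst he
        have h₁ : SemiconjBy (Γ (σ 1)) (Γ (σ 1)) (Γ (σ 1)) := rfl
        simpa using (((((hsc σ 1 0 (by decide)).mul_right h₁).mul_right
          (hsc σ 1 2 (by decide))).mul_right (hsc σ 1 3 (by decide))).mul_right
          (hsc σ 1 0 (by decide))).mul_right (hsc σ 1 4 (by decide))
      · refine trace_eq_zero_of_anticomm (u := Γ (σ 0)) (h.sq _) ?_
        have h₁ : SemiconjBy (Γ (σ 0)) (Γ (σ 0)) (Γ (σ 0)) := rfl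
        simpa using ((((h₁.mul_right (hsc σ 0 1 (by decide))).mul_right
          (hsc σ 0 2 (by decide))).mul_right (hsc σ 0 3 (by decide))).mul_right
          (h.semiconj (Ne.symm he))).mul_right (hsc σ 0 4 (by decide))
    rw [hM, slash_apply]
    simp only [mul_add, add_mul, Finset.mul_sum, Finset.sum_mul, mul_smul_comm, smul_mul_assoc,
      mul_one, Matrix.trace_add, Matrix.trace_sum, Matrix.trace_smul, h6, smul_zero,
      Finset.sum_const_zero, zero_add]
    rw [prod_perm_five (fun i j hij => h.anticomm hij) σ, hprod]
    simp; ring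
  have expand := fun σ : Equiv.Perm (Fin 5) => trace_sandwich_five (a₁ := Γ (σ 1))
    (hS (σ 0)) (hS (σ 2)) (hS (σ 3)) (hS (σ 4))
  have t1 : ∀ σ : Equiv.Perm (Fin 5), (Γ (σ 0) * Γ (σ 1) * Γ (σ 3) * Γ (σ 4)).trace = 0 :=
    fun σ => trace_four (h.sq _) (hsc σ _ _ (by decide)) (hsc σ _ _ (by decide))
      (hsc σ _ _ (by decide))
  have t2 : ∀ σ : Equiv.Perm (Fin 5), (Γ (σ 1) * Γ (σ 2) * Γ (σ 3) * Γ (σ 4)).trace = 0 :=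
    fun σ => trace_four (h.sq _) (hsc σ _ _ (by decide)) (hsc σ _ _ (by decide))
      (hsc σ _ _ (by decide))
  have z1 := sum_sign_mul_eq_zero (i := (2 : Fin 5)) (j := 3) (by decide)
    (fun σ => x (σ 2) * x (σ 3) * (Γ (σ 0) * Γ (σ 1) * M * Γ (σ 4)).trace)
    (by intro σ; simp [Equiv.swap_apply_def, mul_comm (x (σ 3))])
  have z2 := sum_sign_mul_eq_zero (i := (0 : Fin 5)) (j := 4) (by decide)
    (fun σ => x (σ 0) * x (σ 4) * (Γ (σ 1) * Γ (σ 2) * Γ (σ 3) * M).trace)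
    (by intro σ; simp [Equiv.swap_apply_def, mul_comm (x (σ 4))])
  have z3 := sum_sign_mul_eq_zero (i := (0 : Fin 5)) (j := 2) (by decide)
    (fun σ => x (σ 0) * x (σ 2) * (M * Γ (σ 1) * M * Γ (σ 3) * M * Γ (σ 4)).trace)
    (by intro σ; simp [Equiv.swap_apply_def, mul_comm (x (σ 2))])
  simp only [expand, key, t1, t2, mul_zero, add_zero]
  have hsq : ∀ σ : Equiv.Perm (Fin 5),
      ((Equiv.Perm.sign σ : ℤ) : ℂ) * ((Equiv.Perm.sign σ : ℤ) : ℂ) = 1 := by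
    intro σ
    rw [← Int.cast_mul, ← Units.val_mul, Int.units_mul_self]; simp
  have hterm : ∀ σ : Equiv.Perm (Fin 5), ∀ A B C : ℂ,
      ((Equiv.Perm.sign σ : ℤ) : ℂ) * (R ^ 2 * (4 * c * ((Equiv.Perm.sign σ : ℤ) : ℂ))
        - 4 * R * A - 4 * R * B + 4 * C)
      = 4 * c * R ^ 2 - 4 * R * (((Equiv.Perm.sign σ : ℤ) : ℂ) * A)
        - 4 * R * (((Equiv.Perm.sign σ : ℤ) : ℂ) * B)
        + 4 * (((Equiv.Perm.sign σ : ℤ) : ℂ) * C) := by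
    intro σ A B C
    linear_combination (4 * c * R ^ 2) * hsq σ
  simp only [hterm, Finset.sum_add_distrib, Finset.sum_sub_distrib, ← Finset.mul_sum, z1, z2, z3]
  simp [Fintype.card_perm, Nat.factorial]
  ring

/-- The y₁y₃ term is symmetric in slots 1 and 3. Unlike in the five-factor case, the terms linear in
y survive: after summation they turn R² into R(R - x²) = -c²R. -/
theorem trace_sandwich_four {g₅ M a₀ a₁ a₂ a₃ : SpinMat} {R y₁ y₃ : ℂ}
    (h₁ : M * a₁ * M = (-R) • a₁ + (2 * y₁) • M) (h₃ : M * a₃ * M = (-R) • a₃ + (2 * y₃) • M) :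
    (g₅ * (a₀ * (M * a₁ * M) * a₂ * (M * a₃ * M))).trace
      = R ^ 2 * (g₅ * a₀ * a₁ * a₂ * a₃).trace - 2 * R * y₃ * (g₅ * a₀ * a₁ * a₂ * M).trace
        - 2 * R * y₁ * (g₅ * a₀ * M * a₂ * a₃).trace
        + 4 * (y₁ * y₃ * (g₅ * a₀ * M * a₂ * M).trace) := by
  rw [h₁, h₃]
  simp only [add_mul, mul_add, smul_mul_assoc, mul_smul_comm, Matrix.trace_add, Matrix.trace_smul,
    smul_eq_mul, ← mul_assoc]
  ring

/-- The antisymmetrized trace entering `Tr γ⁵ d𝒢⁻¹∧d𝒢∧d𝒢⁻¹∧d𝒢`. -/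
theorem sum_sign_trace_four {Γ : Fin 4 → SpinMat} (h : IsClifford Γ) {g₅ : SpinMat}
    (h5sq : g₅ * g₅ = 1) (h5 : ∀ i, SemiconjBy (Γ i) g₅ (-g₅))
    (hprod : Γ 0 * Γ 1 * Γ 2 * Γ 3 = g₅) (x : Fin 4 → ℂ) (c : ℂ) :
    ∑ σ : Equiv.Perm (Fin 4), ((Equiv.Perm.sign σ : ℤ) : ℂ) *
      (g₅ * (Γ (σ 0) * ((slash Γ x + c • 1) * Γ (σ 1) * (slash Γ x + c • 1)) * Γ (σ 2) *
        ((slash Γ x + c • 1) * Γ (σ 3) * (slash Γ x + c • 1)))).trace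
      = 96 * (-c ^ 2) * (∑ i, x i * x i - c ^ 2) := by
  set M := slash Γ x + c • 1 with hM
  set R := ∑ i, x i * x i - c ^ 2 with hR
  have hS : ∀ i, M * Γ i * M = (-R) • Γ i + (2 * x i) • M := by
    intro i
    have := sandwich h x (Pi.single i 1) c
    have e : ∑ k, x k * (Pi.single i 1 : _ → ℂ) k = x i := by simp [Pi.single_apply]
    rwa [slash_single, e] at this
  have h5' : ∀ i, SemiconjBy g₅ (Γ i) (-Γ i) := by
    intro i
    have := (h5 i).eq
    rw [SemiconjBy, neg_mul, this]; simp
  have hsc : ∀ σ : Equiv.Perm (Fin 4), ∀ i j, i ≠ j →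
      SemiconjBy (Γ (σ i)) (Γ (σ j)) (-Γ (σ j)) := fun σ i j hij =>
    h.semiconj (σ.injective.ne hij)
  have h55 : SemiconjBy g₅ g₅ g₅ := rfl
  have k0 : ∀ σ : Equiv.Perm (Fin 4), (g₅ * Γ (σ 0) * Γ (σ 1) * Γ (σ 2) * Γ (σ 3)).trace
      = 4 * ((Equiv.Perm.sign σ : ℤ) : ℂ) := by
    intro σ
    have : g₅ * Γ (σ 0) * Γ (σ 1) * Γ (σ 2) * Γ (σ 3)
        = g₅ * (Γ (σ 0) * Γ (σ 1) * Γ (σ 2) * Γ (σ 3)) := by simp only [mul_assoc]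
    rw [this, prod_perm_four (fun i j hij => h.anticomm hij) σ, hprod, mul_smul_comm, h5sq]
    simp; ring
  have k3 : ∀ σ : Equiv.Perm (Fin 4), (g₅ * Γ (σ 0) * Γ (σ 1) * Γ (σ 2) * M).trace
      = 4 * x (σ 3) * ((Equiv.Perm.sign σ : ℤ) : ℂ) := by
    intro σ
    have hc : (g₅ * Γ (σ 0) * Γ (σ 1) * Γ (σ 2)).trace = 0 :=
      trace_four h5sq (h5' _) (h5' _) (h5' _)
    -- Only the gamma matrix absent from the other slots completes the product to a multiple of
    -- `g₅`; any other choice gives a product that anticommutes with the absent one.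
    have he : ∀ e, (g₅ * Γ (σ 0) * Γ (σ 1) * Γ (σ 2) * Γ e).trace
        = if e = σ 3 then 4 * ((Equiv.Perm.sign σ : ℤ) : ℂ) else 0 := by
      intro e
      split_ifs with h'
      · rw [h', k0]
      · refine trace_eq_zero_of_anticomm (u := Γ (σ 3)) (h.sq _) ?_
        simpa using ((((h5 (σ 3)).mul_right (hsc σ 3 0 (by decide))).mul_right
          (hsc σ 3 1 (by decide))).mul_right (hsc σ 3 2 (by decide))).mul_right
          (h.semiconj (Ne.symm h'))
    rw [hM, slash_apply]
    simp only [mul_add, Finset.mul_sum, mul_smul_comm, mul_one, Matrix.trace_add,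
      Matrix.trace_sum, Matrix.trace_smul, hc, he, add_zero, smul_eq_mul, mul_ite,
      mul_zero, Finset.sum_ite_eq', Finset.mem_univ, if_true]
    ring
  have k1 : ∀ σ : Equiv.Perm (Fin 4), (g₅ * Γ (σ 0) * M * Γ (σ 2) * Γ (σ 3)).trace
      = 4 * x (σ 1) * ((Equiv.Perm.sign σ : ℤ) : ℂ) := by
    intro σ
    have hc : (g₅ * Γ (σ 0) * Γ (σ 2) * Γ (σ 3)).trace = 0 :=
      trace_four h5sq (h5' _) (h5' _) (h5' _)
    have he : ∀ e, (g₅ * Γ (σ 0) * Γ e * Γ (σ 2) * Γ (σ 3)).trace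
        = if e = σ 1 then 4 * ((Equiv.Perm.sign σ : ℤ) : ℂ) else 0 := by
      intro e
      split_ifs with h'
      · rw [h', k0]
      · refine trace_eq_zero_of_anticomm (u := Γ (σ 1)) (h.sq _) ?_
        simpa using ((((h5 (σ 1)).mul_right (hsc σ 1 0 (by decide))).mul_right
          (h.semiconj (Ne.symm h'))).mul_right (hsc σ 1 2 (by decide))).mul_right
          (hsc σ 1 3 (by decide))
    rw [hM, slash_apply]
    simp only [mul_add, add_mul, Finset.mul_sum, Finset.sum_mul, mul_smul_comm, smul_mul_assoc,
      mul_one, Matrix.trace_add,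
      Matrix.trace_sum, Matrix.trace_smul, hc, he, add_zero, smul_eq_mul, mul_ite,
      mul_zero, Finset.sum_ite_eq', Finset.mem_univ, if_true]
    ring
  have expand := fun σ : Equiv.Perm (Fin 4) => trace_sandwich_four (g₅ := g₅) (a₀ := Γ (σ 0))
    (a₂ := Γ (σ 2)) (hS (σ 1)) (hS (σ 3))
  have z1 := sum_sign_mul_eq_zero (i := (1 : Fin 4)) (j := 3) (by decide)
    (fun σ => x (σ 1) * x (σ 3) * (g₅ * Γ (σ 0) * M * Γ (σ 2) * M).trace)
    (by intro σ; simp [Equiv.swap_apply_def, mul_comm (x (σ 3))])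
  simp only [expand, k0, k1, k3]
  have hsq : ∀ σ : Equiv.Perm (Fin 4),
      ((Equiv.Perm.sign σ : ℤ) : ℂ) * ((Equiv.Perm.sign σ : ℤ) : ℂ) = 1 := by
    intro σ
    rw [← Int.cast_mul, ← Units.val_mul, Int.units_mul_self]; simp
  have hterm : ∀ σ : Equiv.Perm (Fin 4), ∀ A : ℂ,
      ((Equiv.Perm.sign σ : ℤ) : ℂ) * (R ^ 2 * (4 * ((Equiv.Perm.sign σ : ℤ) : ℂ))
        - 2 * R * x (σ 3) * (4 * x (σ 3) * ((Equiv.Perm.sign σ : ℤ) : ℂ))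
        - 2 * R * x (σ 1) * (4 * x (σ 1) * ((Equiv.Perm.sign σ : ℤ) : ℂ)) + 4 * A)
      = 4 * R ^ 2 - 8 * R * (x (σ 3) * x (σ 3)) - 8 * R * (x (σ 1) * x (σ 1))
        + 4 * (((Equiv.Perm.sign σ : ℤ) : ℂ) * A) := by
    intro σ A
    linear_combination (4 * R ^ 2 - 8 * R * (x (σ 3) * x (σ 3)) - 8 * R * (x (σ 1) * x (σ 1)))
      * hsq σ
  simp only [hterm, Finset.sum_add_distrib, Finset.sum_sub_distrib, ← Finset.mul_sum, z1,
    sum_perm_apply (fun i => x i * x i)]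
  simp [Fintype.card_perm, Nat.factorial]
  rw [hR]; ring

/-! ### The chirality matrix and the five-dimensional Clifford family. -/

theorem IsClifford.gamma5_semiconj {γ : Fin 4 → SpinMat} (h : IsClifford γ) (i : Fin 4) :
    SemiconjBy (γ i) (gamma5 γ) (-gamma5 γ) := by
  have hs : ∀ j, SemiconjBy (γ i) (γ j) (if i = j then γ j else -γ j) := by
    intro j
    split_ifs with hij
    · subst hij; rfl
    · exact h.semiconj hij
  have := (((hs 0).mul_right (hs 1)).mul_right (hs 2)).mul_right (hs 3)
  unfold gamma5
  fin_cases i <;> simpa using this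

theorem IsClifford.gamma5_sq {γ : Fin 4 → SpinMat} (h : IsClifford γ) :
    gamma5 γ * gamma5 γ = 1 := by
  have hrev := prod_perm_four (fun i j hij => h.anticomm hij) (Fin.revPerm : Equiv.Perm (Fin 4))
  have hsign : Equiv.Perm.sign (Fin.revPerm : Equiv.Perm (Fin 4)) = 1 := by decide
  -- Reversing four factors is an even permutation (six inversions), so γ⁵ equals its own reversal
  -- and the square telescopes.
  have e : gamma5 γ = γ 3 * γ 2 * γ 1 * γ 0 := by
    rw [hsign] at hrev
    simpa [gamma5] using hrev.symm
  have e' : gamma5 γ * gamma5 γ = γ 3 * γ 2 * γ 1 * γ 0 * (γ 0 * γ 1 * γ 2 * γ 3) :=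
    congrArg (· * gamma5 γ) e
  rw [e']
  have hz : ∀ i z, γ i * (γ i * z) = z := by
    intro i z; rw [← mul_assoc, h.sq, one_mul]
  simp only [mul_assoc, hz, h.sq]

/-- The five anticommuting matrices `(γ¹, γ², γ³, γ⁴, γ⁵)`. -/
def gammaFive (γ : Fin 4 → SpinMat) : Fin 5 → SpinMat := Fin.snoc γ (gamma5 γ)

theorem gammaFive_castSucc (γ : Fin 4 → SpinMat) (i : Fin 4) :
    gammaFive γ i.castSucc = γ i := by simp [gammaFive]

theorem gammaFive_last (γ : Fin 4 → SpinMat) : gammaFive γ (Fin.last 4) = gamma5 γ :=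
  Fin.snoc_last _ _

theorem IsClifford.gammaFive {γ : Fin 4 → SpinMat} (h : IsClifford γ) :
    IsClifford (gammaFive γ) := by
  intro i j
  have h5 : ∀ i, γ i * gamma5 γ + gamma5 γ * γ i = 0 := by
    intro i; rw [(h.gamma5_semiconj i).eq]; simp
  refine Fin.lastCases ?_ (fun i => ?_) i <;> refine Fin.lastCases ?_ (fun j => ?_) j
  · rw [gammaFive_last, h.gamma5_sq, if_pos rfl, one_add_one_eq_two]
  · rw [gammaFive_last, gammaFive_castSucc, add_comm, h5, if_neg (Fin.castSucc_lt_last j).ne']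
  · rw [gammaFive_last, gammaFive_castSucc, h5, if_neg (Fin.castSucc_lt_last i).ne]
  · simp only [gammaFive_castSucc, Fin.castSucc_inj]; exact h i j

theorem IsClifford.gammaFive_prod {γ : Fin 4 → SpinMat} (h : IsClifford γ) :
    OverlapFermion.gammaFive γ 0 * OverlapFermion.gammaFive γ 1 * OverlapFermion.gammaFive γ 2 *
      OverlapFermion.gammaFive γ 3 * OverlapFermion.gammaFive γ 4 = 1 := by
  have e0 := gammaFive_castSucc γ 0
  have e1 := gammaFive_castSucc γ 1
  have e2 := gammaFive_castSucc γ 2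
  have e3 := gammaFive_castSucc γ 3
  have e4 := gammaFive_last γ
  simp only [Fin.castSucc_zero, Fin.reduceCastSucc, Fin.reduceLast] at e0 e1 e2 e3 e4
  rw [e0, e1, e2, e3, e4]
  exact h.gamma5_sq


/-! ### The differential forms as Jacobians -/

theorem denom_pos {n : ℕ} (g : Fin n → ℝ) {m : ℝ} (hm : m ≠ 0) : 0 < ∑ i, g i ^ 2 + m ^ 2 :=
  add_pos_of_nonneg_of_pos (Finset.sum_nonneg fun _ _ => sq_nonneg _) (by positivity)

theorem ofReal_denom {n : ℕ} (g : Fin n → ℝ) (m : ℝ) :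
    ∑ i, (g i : ℂ) * (g i : ℂ) - (Complex.I * (m : ℂ)) ^ 2 = ((∑ i, g i ^ 2 + m ^ 2 : ℝ) : ℂ) := by
  push_cast
  rw [mul_pow, Complex.I_sq]
  simp [pow_two]

theorem green_eq {γ : Fin 4 → SpinMat} (hγ : IsClifford γ) (g : Mom → Fin 4 → ℝ) (m : ℝ) (p : Mom)
    (hR : ∑ i, g p i ^ 2 + m ^ 2 ≠ 0) :
    green γ g (fun _ => m) p = ((∑ i, g p i ^ 2 + m ^ 2 : ℝ) : ℂ)⁻¹ •
      (slash γ (fun i => (g p i : ℂ)) + (Complex.I * (m : ℂ)) • 1) := by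
  unfold green
  rw [← slash_apply, slash_sub_inv hγ, ofReal_denom]
  rw [ofReal_denom]; exact_mod_cast hR

theorem green_inv {γ : Fin 4 → SpinMat} (hγ : IsClifford γ) (g : Mom → Fin 4 → ℝ) (m : ℝ) (p : Mom)
    (hR : ∑ i, g p i ^ 2 + m ^ 2 ≠ 0) :
    (green γ g (fun _ => m) p)⁻¹ = slash γ (fun i => (g p i : ℂ)) - (Complex.I * (m : ℂ)) • 1 := by
  unfold green
  rw [← slash_apply]
  apply Matrix.nonsing_inv_nonsing_inv
  refine Matrix.isUnit_det_of_right_inverse (B := ((∑ i, g p i ^ 2 + m ^ 2 : ℝ) : ℂ)⁻¹ •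
      (slash γ (fun i => (g p i : ℂ)) + (Complex.I * (m : ℂ)) • 1)) ?_
  rw [Matrix.mul_smul, slash_sub_mul hγ, smul_smul, ofReal_denom, inv_mul_cancel₀, one_smul]
  exact_mod_cast hR

theorem hasLineDerivAt_slash {N n : ℕ} (Γ : Fin n → SpinMat) {f : (Fin N → ℝ) → Fin n → ℝ}
    {J : Fin n → ℝ} {p v : Fin N → ℝ} (hf : ∀ a, HasLineDerivAt ℝ (fun q => f q a) (J a) p v)
    {k : (Fin N → ℝ) → ℂ} {k' : ℂ} (hk : HasLineDerivAt ℝ k k' p v) (i j : Fin 4) :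
    HasLineDerivAt ℝ
      (fun q => (slash Γ (fun a => (f q a : ℂ)) + k q • (1 : SpinMat)) i j)
      ((slash Γ (fun a => (J a : ℂ)) + k' • (1 : SpinMat)) i j) p v := by
  simp only [slash_apply, Matrix.add_apply, Matrix.sum_apply, Matrix.smul_apply, smul_eq_mul]
  unfold HasLineDerivAt at *
  exact (HasDerivAt.fun_sum fun a _ => ((hf a).ofReal_comp.mul_const (Γ a i j))).add
    (hk.mul_const _)

theorem partialMat_green_inv {γ : Fin 4 → SpinMat} (hγ : IsClifford γ) {g : Mom → Fin 4 → ℝ}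
    {m : ℝ} (hm : m ≠ 0) {p : Mom} {μ : Fin 4} {J : Fin 4 → ℝ}
    (hg : ∀ a, HasLineDerivAt ℝ (fun q => g q a) (J a) p (Pi.single μ 1)) :
    partialMat μ (fun q => (green γ g (fun _ => m) q)⁻¹) p = slash γ (fun a => (J a : ℂ)) := by
  ext i j
  have h := hasLineDerivAt_slash γ hg (k := fun _ => -(Complex.I * (m : ℂ))) (k' := 0)
    (hasDerivAt_const _ _) i j
  rw [zero_smul, add_zero] at h
  rw [partialMat, Matrix.of_apply, ← h.lineDeriv]
  congr 1
  ext q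
  rw [green_inv hγ g m q (denom_pos _ hm).ne', neg_smul, sub_eq_add_neg]

/-- This is d(X⁻¹) = -X⁻¹ dX X⁻¹ with X⁻¹ = M/R. The derivation differentiates the explicit quotient
entrywise, and `sandwich` identifies the result with M dX M. -/
theorem partialMat_green {γ : Fin 4 → SpinMat} (hγ : IsClifford γ) {g : Mom → Fin 4 → ℝ}
    {m : ℝ} (hm : m ≠ 0) {p : Mom} {μ : Fin 4} {J : Fin 4 → ℝ}
    (hg : ∀ a, HasLineDerivAt ℝ (fun q => g q a) (J a) p (Pi.single μ 1)) :
    partialMat μ (green γ g (fun _ => m)) p = (-((∑ i, g p i ^ 2 + m ^ 2 : ℝ) : ℂ)⁻¹ ^ 2) •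
      ((slash γ (fun i => (g p i : ℂ)) + (Complex.I * (m : ℂ)) • 1) * slash γ (fun a => (J a : ℂ)) *
        (slash γ (fun i => (g p i : ℂ)) + (Complex.I * (m : ℂ)) • 1)) := by
  ext i j
  have hR := (denom_pos (g p) hm).ne'
  have hR' : HasLineDerivAt ℝ (fun q => ∑ i, g q i ^ 2 + m ^ 2) (2 * ∑ i, g p i * J i) p
      (Pi.single μ 1) := by
    unfold HasLineDerivAt at *
    exact ((HasDerivAt.fun_sum fun a (_ : a ∈ Finset.univ) => (hg a).fun_pow 2).add_const
      (m ^ 2)).congr_deriv (by simp [Finset.mul_sum, mul_assoc])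
  have hd := hasLineDerivAt_slash γ (p := p) (v := Pi.single μ 1)
    (f := fun q a => g q a / (∑ i, g q i ^ 2 + m ^ 2))
    (J := fun a => (J a * (∑ i, g p i ^ 2 + m ^ 2) - g p a * (2 * ∑ i, g p i * J i)) /
      (∑ i, g p i ^ 2 + m ^ 2) ^ 2)
    (fun a => by
      unfold HasLineDerivAt at *
      have := (hg a).fun_div hR' (by simpa using hR)
      simpa using this)
    (k := fun q => Complex.I * (m : ℂ) * (((∑ i, g q i ^ 2 + m ^ 2)⁻¹ : ℝ) : ℂ))
    (k' := Complex.I * (m : ℂ) *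
      ((-(2 * ∑ i, g p i * J i) / (∑ i, g p i ^ 2 + m ^ 2) ^ 2 : ℝ) : ℂ))
    (by
      unfold HasLineDerivAt at *
      have := (hR'.fun_inv (by simpa using hR)).ofReal_comp.const_mul (Complex.I * (m : ℂ))
      simpa using this) i j
  have e1 : (fun q => green γ g (fun _ => m) q i j) = fun q =>
      (slash γ (fun a => ((g q a / (∑ i, g q i ^ 2 + m ^ 2) : ℝ) : ℂ)) +
        (Complex.I * (m : ℂ) * (((∑ i, g q i ^ 2 + m ^ 2)⁻¹ : ℝ) : ℂ)) • (1 : SpinMat)) i j := by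
    ext q
    rw [green_eq hγ g m q (denom_pos _ hm).ne']
    have e : (fun a => ((g q a / (∑ i, g q i ^ 2 + m ^ 2) : ℝ) : ℂ))
        = ((∑ i, g q i ^ 2 + m ^ 2 : ℝ) : ℂ)⁻¹ • fun a => (g q a : ℂ) := by
      ext a; simp [div_eq_inv_mul]
    rw [e, smul_add, smul_smul, ← map_smul, Complex.ofReal_inv, mul_comm (Complex.I * (m : ℂ))]
  rw [partialMat, Matrix.of_apply, e1, hd.lineDeriv]
  rw [sandwich hγ, ofReal_denom]
  set R := ∑ i, g p i ^ 2 + m ^ 2 with hRdef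
  have hRc : (R : ℂ) ≠ 0 := by exact_mod_cast hR
  have e2 : (fun a => (((J a * R - g p a * (2 * ∑ i, g p i * J i)) / R ^ 2 : ℝ) : ℂ))
      = (R : ℂ)⁻¹ • (fun a => (J a : ℂ))
        + (-(2 * ∑ i, (g p i : ℂ) * (J i : ℂ)) * (R : ℂ)⁻¹ ^ 2) • (fun a => (g p a : ℂ)) := by
    ext a
    simp only [Pi.add_apply, Pi.smul_apply, smul_eq_mul]
    push_cast
    field_simp
    ring
  rw [e2, map_add, map_smul, map_smul]
  push_cast
  simp only [smul_add, smul_smul]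
  have e3 : -(R : ℂ)⁻¹ ^ 2 * -(R : ℂ) = (R : ℂ)⁻¹ := by field_simp
  rw [e3]
  have e4 : Complex.I * (m : ℂ) * (-(2 * ∑ i, (g p i : ℂ) * (J i : ℂ)) / (R : ℂ) ^ 2)
      = -(R : ℂ)⁻¹ ^ 2 * (2 * ∑ i, (g p i : ℂ) * (J i : ℂ)) * (Complex.I * (m : ℂ)) := by
    field_simp
  rw [e4, add_assoc]
  ring_nf

theorem det_ofReal {n : ℕ} (J : Fin n → Fin n → ℝ) :
    (Matrix.of fun μ a => (J μ a : ℂ)).det = ((Matrix.of J).det : ℂ) := by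
  have := RingHom.map_det Complex.ofRealHom (Matrix.of J)
  simpa [RingHom.mapMatrix_apply, Matrix.map] using this.symm

/-- `Tr γ⁵ d𝒢⁻¹∧d𝒢∧d𝒢⁻¹∧d𝒢 = 96 m² det(∂g) / (g² + m²)³ d⁴p`. -/
theorem form4_eq {γ : Fin 4 → SpinMat} (hγ : IsClifford γ) {g : Mom → Fin 4 → ℝ}
    {m : ℝ} (hm : m ≠ 0) {p : Mom} {J : Fin 4 → Fin 4 → ℝ}
    (hg : ∀ μ a, HasLineDerivAt ℝ (fun q => g q a) (J μ a) p (Pi.single μ 1)) :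
    form4 γ (green γ g (fun _ => m)) p =
      ((96 * m ^ 2 * ((Matrix.of J).det / (∑ i, g p i ^ 2 + m ^ 2) ^ 3) : ℝ) : ℂ) := by
  set R := ∑ i, g p i ^ 2 + m ^ 2 with hRdef
  have hR : R ≠ 0 := (denom_pos (g p) hm).ne'
  have hRc : (R : ℂ) ≠ 0 := by exact_mod_cast hR
  set M : SpinMat := slash γ (fun i => (g p i : ℂ)) + (Complex.I * (m : ℂ)) • 1 with hM
  let L : (Fin 4 → ℂ) →ₗ[ℂ] SpinMat := LinearMap.mulRight ℂ M ∘ₗ LinearMap.mulLeft ℂ M ∘ₗ slash γ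
  let f : MultilinearMap ℂ (fun _ : Fin 4 => Fin 4 → ℂ) ℂ :=
    (Matrix.traceLinearMap (Fin 4) ℂ ℂ ∘ₗ LinearMap.mulLeft ℂ (gamma5 γ)).compMultilinearMap
      ((MultilinearMap.mkPiAlgebraFin ℂ 4 SpinMat).compLinearMap ![slash γ, L, slash γ, L])
  have hf : ∀ v, f v = (gamma5 γ * (slash γ (v 0) * (M * slash γ (v 1) * M) * slash γ (v 2) *
      (M * slash γ (v 3) * M))).trace := by
    intro v
    simp [f, L, List.ofFn_succ, mul_assoc]
  have h1 := alternatization_eq_det f (fun μ a => (J μ a : ℂ))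
  have h2 := sum_sign_trace_four hγ hγ.gamma5_sq hγ.gamma5_semiconj rfl
    (fun i => (g p i : ℂ)) (Complex.I * (m : ℂ))
  simp only [hf, slash_single] at h1
  rw [← hM] at h2
  rw [h2, det_ofReal, ofReal_denom, mul_pow, Complex.I_sq, ← hRdef] at h1
  unfold form4
  have h3 : ∀ σ : Equiv.Perm (Fin 4), ((Equiv.Perm.sign σ : ℤ) : ℂ) *
      Matrix.trace (gamma5 γ * (partialMat (σ 0) (fun q => (green γ g (fun _ => m) q)⁻¹) p *
        partialMat (σ 1) (green γ g (fun _ => m)) p *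
        partialMat (σ 2) (fun q => (green γ g (fun _ => m) q)⁻¹) p *
        partialMat (σ 3) (green γ g (fun _ => m)) p))
      = (R : ℂ)⁻¹ ^ 4 * (((Equiv.Perm.sign σ : ℤ) : ℂ) *
        (gamma5 γ * (slash γ (fun a => (J (σ 0) a : ℂ)) *
        (M * slash γ (fun a => (J (σ 1) a : ℂ)) * M) * slash γ (fun a => (J (σ 2) a : ℂ)) *
        (M * slash γ (fun a => (J (σ 3) a : ℂ)) * M))).trace) := by
    intro σ
    rw [partialMat_green_inv hγ hm (hg (σ 0)), partialMat_green_inv hγ hm (hg (σ 2)),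
      partialMat_green hγ hm (hg (σ 1)), partialMat_green hγ hm (hg (σ 3)), ← hM, ← hRdef]
    simp only [smul_mul_assoc, mul_smul_comm, Matrix.trace_smul, smul_eq_mul]
    ring
  rw [Finset.sum_congr rfl fun σ _ => h3 σ, ← Finset.mul_sum, h1]
  push_cast
  field_simp

theorem greenInv5_eq {γ : Fin 4 → SpinMat} (hγ : IsClifford γ) {g : Mom → Fin 4 → ℝ}
    {m : ℝ} (hm : m ≠ 0) (q : Fin 5 → ℝ) :
    greenInv5 γ (green γ g (fun _ => m)) q =
      slash (gammaFive γ)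
        (fun a => ((Fin.snoc (g fun i => q i.castSucc) (q 4) : Fin 5 → ℝ) a : ℂ))
        - (Complex.I * (m : ℂ)) • 1 := by
  unfold greenInv5
  rw [green_inv hγ g m _ (denom_pos _ hm).ne', slash_apply, slash_apply, Fin.sum_univ_castSucc (n := 4)]
  simp only [Fin.snoc_castSucc, gammaFive_castSucc, gammaFive_last, Fin.snoc_last]
  abel

/-- The Jacobian in (p, p₅) is block diagonal with blocks J and 1, since `g` does not depend on p₅;
its determinant is therefore that of J. -/
theorem partialMat_greenInv5 {γ : Fin 4 → SpinMat} (hγ : IsClifford γ) {g : Mom → Fin 4 → ℝ}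
    {m : ℝ} (hm : m ≠ 0) {q : Fin 5 → ℝ} {J : Fin 4 → Fin 4 → ℝ}
    (hg : ∀ μ a, HasLineDerivAt ℝ (fun p => g p a) (J μ a) (fun i => q i.castSucc)
      (Pi.single μ 1)) (μ : Fin 5) :
    partialMat μ (greenInv5 γ (green γ g (fun _ => m))) q =
      slash (gammaFive γ) (fun a => (((Fin.snoc (fun μ => (Fin.snoc (J μ) 0 : Fin 5 → ℝ))
        (Pi.single (Fin.last 4) 1) : Fin 5 → Fin 5 → ℝ) μ a : ℝ) : ℂ)) := by
  ext i j
  have hd : ∀ a, HasLineDerivAt ℝ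
      (fun q : Fin 5 → ℝ => (Fin.snoc (g fun i => q i.castSucc) (q 4) : Fin 5 → ℝ) a)
      ((Fin.snoc (fun μ => (Fin.snoc (J μ) 0 : Fin 5 → ℝ))
        (Pi.single (Fin.last 4) 1) : Fin 5 → Fin 5 → ℝ) μ a) q (Pi.single μ 1) := by
    intro a
    refine Fin.lastCases ?_ (fun μ => ?_) μ <;> refine Fin.lastCases ?_ (fun a => ?_) a
    · simp only [Fin.snoc_last, Pi.single_eq_same]
      have : HasDerivAt (fun t : ℝ => q (Fin.last 4) + t) 1 0 := (hasDerivAt_id _).const_add _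
      unfold HasLineDerivAt
      refine this.congr_of_eventuallyEq (Eventually.of_forall fun t => ?_)
      simp
    · simp only [Fin.snoc_last, Fin.snoc_castSucc]
      rw [Pi.single_eq_of_ne (Fin.castSucc_lt_last a).ne]
      unfold HasLineDerivAt
      have e : (fun t : ℝ => g (fun i : Fin 4 =>
          (q + t • (Pi.single (Fin.last 4) 1 : Fin 5 → ℝ)) i.castSucc) a)
          = fun _ => g (fun i => q i.castSucc) a := by
        ext t
        congr 2
        ext i
        rw [Pi.add_apply, Pi.smul_apply, Pi.single_eq_of_ne (Fin.castSucc_lt_last i).ne, smul_zero,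
          add_zero]
      rw [e]; exact hasDerivAt_const _ _
    · simp only [Fin.snoc_last, Fin.snoc_castSucc]
      unfold HasLineDerivAt
      have e : (fun t : ℝ => (q + t • (Pi.single μ.castSucc 1 : Fin 5 → ℝ)) 4)
          = fun _ => q 4 := by
        ext t
        have : (Pi.single μ.castSucc 1 : Fin 5 → ℝ) 4 = 0 :=
          Pi.single_eq_of_ne (Fin.castSucc_lt_last μ).ne' _
        simp [this]
      rw [e]; exact hasDerivAt_const _ _
    · simp only [Fin.snoc_castSucc]
      have := hg μ a
      unfold HasLineDerivAt at this ⊢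
      have e : ∀ t : ℝ, (fun i : Fin 4 => (q + t • (Pi.single μ.castSucc 1 : Fin 5 → ℝ)) i.castSucc)
          = (fun i => q i.castSucc) + t • (Pi.single μ 1 : Fin 4 → ℝ) := by
        intro t
        ext i
        simp [Pi.single_apply]
      simp only [e]
      exact this
  have h := hasLineDerivAt_slash (gammaFive γ) hd (k := fun _ => -(Complex.I * (m : ℂ))) (k' := 0)
    (hasDerivAt_const _ _) i j
  rw [zero_smul, add_zero] at h
  rw [partialMat, Matrix.of_apply, ← h.lineDeriv]
  congr 1
  ext q
  rw [greenInv5_eq hγ hm, neg_smul, sub_eq_add_neg]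

/-- `Tr (G dG⁻¹)^{∧5} = 480 i m det(∂g) / (g² + p₅² + m²)³ d⁴p dp₅`. -/
theorem form5_eq {γ : Fin 4 → SpinMat} (hγ : IsClifford γ) {g : Mom → Fin 4 → ℝ}
    {m : ℝ} (hm : m ≠ 0) {q : Fin 5 → ℝ} {J : Fin 4 → Fin 4 → ℝ}
    (hg : ∀ μ a, HasLineDerivAt ℝ (fun p => g p a) (J μ a) (fun i => q i.castSucc)
      (Pi.single μ 1)) :
    form5 γ (green γ g (fun _ => m)) q = 480 * Complex.I * (m : ℂ) *
      (((Matrix.of J).det /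
        (∑ i, g (fun i => q i.castSucc) i ^ 2 + (m ^ 2 + q 4 ^ 2)) ^ 3 : ℝ) : ℂ) := by
  set x : Fin 5 → ℝ := Fin.snoc (g fun i => q i.castSucc) (q 4) with hx
  have hxR : ∑ i, g (fun i => q i.castSucc) i ^ 2 + (m ^ 2 + q 4 ^ 2) = ∑ i, x i ^ 2 + m ^ 2 := by
    rw [Fin.sum_univ_castSucc (n := 4)]
    simp only [hx, Fin.snoc_castSucc, Fin.snoc_last]
    ring
  rw [hxR]
  set R := ∑ i, x i ^ 2 + m ^ 2 with hRdef
  have hR : R ≠ 0 := (denom_pos x hm).ne'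
  have hRc : (R : ℂ) ≠ 0 := by exact_mod_cast hR
  set M : SpinMat := slash (gammaFive γ) (fun i => (x i : ℂ)) + (Complex.I * (m : ℂ)) • 1 with hM
  have hinv : (greenInv5 γ (green γ g (fun _ => m)) q)⁻¹ = (R : ℂ)⁻¹ • M := by
    rw [greenInv5_eq hγ hm, slash_sub_inv hγ.gammaFive, ofReal_denom]
    rw [ofReal_denom]; exact hRc
  set J5 : Fin 5 → Fin 5 → ℝ := Fin.snoc (fun μ => (Fin.snoc (J μ) 0 : Fin 5 → ℝ))
        (Pi.single (Fin.last 4) 1) with hJ5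
  have hdet : (Matrix.of J5).det = (Matrix.of J).det := by
    rw [Matrix.det_succ_row _ (Fin.last 4), Fin.sum_univ_castSucc]
    have h0 : ∀ i : Fin 4, Matrix.of J5 (Fin.last 4) i.castSucc = 0 := by
      intro i
      rw [hJ5, Matrix.of_apply, Fin.snoc_last, Pi.single_eq_of_ne (Fin.castSucc_lt_last i).ne]
    have h1 : Matrix.of J5 (Fin.last 4) (Fin.last 4) = 1 := by
      rw [hJ5, Matrix.of_apply, Fin.snoc_last, Pi.single_eq_same]
    have h2 : (Matrix.of J5).submatrix (Fin.last 4).succAbove (Fin.last 4).succAbove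
        = Matrix.of J := by
      ext i j
      rw [Matrix.submatrix_apply, Fin.succAbove_last, hJ5, Matrix.of_apply, Fin.snoc_castSucc,
        Fin.snoc_castSucc, Matrix.of_apply]
    simp only [h0, h1, h2]
    norm_num
  let L : (Fin 5 → ℂ) →ₗ[ℂ] SpinMat := LinearMap.mulLeft ℂ M ∘ₗ slash (gammaFive γ)
  let f : MultilinearMap ℂ (fun _ : Fin 5 => Fin 5 → ℂ) ℂ :=
    (Matrix.traceLinearMap (Fin 4) ℂ ℂ).compMultilinearMap
      ((MultilinearMap.mkPiAlgebraFin ℂ 5 SpinMat).compLinearMap fun _ => L)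
  have hf : ∀ v, f v = (M * slash (gammaFive γ) (v 0) * (M * slash (gammaFive γ) (v 1)) *
      (M * slash (gammaFive γ) (v 2)) * (M * slash (gammaFive γ) (v 3)) *
      (M * slash (gammaFive γ) (v 4))).trace := by
    intro v
    simp [f, L, List.ofFn_succ, mul_assoc]
  have h1 := alternatization_eq_det f (fun μ a => (J5 μ a : ℂ))
  have h2 := sum_sign_trace_five hγ.gammaFive hγ.gammaFive_prod
    (fun i => (x i : ℂ)) (Complex.I * (m : ℂ))
  simp only [hf, slash_single] at h1
  rw [← hM] at h2
  rw [h2, det_ofReal, ofReal_denom, ← hRdef, hdet] at h1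
  unfold form5
  have h3 : ∀ σ : Equiv.Perm (Fin 5), ((Equiv.Perm.sign σ : ℤ) : ℂ) *
      Matrix.trace (List.ofFn fun i : Fin 5 =>
        (greenInv5 γ (green γ g (fun _ => m)) q)⁻¹ *
          partialMat (σ i) (greenInv5 γ (green γ g (fun _ => m))) q).prod
      = (R : ℂ)⁻¹ ^ 5 * (((Equiv.Perm.sign σ : ℤ) : ℂ) *
        (M * slash (gammaFive γ) (fun a => (J5 (σ 0) a : ℂ)) *
        (M * slash (gammaFive γ) (fun a => (J5 (σ 1) a : ℂ))) *
        (M * slash (gammaFive γ) (fun a => (J5 (σ 2) a : ℂ))) *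
        (M * slash (gammaFive γ) (fun a => (J5 (σ 3) a : ℂ))) *
        (M * slash (gammaFive γ) (fun a => (J5 (σ 4) a : ℂ)))).trace) := by
    intro σ
    rw [hinv]
    simp only [partialMat_greenInv5 hγ hm hg, ← hJ5]
    rw [← hf (fun i a => (J5 (σ i) a : ℂ))]
    simp only [f, L, LinearMap.compMultilinearMap_apply, MultilinearMap.compLinearMap_apply,
      MultilinearMap.mkPiAlgebraFin_apply, Matrix.traceLinearMap_apply, LinearMap.comp_apply,
      LinearMap.mulLeft_apply, List.ofFn_succ, List.ofFn_zero, List.prod_cons, List.prod_nil,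
      smul_mul_assoc, mul_smul_comm, Matrix.trace_smul, smul_eq_mul]
    ring
  rw [Finset.sum_congr rfl fun σ _ => h3 σ, ← Finset.mul_sum, h1]
  push_cast
  field_simp

/-- For fixed τ the sum over σ is a 5×5 determinant whose last four rows are permuted by τ. Its sign
cancels the explicit one, leaving 4! equal terms. -/
theorem sum_sign_sum_sign_eq_det (w : Fin 5 → ℝ) (K : Fin 4 → Fin 5 → ℝ) :
    ∑ σ : Equiv.Perm (Fin 5), ((Equiv.Perm.sign σ : ℤ) : ℝ) * (w (σ 0) *
      ∑ τ : Equiv.Perm (Fin 4), ((Equiv.Perm.sign τ : ℤ) : ℝ) *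
        ∏ i : Fin 4, K (τ i) (σ i.succ))
      = 24 * (Matrix.of (Fin.cons w K : Fin 5 → Fin 5 → ℝ)).det := by
  set B : Matrix (Fin 5) (Fin 5) ℝ := Matrix.of (Fin.cons w K : Fin 5 → Fin 5 → ℝ) with hB
  have h1 : ∀ τ : Equiv.Perm (Fin 4), ∑ σ : Equiv.Perm (Fin 5), ((Equiv.Perm.sign σ : ℤ) : ℝ) *
      (w (σ 0) * ∏ i : Fin 4, K (τ i) (σ i.succ)) = ((Equiv.Perm.sign τ : ℤ) : ℝ) * B.det := by
    intro τ
    have h2 := Matrix.det_permute (Equiv.Perm.decomposeFin.symm (0, τ)) B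
    -- `decomposeFin.symm (0, τ)` fixes row 0 and acts as τ on the others, so it has the sign of τ.
    rw [Equiv.Perm.decomposeFin.symm_sign, if_pos rfl, one_mul] at h2
    rw [← h2, ← Matrix.det_transpose, Matrix.det_apply']
    refine Finset.sum_congr rfl fun σ _ => ?_
    rw [Fin.prod_univ_succ]
    congr 2
  have h3 : ∀ σ : Equiv.Perm (Fin 5), ((Equiv.Perm.sign σ : ℤ) : ℝ) * (w (σ 0) *
      ∑ τ : Equiv.Perm (Fin 4), ((Equiv.Perm.sign τ : ℤ) : ℝ) *
        ∏ i : Fin 4, K (τ i) (σ i.succ)) = ∑ τ : Equiv.Perm (Fin 4),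
      ((Equiv.Perm.sign τ : ℤ) : ℝ) * (((Equiv.Perm.sign σ : ℤ) : ℝ) *
      (w (σ 0) * ∏ i : Fin 4, K (τ i) (σ i.succ))) := by
    intro σ
    rw [Finset.mul_sum, Finset.mul_sum]
    refine Finset.sum_congr rfl fun τ _ => ?_
    ring
  rw [Finset.sum_congr rfl fun σ _ => h3 σ, Finset.sum_comm]
  have h4 : ∀ τ : Equiv.Perm (Fin 4),
      ((Equiv.Perm.sign τ : ℤ) : ℝ) * (((Equiv.Perm.sign τ : ℤ) : ℝ) * B.det) = B.det := by
    intro τ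
    rw [← mul_assoc, ← Int.cast_mul, ← Units.val_mul, Int.units_mul_self]; simp
  simp only [← Finset.mul_sum, h1, h4]
  simp [Fintype.card_perm, Nat.factorial]

/-- `ε_{abcde} ĝᵃ dĝᵇ∧dĝᶜ∧dĝᵈ∧dĝᵉ = 24 m det(∂g) / (g² + m²)^{5/2} d⁴p`. -/
theorem formSphere_eq {g : Mom → Fin 4 → ℝ} {m : ℝ} (hm : m ≠ 0) {p : Mom} {J : Fin 4 → Fin 4 → ℝ}
    (hg : ∀ μ a, HasLineDerivAt ℝ (fun q => g q a) (J μ a) p (Pi.single μ 1)) :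
    formSphere g (fun _ => m) p =
      24 * m * ((Matrix.of J).det / Real.sqrt (∑ i, g p i ^ 2 + m ^ 2) ^ 5) := by
  set N := Real.sqrt (∑ i, g p i ^ 2 + m ^ 2) with hN
  have hNpos : 0 < N := Real.sqrt_pos.2 (denom_pos (g p) hm)
  set n : Fin 5 → ℝ := Fin.snoc (g p) m with hn
  set c : Fin 4 → ℝ := fun μ => -(∑ i, g p i * J μ i) / N / N ^ 2 with hc
  have hK : ∀ μ a, partialReal μ (ghat g (fun _ => m) a) p
      = (Fin.snoc (J μ) 0 : Fin 5 → ℝ) a / N + c μ * n a := by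
    intro μ a
    refine HasLineDerivAt.lineDeriv ?_
    have hR' : HasLineDerivAt ℝ (fun q => ∑ i, g q i ^ 2 + m ^ 2) (2 * ∑ i, g p i * J μ i) p
        (Pi.single μ 1) := by
      have hg' := hg μ
      unfold HasLineDerivAt at *
      exact ((HasDerivAt.fun_sum fun a (_ : a ∈ Finset.univ) => (hg' a).fun_pow 2).add_const
        (m ^ 2)).congr_deriv (by simp [Finset.mul_sum, mul_assoc])
    have hs : HasLineDerivAt ℝ (fun q => Real.sqrt (∑ i, g q i ^ 2 + m ^ 2))
        ((∑ i, g p i * J μ i) / N) p (Pi.single μ 1) := by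
      unfold HasLineDerivAt at *
      refine (hR'.sqrt (by simpa using (denom_pos (g p) hm).ne')).congr_deriv ?_
      simp only [zero_smul, add_zero, ← hN]
      field_simp
    have ha : HasLineDerivAt ℝ (fun q => (Fin.snoc (g q) m : Fin 5 → ℝ) a)
        ((Fin.snoc (J μ) 0 : Fin 5 → ℝ) a) p (Pi.single μ 1) := by
      refine Fin.lastCases ?_ (fun a => ?_) a
      · simp only [Fin.snoc_last]; exact hasDerivAt_const _ _
      · simp only [Fin.snoc_castSucc]; exact hg μ a
    unfold ghat
    unfold HasLineDerivAt at *
    refine (ha.fun_div hs (by simpa using hNpos.ne')).congr_deriv ?_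
    simp only [zero_smul, add_zero, ← hN, ← hn, hc]
    field_simp
    ring
  unfold formSphere
  simp only [hK]
  have h0 : ∀ a, ghat g (fun _ => m) a p = n a / N := fun a => rfl
  simp only [h0]
  rw [sum_sign_sum_sign_eq_det (fun a => n a / N)
    (fun μ a => (Fin.snoc (J μ) 0 : Fin 5 → ℝ) a / N + c μ * n a)]
  set C : Matrix (Fin 5) (Fin 5) ℝ :=
    Matrix.of (Fin.cons n (fun μ => (Fin.snoc (J μ) 0 : Fin 5 → ℝ)) : Fin 5 → Fin 5 → ℝ) with hC
  have h1 : (Matrix.of (Fin.cons (fun a => n a / N) (fun μ a =>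
      (Fin.snoc (J μ) 0 : Fin 5 → ℝ) a / N + c μ * n a) : Fin 5 → Fin 5 → ℝ)).det
      = (N⁻¹ • C).det := by
    -- Differentiating the normalization adds c μ · n to row μ. Since row 0 is n/N, subtracting c μ
    -- · N times row 0 removes it without changing the determinant.
    refine Matrix.det_eq_of_forall_row_eq_smul_add_const (Fin.cons 0 fun μ => c μ * N) 0 rfl ?_
    intro i j
    refine Fin.cases ?_ (fun i => ?_) i
    · simp [hC, div_eq_inv_mul]
    · simp only [hC, Matrix.of_apply, Fin.cons_succ, Fin.cons_zero, Matrix.smul_apply, smul_eq_mul]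
      field_simp
  have h2 : C.det = m * (Matrix.of J).det := by
    rw [Matrix.det_succ_column _ (Fin.last 4), Fin.sum_univ_succ]
    have e0 : C 0 (Fin.last 4) = m := by
      rw [hC, Matrix.of_apply, Fin.cons_zero, hn, Fin.snoc_last]
    have e1 : ∀ i : Fin 4, C i.succ (Fin.last 4) = 0 := by
      intro i
      rw [hC, Matrix.of_apply, Fin.cons_succ, Fin.snoc_last]
    have e2 : C.submatrix (Fin.succAbove 0) (Fin.last 4).succAbove = Matrix.of J := by
      ext i j
      rw [Matrix.submatrix_apply, Fin.succAbove_last, Fin.succAbove_zero, hC, Matrix.of_apply,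
        Fin.cons_succ, Fin.snoc_castSucc, Matrix.of_apply]
    simp only [e0, e1, e2]
    norm_num
  rw [h1, Matrix.det_smul, h2, Fintype.card_fin]
  field_simp


/-! ### Calculus on the Brillouin zone -/

/-- `s(p) = ∑ₖ sin² pᵏ`. -/
def sinSq (p : Mom) : ℝ := ∑ k, Real.sin (p k) ^ 2

/-- `R(p) = √(A² + s)`. -/
def overlapR (m₀ : ℝ) (p : Mom) : ℝ := Real.sqrt (overlapA m₀ p ^ 2 + sinSq p)

/-- `∏ₖ cos pᵏ`. -/
def cosProd (p : Mom) : ℝ := ∏ k, Real.cos (p k)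

/-- `sin pⁱ ∏_{j ≠ i} cos pʲ`. -/
def angField (i : Fin 4) (p : Mom) : ℝ :=
  Real.sin (p i) * ∏ j ∈ Finset.univ.erase i, Real.cos (p j)

/-- `∑ᵢ sin² pⁱ ∏_{j ≠ i} cos pʲ - A ∏ⱼ cos pʲ`. -/
def jacNum (m₀ : ℝ) (p : Mom) : ℝ :=
  ∑ i, Real.sin (p i) * angField i p - overlapA m₀ p * cosProd p

/-- `q = 4 m₀² (R + A) + w (R - A)`, so that `g² + w = q / (R - A)`. -/
def massDenom (m₀ w : ℝ) (p : Mom) : ℝ :=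
  4 * m₀ ^ 2 * (overlapR m₀ p + overlapA m₀ p) + w * (overlapR m₀ p - overlapA m₀ p)

theorem sinSq_nonneg (p : Mom) : 0 ≤ sinSq p := Finset.sum_nonneg fun _ _ => sq_nonneg _

theorem sinSq_eq_zero {p : Mom} : sinSq p = 0 ↔ ∀ i, Real.sin (p i) = 0 := by
  unfold sinSq
  rw [Finset.sum_eq_zero_iff_of_nonneg fun _ _ => sq_nonneg _]
  simp

theorem overlapR_sq (m₀ : ℝ) (p : Mom) : overlapR m₀ p ^ 2 = overlapA m₀ p ^ 2 + sinSq p :=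
  Real.sq_sqrt (add_nonneg (sq_nonneg _) (sinSq_nonneg p))

theorem abs_overlapA_le (m₀ : ℝ) (p : Mom) : |overlapA m₀ p| ≤ overlapR m₀ p :=
  Real.abs_le_sqrt (le_add_of_nonneg_right (sinSq_nonneg p))

theorem sub_mul_add_overlap (m₀ : ℝ) (p : Mom) :
    (overlapR m₀ p - overlapA m₀ p) * (overlapR m₀ p + overlapA m₀ p) = sinSq p := by
  linear_combination overlapR_sq m₀ p

/-- Stands in for `angField` = sin · `cosProd` / cos, with no division by a cosine that may vanish.
-/
theorem cos_mul_angField (i : Fin 4) (p : Mom) :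
    Real.cos (p i) * angField i p = Real.sin (p i) * cosProd p := by
  unfold angField cosProd
  rw [← Finset.mul_prod_erase Finset.univ _ (Finset.mem_univ i)]
  ring

/-- Rationalization by (R - A)(R + A) = s. The new form is smooth at corners with A < 0, where s
vanishes but R - A does not. At s = 0 both sides are 0 because of the factor sin pⁱ. -/
theorem overlapG_eq (m₀ : ℝ) (p : Mom) (i : Fin 4) :
    overlapG m₀ p i = 2 * m₀ * Real.sin (p i) / (overlapR m₀ p - overlapA m₀ p) := by
  have h := sub_mul_add_overlap m₀ p
  unfold overlapG
  rw [← sinSq, ← overlapR]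
  by_cases hs : sinSq p = 0
  · simp [sinSq_eq_zero.1 hs i]
  · have hu : overlapR m₀ p - overlapA m₀ p ≠ 0 := by
      intro h0; rw [h0, zero_mul] at h; exact hs h.symm
    field_simp
    rw [← h]; ring

theorem hasLineDerivAt_coord {f : ℝ → ℝ} {f' : ℝ} {p : Mom} {μ : Fin 4}
    (hf : HasDerivAt f f' (p μ)) (i : Fin 4) :
    HasLineDerivAt ℝ (fun q : Mom => f (q i)) (if i = μ then f' else 0) p (Pi.single μ 1) := by
  unfold HasLineDerivAt
  by_cases h : i = μ
  · subst h
    have h1 : HasDerivAt (fun t : ℝ => (p + t • (Pi.single i 1 : Mom)) i) 1 0 := by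
      simpa using (hasDerivAt_id (0 : ℝ)).const_add (p i)
    have h2 : HasDerivAt f f' ((p + (0 : ℝ) • (Pi.single i 1 : Mom)) i) := by simpa using hf
    simpa [Function.comp_def] using h2.comp (0 : ℝ) h1
  · rw [if_neg h]
    have : (fun t : ℝ => f ((p + t • (Pi.single μ 1 : Mom)) i)) = fun _ => f (p i) := by
      ext t; simp [Pi.single_eq_of_ne h]
    rw [this]; exact hasDerivAt_const _ _

theorem hasLineDerivAt_overlapA (m₀ : ℝ) (p : Mom) (μ : Fin 4) :
    HasLineDerivAt ℝ (overlapA m₀) (Real.sin (p μ)) p (Pi.single μ 1) := by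
  have h := fun i => hasLineDerivAt_coord ((Real.hasDerivAt_cos (p μ)).const_sub 1) i
  unfold HasLineDerivAt at *
  refine ((HasDerivAt.fun_sum fun i (_ : i ∈ Finset.univ) => h i).const_add (-m₀)).congr_deriv ?_
  simp

theorem hasLineDerivAt_sinSq (p : Mom) (μ : Fin 4) :
    HasLineDerivAt ℝ sinSq (2 * Real.sin (p μ) * Real.cos (p μ)) p (Pi.single μ 1) := by
  have h := fun i => hasLineDerivAt_coord ((Real.hasDerivAt_sin (p μ)).fun_pow 2) i
  unfold HasLineDerivAt at *
  refine (HasDerivAt.fun_sum fun i (_ : i ∈ Finset.univ) => h i).congr_deriv ?_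
  simp

theorem hasLineDerivAt_overlapR {m₀ : ℝ} {p : Mom} (hR : 0 < overlapR m₀ p) (μ : Fin 4) :
    HasLineDerivAt ℝ (overlapR m₀)
      (Real.sin (p μ) * (overlapA m₀ p + Real.cos (p μ)) / overlapR m₀ p) p (Pi.single μ 1) := by
  have h1 := hasLineDerivAt_overlapA m₀ p μ
  have h2 := hasLineDerivAt_sinSq p μ
  unfold HasLineDerivAt at *
  refine (((h1.fun_pow 2).fun_add h2).sqrt ?_).congr_deriv ?_
  · simpa using (Real.sqrt_pos.1 hR).ne'
  · simp only [zero_smul, add_zero]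
    rw [← overlapR]
    field_simp
    push_cast
    ring

/-- The Jacobian of `g`. -/
def overlapJac (m₀ : ℝ) (p : Mom) (μ a : Fin 4) : ℝ :=
  2 * m₀ / (overlapR m₀ p - overlapA m₀ p) * ((if a = μ then Real.cos (p μ) else 0) -
    Real.sin (p μ) * ((overlapA m₀ p + Real.cos (p μ)) / overlapR m₀ p - 1) /
      (overlapR m₀ p - overlapA m₀ p) * Real.sin (p a))

theorem hasLineDerivAt_overlapG {m₀ : ℝ} {p : Mom} (hR : 0 < overlapR m₀ p)
    (hu : overlapR m₀ p - overlapA m₀ p ≠ 0) (μ a : Fin 4) :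
    HasLineDerivAt ℝ (fun q => overlapG m₀ q a) (overlapJac m₀ p μ a) p (Pi.single μ 1) := by
  have h1 := hasLineDerivAt_overlapA m₀ p μ
  have h2 := hasLineDerivAt_overlapR hR μ
  have h3 := hasLineDerivAt_coord (Real.hasDerivAt_sin (p μ)) a
  simp only [overlapG_eq]
  unfold HasLineDerivAt at *
  refine ((h3.const_mul (2 * m₀)).fun_div (h2.fun_sub h1) (by simpa using hu)).congr_deriv ?_
  simp only [zero_smul, add_zero]
  unfold overlapJac
  have hR' := hR.ne'
  field_simp

/-- The matrix determinant lemma, in the form that does not invert the diagonal part; here that part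
consists of cosines. -/
theorem det_diagonal_add_rankOne (d x y : Fin 4 → ℝ) :
    (Matrix.of fun μ a : Fin 4 => (if a = μ then d μ else 0) - x μ * y a).det
      = ∏ i, d i - ∑ i, x i * y i * ∏ j ∈ Finset.univ.erase i, d j := by
  have e0 : Finset.univ.erase (0 : Fin 4) = {1, 2, 3} := by decide
  have e1 : Finset.univ.erase (1 : Fin 4) = {0, 2, 3} := by decide
  have e2 : Finset.univ.erase (2 : Fin 4) = {0, 1, 3} := by decide
  have e3 : Finset.univ.erase (3 : Fin 4) = {0, 1, 2} := by decide
  simp [Matrix.det_succ_row_zero, Fin.sum_univ_succ, Fin.prod_univ_succ, Fin.succAbove, e0, e1, e2,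
    e3]
  ring

theorem det_overlapJac {m₀ : ℝ} {p : Mom} (hR : 0 < overlapR m₀ p)
    (hu : overlapR m₀ p - overlapA m₀ p ≠ 0) :
    (Matrix.of (overlapJac m₀ p)).det = 16 * m₀ ^ 4 * jacNum m₀ p /
      (overlapR m₀ p * (overlapR m₀ p - overlapA m₀ p) ^ 4) := by
  set R := overlapR m₀ p with hRdef
  set A := overlapA m₀ p with hA
  have e : Matrix.of (overlapJac m₀ p) = (2 * m₀ / (R - A)) • Matrix.of fun μ a : Fin 4 =>
      (if a = μ then Real.cos (p μ) else 0) -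
        (Real.sin (p μ) * ((A + Real.cos (p μ)) / R - 1) / (R - A)) * Real.sin (p a) := by
    ext μ a
    rfl
  rw [e, Matrix.det_smul, det_diagonal_add_rankOne (fun μ => Real.cos (p μ))
    (fun μ => Real.sin (p μ) * ((A + Real.cos (p μ)) / R - 1) / (R - A))
    (fun a => Real.sin (p a)), Fintype.card_fin]
  have h1 : ∀ i, Real.sin (p i) * ((A + Real.cos (p i)) / R - 1) / (R - A) * Real.sin (p i) *
      ∏ j ∈ Finset.univ.erase i, Real.cos (p j)
      = (A - R) / (R * (R - A)) * (Real.sin (p i) * angField i p)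
        + cosProd p / (R * (R - A)) * Real.sin (p i) ^ 2 := by
    intro i
    have := cos_mul_angField i p
    have hR' := hR.ne'
    rw [show Real.sin (p i) * ((A + Real.cos (p i)) / R - 1) / (R - A) * Real.sin (p i) *
      ∏ j ∈ Finset.univ.erase i, Real.cos (p j) = Real.sin (p i) *
      ((A + Real.cos (p i)) / R - 1) / (R - A) * angField i p by unfold angField; ring]
    field_simp
    linear_combination Real.sin (p i) * this
  simp only [h1, Finset.sum_add_distrib, ← Finset.mul_sum]
  have hs := sub_mul_add_overlap m₀ p
  rw [← sinSq, ← hs, ← hRdef, ← hA]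
  unfold jacNum cosProd
  rw [← hA]
  have hR' := hR.ne'
  field_simp
  ring

/-! ### The density, its radial primitive and the flux field. -/

/-- `det(∂g) / (g² + w)³`. -/
def overlapDensity (m₀ w : ℝ) (p : Mom) : ℝ :=
  16 * m₀ ^ 4 * (overlapR m₀ p + overlapA m₀ p) * jacNum m₀ p /
    (overlapR m₀ p * sinSq p * massDenom m₀ w p ^ 3)

theorem sum_overlapG_sq {m₀ : ℝ} {p : Mom} (hu : overlapR m₀ p - overlapA m₀ p ≠ 0) (w : ℝ) :
    ∑ i, overlapG m₀ p i ^ 2 + w = massDenom m₀ w p / (overlapR m₀ p - overlapA m₀ p) := by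
  simp only [overlapG_eq, div_pow, mul_pow]
  rw [← Finset.sum_div, ← Finset.mul_sum, ← sinSq, ← sub_mul_add_overlap m₀ p, massDenom]
  field_simp
  ring

theorem det_div_eq_density {m₀ : ℝ} {p : Mom} (hR : 0 < overlapR m₀ p) (hs : sinSq p ≠ 0) (w : ℝ) :
    (Matrix.of (overlapJac m₀ p)).det / (∑ i, overlapG m₀ p i ^ 2 + w) ^ 3
      = overlapDensity m₀ w p := by
  have h := sub_mul_add_overlap m₀ p
  have hu : overlapR m₀ p - overlapA m₀ p ≠ 0 := by
    intro h0; rw [h0, zero_mul] at h; exact hs h.symm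
  have hX : overlapR m₀ p + overlapA m₀ p ≠ 0 := by
    intro h0; rw [h0, mul_zero] at h; exact hs h.symm
  rw [det_overlapJac hR hu, sum_overlapG_sq hu, overlapDensity, ← h]
  have hR' := hR.ne'
  -- When `massDenom` vanishes both sides are quotients by zero, hence 0, so no sign condition on w
  -- is needed.
  by_cases hq : massDenom m₀ w p = 0
  · simp [hq]
  · field_simp

/-- R + A and R - A are nonnegative, and for R > 0 at least one of them is positive. -/
theorem massDenom_pos {m₀ w : ℝ} (hm₀ : m₀ ≠ 0) (hw : 0 < w) {p : Mom} (hR : 0 < overlapR m₀ p) :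
    0 < massDenom m₀ w p := by
  have h := abs_le.1 (abs_overlapA_le m₀ p)
  have h4 : 0 < 4 * m₀ ^ 2 := by positivity
  unfold massDenom
  rcases lt_or_ge (overlapA m₀ p) 0 with hA | hA
  · have : 0 < w * (overlapR m₀ p - overlapA m₀ p) := mul_pos hw (by linarith)
    have : 0 ≤ 4 * m₀ ^ 2 * (overlapR m₀ p + overlapA m₀ p) := mul_nonneg h4.le (by linarith)
    linarith
  · have : 0 ≤ w * (overlapR m₀ p - overlapA m₀ p) := mul_nonneg hw.le (by linarith)
    have : 0 < 4 * m₀ ^ 2 * (overlapR m₀ p + overlapA m₀ p) := mul_pos h4 (by linarith)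
    linarith

/-- The primitive `¼ (g² / (g² + w))²`. -/
def overlapPrim (m₀ w : ℝ) (p : Mom) : ℝ :=
  4 * m₀ ^ 4 * ((overlapR m₀ p + overlapA m₀ p) / massDenom m₀ w p) ^ 2

theorem hasLineDerivAt_overlapPrim {m₀ w : ℝ} {p : Mom} (hR : 0 < overlapR m₀ p)
    (hq : massDenom m₀ w p ≠ 0) (μ : Fin 4) :
    HasLineDerivAt ℝ (overlapPrim m₀ w)
      (16 * m₀ ^ 4 * w * (overlapR m₀ p + overlapA m₀ p) * Real.sin (p μ) *
        (sinSq p - overlapA m₀ p * Real.cos (p μ)) / (overlapR m₀ p * massDenom m₀ w p ^ 3))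
      p (Pi.single μ 1) := by
  have h1 := hasLineDerivAt_overlapA m₀ p μ
  have h2 := hasLineDerivAt_overlapR hR μ
  unfold HasLineDerivAt at *
  have hX := h2.fun_add h1
  have hu := h2.fun_sub h1
  have hqd := (hX.const_mul (4 * m₀ ^ 2)).fun_add (hu.const_mul w)
  refine (((hX.fun_div hqd (by simpa [massDenom] using hq)).fun_pow 2).const_mul
    (4 * m₀ ^ 4)).congr_deriv ?_
  simp only [zero_smul, add_zero]
  rw [← massDenom]
  have hR' := hR.ne'
  have hs : sinSq p = overlapR m₀ p ^ 2 - overlapA m₀ p ^ 2 := by rw [overlapR_sq]; ring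
  rw [hs]
  push_cast
  field_simp
  unfold massDenom
  ring

/-- The heat kernel cutoff `(1 - (1 + τ s) e^{-τ s})`. -/
def cutoff (τ : ℝ) (s : ℝ) : ℝ := 1 - (1 + τ * s) * Real.exp (-(τ * s))

theorem hasDerivAt_cutoff (τ s : ℝ) :
    HasDerivAt (cutoff τ) (τ ^ 2 * s * Real.exp (-(τ * s))) s := by
  have h1 : HasDerivAt (fun s => τ * s) τ s := by simpa using (hasDerivAt_id s).const_mul τ
  refine (((h1.const_add 1).fun_mul h1.fun_neg.exp).const_sub 1).congr_deriv ?_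
  ring

/-- The field whose divergence computes the integral of the density. -/
def fluxField (m₀ w τ : ℝ) (i : Fin 4) (p : Mom) : ℝ :=
  overlapPrim m₀ w p * angField i p * (cutoff τ (sinSq p) / sinSq p ^ 2)

theorem hasLineDerivAt_angField (p : Mom) (μ : Fin 4) :
    HasLineDerivAt ℝ (angField μ) (cosProd p) p (Pi.single μ 1) := by
  have h1 := hasLineDerivAt_coord (Real.hasDerivAt_sin (p μ)) μ
  rw [if_pos rfl] at h1
  unfold HasLineDerivAt at *
  have h2 : ∀ t : ℝ, ∏ j ∈ Finset.univ.erase μ, Real.cos ((p + t • (Pi.single μ 1 : Mom)) j)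
      = ∏ j ∈ Finset.univ.erase μ, Real.cos (p j) := by
    intro t
    refine Finset.prod_congr rfl fun j hj => ?_
    simp [Pi.single_eq_of_ne (Finset.ne_of_mem_erase hj)]
  unfold angField
  simp only [h2]
  refine (h1.mul_const _).congr_deriv ?_
  rw [cosProd, ← Finset.mul_prod_erase Finset.univ _ (Finset.mem_univ μ)]

/-- The partial derivatives of `fluxField`. -/
def fluxDeriv (m₀ w τ : ℝ) (μ : Fin 4) (p : Mom) : ℝ :=
  (16 * m₀ ^ 4 * w * (overlapR m₀ p + overlapA m₀ p) * Real.sin (p μ) *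
        (sinSq p - overlapA m₀ p * Real.cos (p μ)) / (overlapR m₀ p * massDenom m₀ w p ^ 3)
      * angField μ p + overlapPrim m₀ w p * cosProd p) * (cutoff τ (sinSq p) / sinSq p ^ 2)
    + overlapPrim m₀ w p * angField μ p * (2 * Real.sin (p μ) * Real.cos (p μ) *
      (τ ^ 2 * Real.exp (-(τ * sinSq p)) / sinSq p - 2 * cutoff τ (sinSq p) / sinSq p ^ 3))

theorem hasLineDerivAt_fluxField {m₀ w τ : ℝ} {p : Mom} (hR : 0 < overlapR m₀ p)
    (hq : massDenom m₀ w p ≠ 0) (hs : sinSq p ≠ 0) (μ : Fin 4) :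
    HasLineDerivAt ℝ (fluxField m₀ w τ μ) (fluxDeriv m₀ w τ μ p) p (Pi.single μ 1) := by
  have h1 := hasLineDerivAt_overlapPrim hR hq μ
  have h2 := hasLineDerivAt_angField p μ
  have h3 := hasLineDerivAt_sinSq p μ
  unfold HasLineDerivAt at *
  have h4 : HasDerivAt (fun t : ℝ => cutoff τ (sinSq (p + t • (Pi.single μ 1 : Mom))))
      (τ ^ 2 * sinSq p * Real.exp (-(τ * sinSq p)) * (2 * Real.sin (p μ) * Real.cos (p μ))) 0 := by
    have h5 : HasDerivAt (cutoff τ) (τ ^ 2 * sinSq p * Real.exp (-(τ * sinSq p)))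
        (sinSq (p + (0 : ℝ) • (Pi.single μ 1 : Mom))) := by
      simpa using hasDerivAt_cutoff τ (sinSq p)
    have h6 := HasDerivAt.comp (h₂ := cutoff τ) (0 : ℝ) h5 h3
    exact h6
  refine ((h1.fun_mul h2).fun_mul (h4.fun_div (h3.fun_pow 2) (by simpa using hs))).congr_deriv ?_
  simp only [zero_smul, add_zero, fluxDeriv]
  push_cast
  field_simp

/-- The field `angField` / s² is the pullback of the closed angular form and has no divergence. What
remains is the derivative of the primitive, giving w times the density, and the derivative of the
cutoff, τ² s e^{-τs}, whose s cancels the singularity. -/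
theorem sum_fluxDeriv {m₀ w τ : ℝ} {p : Mom} (hs : sinSq p ≠ 0) :
    ∑ μ, fluxDeriv m₀ w τ μ p = w * overlapDensity m₀ w p * cutoff τ (sinSq p)
      + overlapPrim m₀ w p * (2 * τ ^ 2 * Real.exp (-(τ * sinSq p)) * cosProd p) := by
  have h1 : ∀ μ, fluxDeriv m₀ w τ μ p
      = 16 * m₀ ^ 4 * w * (overlapR m₀ p + overlapA m₀ p) / (overlapR m₀ p * massDenom m₀ w p ^ 3)
          * (cutoff τ (sinSq p) / sinSq p ^ 2) * sinSq p * (Real.sin (p μ) * angField μ p)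
        + (-(16 * m₀ ^ 4 * w * (overlapR m₀ p + overlapA m₀ p) /
            (overlapR m₀ p * massDenom m₀ w p ^ 3)
          * (cutoff τ (sinSq p) / sinSq p ^ 2) * overlapA m₀ p * cosProd p)
          + overlapPrim m₀ w p * 2 * cosProd p *
          (τ ^ 2 * Real.exp (-(τ * sinSq p)) / sinSq p - 2 * cutoff τ (sinSq p) / sinSq p ^ 3))
          * Real.sin (p μ) ^ 2
        + overlapPrim m₀ w p * cosProd p * (cutoff τ (sinSq p) / sinSq p ^ 2) := by
    intro μ
    unfold fluxDeriv
    linear_combination (-(16 * m₀ ^ 4 * w * (overlapR m₀ p + overlapA m₀ p) /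
            (overlapR m₀ p * massDenom m₀ w p ^ 3)
          * (cutoff τ (sinSq p) / sinSq p ^ 2) * overlapA m₀ p * Real.sin (p μ))
          + overlapPrim m₀ w p * 2 * Real.sin (p μ) *
          (τ ^ 2 * Real.exp (-(τ * sinSq p)) / sinSq p - 2 * cutoff τ (sinSq p) / sinSq p ^ 3))
          * cos_mul_angField μ p
  simp only [h1, Finset.sum_add_distrib, ← Finset.mul_sum]
  rw [← sinSq]
  simp only [Finset.sum_const, Finset.card_univ, Fintype.card_fin, nsmul_eq_mul]
  unfold overlapDensity jacNum
  push_cast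
  -- At R = 0 or `massDenom` = 0 the quotients are 0 by convention, and the remaining terms still
  -- balance.
  by_cases hR : overlapR m₀ p = 0
  · simp [hR]; field_simp; ring
  by_cases hq : massDenom m₀ w p = 0
  · simp [hq]; field_simp; ring
  field_simp
  ring


/-! ### Continuity and integrability -/

@[fun_prop]
theorem continuous_overlapA (m₀ : ℝ) : Continuous (overlapA m₀) := by
  unfold overlapA; fun_prop

@[fun_prop]
theorem continuous_sinSq : Continuous sinSq := by
  unfold sinSq; fun_prop

@[fun_prop]
theorem continuous_overlapR (m₀ : ℝ) : Continuous (overlapR m₀) := by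
  unfold overlapR; fun_prop

@[fun_prop]
theorem continuous_cosProd : Continuous cosProd := by
  unfold cosProd; fun_prop

@[fun_prop]
theorem continuous_angField (i : Fin 4) : Continuous (angField i) := by
  unfold angField; fun_prop

@[fun_prop]
theorem continuous_jacNum (m₀ : ℝ) : Continuous (jacNum m₀) := by
  unfold jacNum; fun_prop

@[fun_prop]
theorem continuous_massDenom (m₀ w : ℝ) : Continuous (massDenom m₀ w) := by
  unfold massDenom; fun_prop

theorem continuous_overlapPrim {m₀ w : ℝ} (hq : ∀ p, massDenom m₀ w p ≠ 0) :
    Continuous (overlapPrim m₀ w) := by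
  unfold overlapPrim
  exact continuous_const.mul ((Continuous.div (by fun_prop) (by fun_prop) hq).pow 2)

@[fun_prop]
theorem differentiable_overlapA (m₀ : ℝ) : Differentiable ℝ (overlapA m₀) := by
  unfold overlapA; fun_prop

@[fun_prop]
theorem differentiable_sinSq : Differentiable ℝ sinSq := by
  unfold sinSq; fun_prop

theorem differentiableAt_overlapR {m₀ : ℝ} {p : Mom} (hR : 0 < overlapR m₀ p) :
    DifferentiableAt ℝ (overlapR m₀) p := by
  unfold overlapR
  exact DifferentiableAt.sqrt (by fun_prop) (Real.sqrt_pos.1 hR).ne'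

@[fun_prop]
theorem differentiable_angField (i : Fin 4) : Differentiable ℝ (angField i) := by
  unfold angField; fun_prop

theorem differentiableAt_fluxField {m₀ w τ : ℝ} {p : Mom} (hR : 0 < overlapR m₀ p)
    (hq : massDenom m₀ w p ≠ 0) (hs : sinSq p ≠ 0) (i : Fin 4) :
    DifferentiableAt ℝ (fluxField m₀ w τ i) p := by
  have h1 := differentiableAt_overlapR hR
  have hA := differentiable_overlapA m₀ p
  have hs' := differentiable_sinSq p
  have hw := differentiable_angField i p
  have hqd : DifferentiableAt ℝ (massDenom m₀ w) p :=
    ((h1.fun_add hA).const_mul (4 * m₀ ^ 2)).fun_add ((h1.fun_sub hA).const_mul w)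
  have h2 : DifferentiableAt ℝ (overlapPrim m₀ w) p := by
    unfold overlapPrim
    simp only [div_eq_mul_inv]
    exact (((h1.fun_add hA).fun_mul (hqd.fun_inv hq)).fun_pow 2).const_mul _
  have h3 : DifferentiableAt ℝ (fun p => cutoff τ (sinSq p)) p :=
    (hasDerivAt_cutoff τ (sinSq p)).differentiableAt.comp p hs'
  unfold fluxField
  simp only [div_eq_mul_inv]
  exact (h2.fun_mul hw).fun_mul (h3.fun_mul ((hs'.fun_pow 2).fun_inv (pow_ne_zero 2 hs)))

/-! ### The zeros of `sinSq` and its integrable negative powers. -/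

theorem countable_sinSq_zero : {p : Mom | sinSq p = 0}.Countable := by
  have h1 : {x : ℝ | Real.sin x = 0}.Countable := by
    refine (Set.countable_range (fun n : ℤ => (n : ℝ) * Real.pi)).mono ?_
    intro x hx
    exact Real.sin_eq_zero_iff.1 hx
  refine (Set.countable_univ_pi (fun _ : Fin 4 => h1)).mono ?_
  intro p hp i _
  exact sinSq_eq_zero.1 hp i

theorem isClosed_sinSq_zero : IsClosed {p : Mom | sinSq p = 0} :=
  isClosed_eq continuous_sinSq continuous_const

theorem volume_sinSq_zero : volume {p : Mom | sinSq p = 0} = 0 :=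
  countable_sinSq_zero.measure_zero _

theorem ae_sinSq_ne_zero (S : Set Mom) : ∀ᵐ p ∂(volume.restrict S), sinSq p ≠ 0 :=
  ae_restrict_of_ae (measure_eq_zero_iff_ae_notMem.1 volume_sinSq_zero)

theorem ae_sin_ne_zero (S : Set Mom) :
    ∀ᵐ p ∂(volume.restrict S), ∀ i, Real.sin (p i) ≠ 0 := by
  refine ae_restrict_of_ae ?_
  rw [ae_all_iff]
  intro i
  have h1 : {x : ℝ | Real.sin x = 0}.Countable := by
    refine (Set.countable_range (fun n : ℤ => (n : ℝ) * Real.pi)).mono ?_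
    intro x hx
    exact Real.sin_eq_zero_iff.1 hx
  have h2 := (Measure.quasiMeasurePreserving_eval (fun _ : Fin 4 => (volume : Measure ℝ)) i).ae
    (measure_eq_zero_iff_ae_notMem.1 (h1.measure_zero volume))
  exact h2

theorem isCompact_brillouinZone : IsCompact brillouinZone := isCompact_Icc

theorem measurableSet_brillouinZone : MeasurableSet brillouinZone := measurableSet_Icc

theorem restrict_brillouinZone : (volume : Measure Mom).restrict brillouinZone
    = Measure.pi fun _ : Fin 4 => (volume : Measure ℝ).restrict (Set.Icc (-Real.pi) Real.pi) := by
  rw [brillouinZone, ← Set.pi_univ_Icc, volume_pi, Measure.restrict_pi_pi]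

/-- Jordan's inequality sin x ≥ 2x/π compares with a power of x on [0, π/2]; reflections cover the
rest of the period. -/
theorem integrableOn_abs_sin_rpow {r : ℝ} (hr : -1 < r) (hr0 : r ≤ 0) :
    IntegrableOn (fun x => |Real.sin x| ^ r) (Set.Icc (-Real.pi) Real.pi) := by
  have hpi := Real.pi_pos
  have h1 : IntervalIntegrable (fun x => |Real.sin x| ^ r) volume 0 (Real.pi / 2) := by
    have h0 : IntervalIntegrable (fun x : ℝ => (2 / Real.pi) ^ r * x ^ r) volume 0 (Real.pi / 2) :=
      (intervalIntegral.intervalIntegrable_rpow' hr).const_mul _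
    refine h0.mono_fun' ?_ ?_
    · exact ((Real.measurable_sin.abs).pow_const r).aestronglyMeasurable
    · rw [Set.uIoc_of_le (by positivity)]
      refine (ae_restrict_iff' measurableSet_Ioc).2 (Eventually.of_forall fun x hx => ?_)
      have h2 := Real.mul_le_sin hx.1.le hx.2
      have h3 : 0 < 2 / Real.pi * x := mul_pos (by positivity) hx.1
      dsimp only
      rw [Real.norm_of_nonneg (Real.rpow_nonneg (abs_nonneg _) _),
        ← Real.mul_rpow (by positivity) hx.1.le]
      exact Real.rpow_le_rpow_of_nonpos h3 (h2.trans (le_abs_self _)) hr0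
  have h2 : IntervalIntegrable (fun x => |Real.sin x| ^ r) volume (Real.pi / 2) Real.pi := by
    have := h1.comp_sub_left Real.pi
    simp only [Real.sin_pi_sub, sub_zero] at this
    convert this.symm using 1
    ring
  have h3 := h1.trans h2
  have h4 : IntervalIntegrable (fun x => |Real.sin x| ^ r) volume (-Real.pi) 0 := by
    have := h3.comp_sub_left 0
    simp only [zero_sub, Real.sin_neg, abs_neg, neg_zero] at this
    exact this.symm
  have h5 := h4.trans h3
  rwa [intervalIntegrable_iff_integrableOn_Icc_of_le (by linarith)] at h5

/-- As s dominates each sin² pⁱ, the power splits into four equal factors s^{-7/16} ≤ |sin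
pⁱ|^{-7/8}, each integrable in one variable. The exponent 7/4 = 1 + 3/4 is the one produced by
`integrable_jointDensity`. -/
theorem integrableOn_sinSq_rpow :
    IntegrableOn (fun p => sinSq p ^ (-(7 / 4) : ℝ)) brillouinZone := by
  have h1 : Integrable (fun p : Mom => ∏ i, |Real.sin (p i)| ^ (-(7 / 8) : ℝ))
      (volume.restrict brillouinZone) := by
    rw [restrict_brillouinZone]
    exact Integrable.fintype_prod (f := fun (_ : Fin 4) x => |Real.sin x| ^ (-(7 / 8) : ℝ))
      fun _ => integrableOn_abs_sin_rpow (by norm_num) (by norm_num)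
  refine h1.mono' (continuous_sinSq.measurable.pow_const _).aestronglyMeasurable ?_
  filter_upwards [ae_sin_ne_zero brillouinZone] with p hp
  have hs : ∀ i, Real.sin (p i) ^ 2 ≤ sinSq p := fun i =>
    Finset.single_le_sum (f := fun k => Real.sin (p k) ^ 2) (fun _ _ => sq_nonneg _)
      (Finset.mem_univ i)
  rw [Real.norm_of_nonneg (Real.rpow_nonneg (sinSq_nonneg p) _)]
  have h2 : sinSq p ^ (-(7 / 4) : ℝ) = ∏ _i : Fin 4, sinSq p ^ (-(7 / 16) : ℝ) := by
    rw [Finset.prod_const, Finset.card_univ, Fintype.card_fin, ← Real.rpow_natCast,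
      ← Real.rpow_mul (sinSq_nonneg p)]
    norm_num
  rw [h2]
  refine Finset.prod_le_prod (fun i _ => Real.rpow_nonneg (sinSq_nonneg p) _) fun i _ => ?_
  have h3 : |Real.sin (p i)| ^ (-(7 / 8) : ℝ) = (Real.sin (p i) ^ 2) ^ (-(7 / 16) : ℝ) := by
    rw [← sq_abs, ← Real.rpow_natCast, ← Real.rpow_mul (abs_nonneg _)]
    norm_num
  rw [h3]
  exact Real.rpow_le_rpow_of_nonpos (by have := hp i; positivity) (hs i) (by norm_num)

theorem sinSq_le (p : Mom) : sinSq p ≤ 4 := by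
  have : sinSq p ≤ ∑ _k : Fin 4, (1 : ℝ) :=
    Finset.sum_le_sum fun k _ => Real.sin_sq_le_one (p k)
  simpa using this

theorem integrableOn_inv_sinSq : IntegrableOn (fun p => (sinSq p)⁻¹) brillouinZone := by
  refine (integrableOn_sinSq_rpow.const_mul (4 ^ (3 / 4 : ℝ))).mono' ?_ ?_
  · exact (continuous_sinSq.measurable.inv).aestronglyMeasurable
  filter_upwards [ae_sinSq_ne_zero brillouinZone] with p hp
  have hpos : 0 < sinSq p := lt_of_le_of_ne (sinSq_nonneg p) (Ne.symm hp)
  rw [Real.norm_of_nonneg (by positivity)]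
  have : (sinSq p)⁻¹ = sinSq p ^ (3 / 4 : ℝ) * sinSq p ^ (-(7 / 4) : ℝ) := by
    rw [← Real.rpow_add hpos, ← Real.rpow_neg_one]; norm_num
  rw [this]
  refine mul_le_mul_of_nonneg_right ?_ (by positivity)
  exact Real.rpow_le_rpow hpos.le (sinSq_le p) (by norm_num)

/-! ### Bounds -/

theorem abs_sin_mul_angField_le (i : Fin 4) (p : Mom) : |Real.sin (p i) * angField i p| ≤ 1 := by
  unfold angField
  have h : |∏ j ∈ Finset.univ.erase i, Real.cos (p j)| ≤ 1 := by
    rw [Finset.abs_prod]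
    exact Finset.prod_le_one (fun _ _ => abs_nonneg _) fun j _ => Real.abs_cos_le_one _
  rw [abs_mul, abs_mul]
  exact mul_le_one₀ (Real.abs_sin_le_one _) (by positivity)
    (mul_le_one₀ (Real.abs_sin_le_one _) (by positivity) h)

theorem abs_cosProd_le (p : Mom) : |cosProd p| ≤ 1 := by
  unfold cosProd
  rw [Finset.abs_prod]
  exact Finset.prod_le_one (fun _ _ => abs_nonneg _) fun j _ => Real.abs_cos_le_one _

theorem exists_overlapR_lower {m₀ : ℝ} (hR : ∀ p, 0 < overlapR m₀ p) :
    ∃ r > 0, ∀ p ∈ brillouinZone, r ≤ overlapR m₀ p := by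
  obtain ⟨x, -, hx⟩ := isCompact_brillouinZone.exists_isMinOn
    ⟨0, by simp [brillouinZone, Pi.le_def, Real.pi_pos.le]⟩ (continuous_overlapR m₀).continuousOn
  exact ⟨overlapR m₀ x, hR x, fun p hp => hx hp⟩

theorem massDenom_ge {m₀ w w' : ℝ} (hw : w ≤ w') (p : Mom) :
    2 * min (4 * m₀ ^ 2) w * overlapR m₀ p ≤ massDenom m₀ w' p := by
  have h := abs_le.1 (abs_overlapA_le m₀ p)
  unfold massDenom
  have h1 : min (4 * m₀ ^ 2) w * (overlapR m₀ p + overlapA m₀ p)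
      ≤ 4 * m₀ ^ 2 * (overlapR m₀ p + overlapA m₀ p) :=
    mul_le_mul_of_nonneg_right (min_le_left _ _) (by linarith)
  have h2 : min (4 * m₀ ^ 2) w * (overlapR m₀ p - overlapA m₀ p)
      ≤ w' * (overlapR m₀ p - overlapA m₀ p) :=
    mul_le_mul_of_nonneg_right ((min_le_right _ _).trans hw) (by linarith)
  linarith

/-- The lower bound `c` is a free parameter so that it may later depend on s and on p₅. The constant
12 + |m₀| collects four terms of size at most 1 and |A| ≤ |m₀| + 8. -/
theorem abs_density_le {m₀ w c : ℝ} {p : Mom} (hR : 0 < overlapR m₀ p) (hc : 0 < c)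
    (hq : c ≤ massDenom m₀ w p ^ 3) :
    |overlapDensity m₀ w p| ≤ 32 * m₀ ^ 4 * (12 + |m₀|) * (sinSq p)⁻¹ * c⁻¹ := by
  have h := abs_le.1 (abs_overlapA_le m₀ p)
  have hX : |overlapR m₀ p + overlapA m₀ p| ≤ 2 * overlapR m₀ p := by
    rw [abs_of_nonneg (by linarith)]; linarith
  have hA : |overlapA m₀ p| ≤ |m₀| + 8 := by
    unfold overlapA
    have h2 : |∑ i, (1 - Real.cos (p i))| ≤ ∑ _i : Fin 4, (2 : ℝ) := by
      refine (Finset.abs_sum_le_sum_abs _ _).trans (Finset.sum_le_sum fun i _ => ?_)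
      rw [abs_le]
      constructor <;> linarith [Real.cos_le_one (p i), Real.neg_one_le_cos (p i)]
    have h3 : ∑ _i : Fin 4, (2 : ℝ) = 8 := by simp; norm_num
    rw [h3] at h2
    calc _ ≤ |-m₀| + |∑ i, (1 - Real.cos (p i))| := abs_add_le _ _
      _ ≤ _ := by rw [abs_neg]; linarith
  have hJ : |jacNum m₀ p| ≤ 12 + |m₀| := by
    unfold jacNum
    have h2 : |∑ i, Real.sin (p i) * angField i p| ≤ ∑ _i : Fin 4, (1 : ℝ) :=
      (Finset.abs_sum_le_sum_abs _ _).trans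
        (Finset.sum_le_sum fun i _ => abs_sin_mul_angField_le i p)
    have h3 : |overlapA m₀ p * cosProd p| ≤ |m₀| + 8 := by
      rw [abs_mul]
      exact (mul_le_of_le_one_right (abs_nonneg _) (abs_cosProd_le p)).trans hA
    simp only [Finset.sum_const, Finset.card_univ, Fintype.card_fin, nsmul_eq_mul, mul_one] at h2
    push_cast at h2
    linarith [abs_sub (∑ i, Real.sin (p i) * angField i p) (overlapA m₀ p * cosProd p)]
  have e : overlapDensity m₀ w p = 16 * m₀ ^ 4 * ((overlapR m₀ p + overlapA m₀ p) / overlapR m₀ p)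
      * jacNum m₀ p * (sinSq p)⁻¹ * (massDenom m₀ w p ^ 3)⁻¹ := by
    unfold overlapDensity
    simp only [div_eq_mul_inv, mul_inv]
    ring
  have hX' : |(overlapR m₀ p + overlapA m₀ p) / overlapR m₀ p| ≤ 2 := by
    rw [abs_div, abs_of_pos hR, div_le_iff₀ hR]; exact hX
  rw [e, abs_mul, abs_mul, abs_mul, abs_mul, abs_of_nonneg (by positivity : 0 ≤ 16 * m₀ ^ 4),
    abs_of_nonneg (inv_nonneg.2 (sinSq_nonneg p)),
    abs_of_nonneg (inv_nonneg.2 (hc.le.trans hq))]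
  have hi : (massDenom m₀ w p ^ 3)⁻¹ ≤ c⁻¹ := inv_anti₀ hc hq
  have hs := inv_nonneg.2 (sinSq_nonneg p)
  have hq' := inv_nonneg.2 (hc.le.trans hq)
  calc _ ≤ 16 * m₀ ^ 4 * 2 * (12 + |m₀|) * (sinSq p)⁻¹ * c⁻¹ := by gcongr
    _ = _ := by ring

@[fun_prop]
theorem measurable_overlapDensity (m₀ w : ℝ) : Measurable (overlapDensity m₀ w) := by
  unfold overlapDensity
  exact Measurable.div (by fun_prop) (by fun_prop)

theorem integrableOn_density {m₀ w : ℝ} (hm₀ : m₀ ≠ 0) (hw : 0 < w)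
    (hR : ∀ p, 0 < overlapR m₀ p) : IntegrableOn (overlapDensity m₀ w) brillouinZone := by
  obtain ⟨r, hr, hrR⟩ := exists_overlapR_lower hR
  have hmin : 0 < min (4 * m₀ ^ 2) w := lt_min (by positivity) hw
  set c := (2 * min (4 * m₀ ^ 2) w * r) ^ 3 with hc
  have hcpos : 0 < c := by positivity
  refine ((integrableOn_inv_sinSq.const_mul (32 * m₀ ^ 4 * (12 + |m₀|))).mul_const c⁻¹).mono'
    (measurable_overlapDensity m₀ w).aestronglyMeasurable ?_
  refine (ae_restrict_iff' measurableSet_brillouinZone).2 (Eventually.of_forall fun p hp => ?_)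
  refine abs_density_le (hR p) hcpos ?_
  refine pow_le_pow_left₀ (by positivity) ?_ 3
  refine le_trans ?_ (massDenom_ge le_rfl p)
  exact mul_le_mul_of_nonneg_left (hrR p hp) (by positivity)


/-! ### The divergence theorem with a heat kernel cutoff -/

theorem cutoff_nonneg {τ s : ℝ} : 0 ≤ cutoff τ s := by
  unfold cutoff
  have h := Real.add_one_le_exp (τ * s)
  have h2 : (1 + τ * s) * Real.exp (-(τ * s)) ≤ Real.exp (τ * s) * Real.exp (-(τ * s)) :=
    mul_le_mul_of_nonneg_right (by linarith) (Real.exp_pos _).le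
  rw [← Real.exp_add, add_neg_cancel, Real.exp_zero] at h2
  linarith

theorem cutoff_le_one {τ s : ℝ} (hτ : 0 ≤ τ) (hs : 0 ≤ s) : cutoff τ s ≤ 1 := by
  unfold cutoff
  have : 0 ≤ (1 + τ * s) * Real.exp (-(τ * s)) := by positivity
  linarith

/-- Quadratic vanishing at s = 0 keeps `cutoff` / s² bounded, so that `fluxField` is continuous at
the corners. -/
theorem cutoff_le_sq {τ s : ℝ} (hτ : 0 ≤ τ) (hs : 0 ≤ s) : cutoff τ s ≤ τ ^ 2 * s ^ 2 := by
  unfold cutoff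
  have h := Real.add_one_le_exp (-(τ * s))
  have : 0 ≤ τ * s := by positivity
  nlinarith

theorem continuous_fluxField {m₀ w τ : ℝ} (hτ : 0 ≤ τ) (hR : ∀ p, 0 < overlapR m₀ p)
    (hq : ∀ p, massDenom m₀ w p ≠ 0) (i : Fin 4) : Continuous (fluxField m₀ w τ i) := by
  rw [continuous_iff_continuousAt]
  intro p
  by_cases hs : sinSq p = 0
  · have h0 : angField i p = 0 := by simp [angField, sinSq_eq_zero.1 hs i]
    have h1 : fluxField m₀ w τ i p = 0 := by simp [fluxField, h0]
    rw [ContinuousAt, h1]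
    have hc : Continuous fun p => |overlapPrim m₀ w p * angField i p| * τ ^ 2 :=
      (((continuous_overlapPrim hq).mul (continuous_angField i)).abs).mul_const _
    have h2 := hc.tendsto p
    simp only [h0, mul_zero, abs_zero, zero_mul] at h2
    refine squeeze_zero_norm (fun q => ?_) h2
    rw [Real.norm_eq_abs, fluxField, abs_mul]
    refine mul_le_mul_of_nonneg_left ?_ (abs_nonneg _)
    rw [abs_of_nonneg (div_nonneg cutoff_nonneg (sq_nonneg _))]
    exact div_le_of_le_mul₀ (sq_nonneg _) (sq_nonneg _) (cutoff_le_sq hτ (sinSq_nonneg q))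
  · exact (differentiableAt_fluxField (hR p) (hq p) hs i).continuousAt

theorem fluxField_eq_zero_of_sin (m₀ w τ : ℝ) {i : Fin 4} {p : Mom} (h : Real.sin (p i) = 0) :
    fluxField m₀ w τ i p = 0 := by
  simp [fluxField, angField, h]

theorem continuous_cutoff (τ : ℝ) : Continuous (cutoff τ) := by
  unfold cutoff; fun_prop

theorem integrableOn_density_mul_cutoff {m₀ w τ : ℝ} (hτ : 0 ≤ τ)
    (h : IntegrableOn (overlapDensity m₀ w) brillouinZone) :
    IntegrableOn (fun p => w * overlapDensity m₀ w p * cutoff τ (sinSq p)) brillouinZone := by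
  refine Integrable.mul_bdd (c := 1) (h.const_mul w)
    ((continuous_cutoff τ).comp continuous_sinSq).aestronglyMeasurable
    (Eventually.of_forall fun p => ?_)
  rw [Real.norm_of_nonneg cutoff_nonneg]
  exact cutoff_le_one hτ (sinSq_nonneg p)

theorem integrableOn_prim_mul_heat {m₀ w τ : ℝ} (hq : ∀ p, massDenom m₀ w p ≠ 0) :
    IntegrableOn (fun p => overlapPrim m₀ w p *
      (2 * τ ^ 2 * Real.exp (-(τ * sinSq p)) * cosProd p)) brillouinZone := by
  refine ContinuousOn.integrableOn_compact isCompact_brillouinZone (Continuous.continuousOn ?_)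
  exact (continuous_overlapPrim hq).mul (by fun_prop)

/-- The divergence theorem for `fluxField`: continuity holds everywhere and differentiability off
the countable set s = 0. On each face pⁱ = ±π the normal component carries the factor sin pⁱ = 0, so
there is no boundary flux. -/
theorem integral_density_cutoff {m₀ w τ : ℝ} (hm₀ : m₀ ≠ 0) (hw : 0 < w)
    (hR : ∀ p, 0 < overlapR m₀ p) (hτ : 0 ≤ τ) :
    (∫ p in brillouinZone, w * overlapDensity m₀ w p * cutoff τ (sinSq p)) +
      ∫ p in brillouinZone, overlapPrim m₀ w p *
        (2 * τ ^ 2 * Real.exp (-(τ * sinSq p)) * cosProd p) = 0 := by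
  have hq : ∀ p, massDenom m₀ w p ≠ 0 := fun p => (massDenom_pos hm₀ hw (hR p)).ne'
  have hI1 := integrableOn_density_mul_cutoff hτ (integrableOn_density hm₀ hw hR)
  have hI2 := integrableOn_prim_mul_heat (τ := τ) hq
  rw [← integral_add hI1 hI2]
  have hpi := Real.pi_pos
  have hsum : ∀ p, sinSq p ≠ 0 → ∑ i, fderiv ℝ (fluxField m₀ w τ i) p (Pi.single i 1)
      = w * overlapDensity m₀ w p * cutoff τ (sinSq p) + overlapPrim m₀ w p *
        (2 * τ ^ 2 * Real.exp (-(τ * sinSq p)) * cosProd p) := by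
    intro p hs
    rw [← sum_fluxDeriv hs]
    refine Finset.sum_congr rfl fun i _ => ?_
    rw [← (differentiableAt_fluxField (hR p) (hq p) hs i).lineDeriv_eq_fderiv]
    exact (hasLineDerivAt_fluxField (hR p) (hq p) hs i).lineDeriv
  have hae : (fun p => ∑ i, fderiv ℝ (fluxField m₀ w τ i) p (Pi.single i 1))
      =ᵐ[volume.restrict brillouinZone] fun p => w * overlapDensity m₀ w p * cutoff τ (sinSq p) +
        overlapPrim m₀ w p * (2 * τ ^ 2 * Real.exp (-(τ * sinSq p)) * cosProd p) := by
    filter_upwards [ae_sinSq_ne_zero brillouinZone] with p hp using hsum p hp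
  have hdiv := integral_divergence_of_hasFDerivAt_off_countable'
    (fun _ : Fin 4 => -Real.pi) (fun _ => Real.pi) (fun _ => by linarith)
    (fluxField m₀ w τ) (fun i p => fderiv ℝ (fluxField m₀ w τ i) p) {p | sinSq p = 0}
    countable_sinSq_zero (fun i => (continuous_fluxField hτ hR hq i).continuousOn)
    (fun p hp i => (differentiableAt_fluxField (hR p) (hq p) hp.2 i).hasFDerivAt)
    ((hI1.add hI2).congr hae.symm)
  rw [← integral_congr_ae hae]
  refine hdiv.trans (Finset.sum_eq_zero fun i _ => ?_)
  have h1 : ∀ x : Fin 3 → ℝ, fluxField m₀ w τ i (i.insertNth Real.pi x) = 0 := fun x =>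
    fluxField_eq_zero_of_sin _ _ _ (by simp)
  have h2 : ∀ x : Fin 3 → ℝ, fluxField m₀ w τ i (i.insertNth (-Real.pi) x) = 0 := fun x =>
    fluxField_eq_zero_of_sin _ _ _ (by simp)
  simp [h1, h2]

theorem tendsto_cutoff {s : ℝ} (hs : 0 < s) : Tendsto (fun τ => cutoff τ s) atTop (𝓝 1) := by
  have h1 : Tendsto (fun τ : ℝ => τ * s) atTop atTop := tendsto_id.atTop_mul_const hs
  have h2 : Tendsto (fun x : ℝ => (1 + x) * Real.exp (-x)) atTop (𝓝 0) := by
    have h3 := Real.tendsto_exp_neg_atTop_nhds_zero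
    have h4 := Real.tendsto_pow_mul_exp_neg_atTop_nhds_zero 1
    simpa [add_mul] using h3.add h4
  simpa [cutoff, Function.comp_def] using (h2.comp h1).const_sub 1

theorem tendsto_integral_density_cutoff {m₀ w : ℝ}
    (h : IntegrableOn (overlapDensity m₀ w) brillouinZone) :
    Tendsto (fun τ => ∫ p in brillouinZone, w * overlapDensity m₀ w p * cutoff τ (sinSq p)) atTop
      (𝓝 (w * ∫ p in brillouinZone, overlapDensity m₀ w p)) := by
  rw [← integral_const_mul]
  refine tendsto_integral_filter_of_dominated_convergence (fun p => ‖w * overlapDensity m₀ w p‖)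
    ?_ ?_ (h.const_mul w).norm ?_
  · filter_upwards [eventually_ge_atTop 0] with τ hτ
    exact (integrableOn_density_mul_cutoff hτ h).aestronglyMeasurable
  · filter_upwards [eventually_ge_atTop 0] with τ hτ
    refine Eventually.of_forall fun p => ?_
    rw [norm_mul, Real.norm_of_nonneg (cutoff_nonneg (τ := τ))]
    exact mul_le_of_le_one_right (norm_nonneg _) (cutoff_le_one hτ (sinSq_nonneg p))
  · filter_upwards [ae_sinSq_ne_zero brillouinZone] with p hp
    simpa using (tendsto_cutoff (lt_of_le_of_ne (sinSq_nonneg p) (Ne.symm hp))).const_mul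
      (w * overlapDensity m₀ w p)

/-! ### One-dimensional Laplace asymptotics -/

/-- The half-period of the circle, `0` or `1`, containing `x`. -/
def halfPeriod (x : ℝ) : Fin 2 := if Real.cos x < 0 then 1 else 0

theorem measurable_halfPeriod : Measurable halfPeriod := by
  unfold halfPeriod
  exact Measurable.ite (measurableSet_lt Real.measurable_cos measurable_const) measurable_const
    measurable_const

theorem integral_cos_mul_exp_sin (τ a b : ℝ) :
    ∫ x in a..b, Real.cos x * Real.exp (-τ * Real.sin x ^ 2)
      = ∫ y in (Real.sin a)..(Real.sin b), Real.exp (-τ * y ^ 2) := by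
  rw [← intervalIntegral.integral_comp_mul_deriv (f := Real.sin) (f' := Real.cos)
    (g := fun y => Real.exp (-τ * y ^ 2)) (fun x _ => Real.hasDerivAt_sin x)
    Real.continuous_cos.continuousOn (by fun_prop)]
  refine intervalIntegral.integral_congr fun x _ => ?_
  simp [mul_comm]

/-- The heat kernel weight of a half-period. -/
def heatWeight (τ : ℝ) (n : Fin 2) (x : ℝ) : ℝ :=
  if halfPeriod x = n then Real.cos x * Real.exp (-τ * Real.sin x ^ 2) else 0

theorem intervalIntegrable_cos_mul_exp (τ a b : ℝ) :
    IntervalIntegrable (fun x => Real.cos x * Real.exp (-τ * Real.sin x ^ 2)) volume a b :=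
  Continuous.intervalIntegrable (by fun_prop) _ _

theorem intervalIntegral_heatWeight {τ a b : ℝ} {n : Fin 2} (hab : a ≤ b) (k : Fin 2)
    (h : ∀ x ∈ Set.Ioo a b, halfPeriod x = k) :
    IntervalIntegrable (heatWeight τ n) volume a b ∧ ∫ x in a..b, heatWeight τ n x
      = if k = n then ∫ y in (Real.sin a)..(Real.sin b), Real.exp (-τ * y ^ 2) else 0 := by
  have hae : ∀ᵐ x, x ∈ Set.uIoc a b → (if k = n then fun x =>
      Real.cos x * Real.exp (-τ * Real.sin x ^ 2) else 0) x = heatWeight τ n x := by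
    have : ∀ᵐ x : ℝ, x ≠ b := by simp [ae_iff]
    filter_upwards [this] with x hx hxI
    rw [Set.uIoc_of_le hab] at hxI
    have := h x ⟨hxI.1, lt_of_le_of_ne hxI.2 hx⟩
    unfold heatWeight
    rw [this]
    split_ifs <;> rfl
  constructor
  · refine IntervalIntegrable.congr_ae ?_
      ((ae_restrict_iff' measurableSet_uIoc).2 hae)
    split_ifs
    · exact intervalIntegrable_cos_mul_exp τ a b
    · exact IntervalIntegrable.zero
  · rw [← intervalIntegral.integral_congr_ae hae]
    split_ifs
    · exact integral_cos_mul_exp_sin τ a b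
    · simp

/-- Under y = sin x the half-period with cos > 0 is mapped onto [-1, 1]. The two quarter-periods
with cos < 0 together traverse the same interval backwards, hence the sign. -/
theorem integral_heatWeight (τ : ℝ) (n : Fin 2) :
    ∫ x in Set.Icc (-Real.pi) Real.pi, heatWeight τ n x
      = (-1) ^ (n : ℕ) * ∫ y in (-1 : ℝ)..1, Real.exp (-τ * y ^ 2) := by
  have hpi := Real.pi_pos
  obtain ⟨i1, e1⟩ := intervalIntegral_heatWeight (τ := τ) (n := n) (a := -Real.pi)
    (b := -(Real.pi / 2)) (by linarith) 1 (fun x hx => by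
      unfold halfPeriod
      rw [if_pos]
      rw [← Real.cos_neg]
      exact Real.cos_neg_of_pi_div_two_lt_of_lt (by linarith [hx.2]) (by linarith [hx.1]))
  obtain ⟨i2, e2⟩ := intervalIntegral_heatWeight (τ := τ) (n := n) (a := -(Real.pi / 2))
    (b := Real.pi / 2) (by linarith) 0 (fun x hx => by
      unfold halfPeriod
      rw [if_neg]
      exact not_lt.2 (Real.cos_pos_of_mem_Ioo ⟨by linarith [hx.1], hx.2⟩).le)
  obtain ⟨i3, e3⟩ := intervalIntegral_heatWeight (τ := τ) (n := n) (a := Real.pi / 2)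
    (b := Real.pi) (by linarith) 1 (fun x hx => by
      unfold halfPeriod
      rw [if_pos]
      exact Real.cos_neg_of_pi_div_two_lt_of_lt hx.1 (by linarith [hx.2]))
  rw [integral_Icc_eq_integral_Ioc, ← intervalIntegral.integral_of_le (by linarith),
    ← intervalIntegral.integral_add_adjacent_intervals (i1.trans i2) i3,
    ← intervalIntegral.integral_add_adjacent_intervals i1 i2, e1, e2, e3]
  have hi : ∀ a b : ℝ, IntervalIntegrable (fun y : ℝ => Real.exp (-τ * y ^ 2)) volume a b :=
    fun a b => Continuous.intervalIntegrable (by fun_prop) _ _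
  have h4 := intervalIntegral.integral_add_adjacent_intervals (hi (-1) 0) (hi 0 1)
  have h5 := intervalIntegral.integral_symm (μ := volume) (f := fun y : ℝ => Real.exp (-τ * y ^ 2))
    (-1) 0
  have h6 := intervalIntegral.integral_symm (μ := volume) (f := fun y : ℝ => Real.exp (-τ * y ^ 2))
    0 1
  simp only [Real.sin_neg, Real.sin_pi, Real.sin_pi_div_two, neg_zero]
  fin_cases n
  · simp
  · simp
    simp only [neg_mul] at h4 h5 h6
    linarith

/-- Rescaling y by √τ turns the integral into a truncated Gaussian. Four such factors later supply
τ² on one side and π² on the other. -/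
theorem tendsto_sqrt_mul_integral_heatWeight (n : Fin 2) :
    Tendsto (fun τ => Real.sqrt τ * ∫ x in Set.Icc (-Real.pi) Real.pi, heatWeight τ n x) atTop
      (𝓝 ((-1) ^ (n : ℕ) * Real.sqrt Real.pi)) := by
  have h1 : ∀ τ : ℝ, 0 < τ → Real.sqrt τ * ∫ x in Set.Icc (-Real.pi) Real.pi, heatWeight τ n x
      = (-1) ^ (n : ℕ) * ∫ y in (-Real.sqrt τ)..(Real.sqrt τ), Real.exp (-1 * y ^ 2) := by
    intro τ hτ
    have h2 := intervalIntegral.mul_integral_comp_mul_left (a := -1) (b := 1)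
      (f := fun y : ℝ => Real.exp (-1 * y ^ 2)) (Real.sqrt τ)
    have h3 : ∀ y : ℝ, -1 * (Real.sqrt τ * y) ^ 2 = -τ * y ^ 2 := by
      intro y; rw [mul_pow, Real.sq_sqrt hτ.le]; ring
    simp only [h3, mul_neg, mul_one] at h2
    rw [integral_heatWeight, ← h2]; ring
  have h4 := intervalIntegral_tendsto_integral (integrable_exp_neg_mul_sq one_pos)
    (tendsto_neg_atTop_atBot.comp Real.tendsto_sqrt_atTop) Real.tendsto_sqrt_atTop
  rw [integral_gaussian, div_one] at h4
  refine (h4.const_mul _).congr' ?_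
  filter_upwards [eventually_gt_atTop 0] with τ hτ
  rw [h1 τ hτ]; rfl


/-! ### Values at the corners -/

theorem cos_corner (n : Fin 4 → Fin 2) (i : Fin 4) :
    Real.cos (corner n i) = (-1) ^ (n i : ℕ) := by
  unfold corner
  rw [mul_comm, Real.cos_nat_mul_pi]

theorem sin_corner (n : Fin 4 → Fin 2) (i : Fin 4) : Real.sin (corner n i) = 0 := by
  unfold corner
  rw [mul_comm, Real.sin_nat_mul_pi]

theorem sinSq_corner (n : Fin 4 → Fin 2) : sinSq (corner n) = 0 :=
  sinSq_eq_zero.2 (sin_corner n)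

theorem overlapA_corner (m₀ : ℝ) (n : Fin 4 → Fin 2) :
    overlapA m₀ (corner n) = 2 * ((∑ i, (n i : ℕ) : ℕ) : ℝ) - m₀ := by
  unfold overlapA
  simp only [cos_corner]
  have : ∀ k : Fin 2, (1 : ℝ) - (-1) ^ (k : ℕ) = 2 * ((k : ℕ) : ℝ) := by
    intro k; fin_cases k <;> norm_num
  simp only [this, ← Finset.mul_sum]
  push_cast
  ring

theorem overlapR_corner (m₀ : ℝ) (n : Fin 4 → Fin 2) :
    overlapR m₀ (corner n) = |overlapA m₀ (corner n)| := by
  rw [overlapR, sinSq_corner, add_zero, Real.sqrt_sq_eq_abs]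

theorem corner_mem_brillouinZone (n : Fin 4 → Fin 2) : corner n ∈ brillouinZone := by
  have hpi := Real.pi_pos
  have h : ∀ k : Fin 2, -Real.pi ≤ Real.pi * ((k : ℕ) : ℝ) ∧ Real.pi * ((k : ℕ) : ℝ) ≤ Real.pi := by
    intro k
    fin_cases k <;> constructor <;> simp <;> linarith
  exact ⟨fun i => (h (n i)).1, fun i => (h (n i)).2⟩

theorem overlapPrim_eq (m₀ w : ℝ) (p : Mom) : overlapPrim m₀ w p =
    (4 * m₀ ^ 2 * (overlapR m₀ p + overlapA m₀ p) / massDenom m₀ w p) ^ 2 / 4 := by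
  unfold overlapPrim; ring

/-- At a corner R = |A|. For A < 0 the numerator R + A vanishes; for A > 0 the mass term w(R - A)
does, leaving 1/4. -/
theorem overlapPrim_corner {m₀ w : ℝ} (hm₀ : m₀ ≠ 0) (n : Fin 4 → Fin 2)
    (hA : overlapA m₀ (corner n) ≠ 0) :
    overlapPrim m₀ w (corner n) = (1 + Real.sign (overlapA m₀ (corner n))) / 8 := by
  rw [overlapPrim_eq, massDenom, overlapR_corner]
  rcases lt_or_gt_of_ne hA with h | h
  · rw [abs_of_neg h, Real.sign_of_neg h]; simp
  · rw [abs_of_pos h, Real.sign_of_pos h, sub_self, mul_zero, add_zero, div_self]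
    · norm_num
    · have : overlapA m₀ (corner n) + overlapA m₀ (corner n) ≠ 0 := by linarith
      positivity

/-- The corner lying in the same cell as `p`. -/
def cell (p : Mom) : Fin 4 → Fin 2 := fun i => halfPeriod (p i)

/-- In each coordinate 1 - |cos| ≤ 1 - cos² = sin². -/
theorem abs_overlapA_sub_cell_le (m₀ : ℝ) (p : Mom) :
    |overlapA m₀ p - overlapA m₀ (corner (cell p))| ≤ sinSq p := by
  have h : overlapA m₀ p - overlapA m₀ (corner (cell p))
      = ∑ i, (Real.cos (corner (cell p) i) - Real.cos (p i)) := by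
    unfold overlapA
    simp only [Finset.sum_sub_distrib]
    ring
  rw [h]
  refine (Finset.abs_sum_le_sum_abs _ _).trans (Finset.sum_le_sum fun i _ => ?_)
  rw [cos_corner, cell, halfPeriod, Real.sin_sq]
  have h1 := Real.cos_le_one (p i)
  have h2 := Real.neg_one_le_cos (p i)
  split_ifs with hc
  · rw [abs_of_nonpos (by simp; linarith)]
    simp
    nlinarith
  · rw [not_lt] at hc
    rw [abs_of_nonneg (by simp; linarith)]
    simp
    nlinarith

/-- A rate linear in s suffices: the heat kernel is at most 4/s², and the product is bounded by a
multiple of the integrable 1/s. -/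
theorem abs_prim_sub_cell_le {m₀ w : ℝ} (hm₀ : m₀ ≠ 0) (hw : 0 < w)
    (hR : ∀ p, 0 < overlapR m₀ p) : ∃ C : ℝ, ∀ p ∈ brillouinZone,
      |overlapPrim m₀ w p - overlapPrim m₀ w (corner (cell p))| ≤ C * sinSq p := by
  obtain ⟨r, hr, hrR⟩ := exists_overlapR_lower hR
  have hmin : 0 < min (4 * m₀ ^ 2) w := lt_min (by positivity) hw
  set c := 2 * min (4 * m₀ ^ 2) w * r with hc
  have hcpos : 0 < c := by positivity
  refine ⟨4 * m₀ ^ 2 / (c * r) + w / (c * r) + 1 / r, fun p hp => ?_⟩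
  have hcorner := hrR _ (corner_mem_brillouinZone (cell p))
  rw [overlapR_corner] at hcorner
  have hq : c ≤ massDenom m₀ w p := le_trans
    (mul_le_mul_of_nonneg_left (hrR p hp) (by positivity)) (massDenom_ge le_rfl p)
  have hqpos : 0 < massDenom m₀ w p := hcpos.trans_le hq
  have hAR := abs_le.1 (abs_overlapA_le m₀ p)
  have hd := abs_le.1 (abs_overlapA_sub_cell_le m₀ p)
  have hXu := sub_mul_add_overlap m₀ p
  have hRp := hrR p hp
  have hs := sinSq_nonneg p
  have hB : overlapA m₀ (corner (cell p)) ≠ 0 := by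
    intro h0; rw [h0, abs_zero] at hcorner; linarith
  rw [overlapPrim_corner hm₀ _ hB, overlapPrim_eq]
  set A := overlapA m₀ p
  set R := overlapR m₀ p
  set B := overlapA m₀ (corner (cell p))
  set q := massDenom m₀ w p with hqdef
  set s := sinSq p
  -- y is g²/(g² + w), so it lies in [0, 1] and the primitive is y²/4. At the corner y is 0 or 1
  -- according to the sign of B.
  set y := 4 * m₀ ^ 2 * (R + A) / q with hy
  have hy' : 1 - y = w * (R - A) / q := by
    rw [hy, eq_div_iff hqpos.ne', sub_mul, div_mul_cancel₀ _ hqpos.ne', hqdef, massDenom]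
    ring
  have hy0 : 0 ≤ y := div_nonneg (mul_nonneg (by positivity) (by linarith)) hqpos.le
  have hy1 : y ≤ 1 := by
    have : 0 ≤ 1 - y := by
      rw [hy']; exact div_nonneg (mul_nonneg hw.le (by linarith)) hqpos.le
    linarith
  have hC1 : 0 ≤ 4 * m₀ ^ 2 / (c * r) * s := by positivity
  have hC2 : 0 ≤ w / (c * r) * s := by positivity
  have hC3 : 0 ≤ 1 / r * s := by positivity
  rcases lt_or_gt_of_ne hB with h | h
  · rw [Real.sign_of_neg h]
    rw [abs_of_neg h] at hcorner
    have key : y ≤ 4 * m₀ ^ 2 / (c * r) * s + 1 / r * s := by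
      rcases le_or_gt A 0 with hA | hA
      · have hX : R + A ≤ s / r := by
          rw [le_div_iff₀ hr, ← hXu, mul_comm]
          exact mul_le_mul_of_nonneg_right (by linarith) (by linarith)
        have : y ≤ 4 * m₀ ^ 2 * (s / r) / c := by
          rw [hy]; gcongr
        have e : 4 * m₀ ^ 2 * (s / r) / c = 4 * m₀ ^ 2 / (c * r) * s := by field_simp
        linarith
      -- A and B have opposite signs, so r ≤ |B| ≤ |A - B| ≤ s, and the trivial bound y ≤ 1 is
      -- already of order s.
      · have : 1 ≤ 1 / r * s := by
          rw [one_div, inv_mul_eq_div, le_div_iff₀ hr]; linarith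
        linarith
    rw [show (1 + -1 : ℝ) / 8 = 0 by norm_num, sub_zero, abs_of_nonneg (by positivity)]
    have : y ^ 2 ≤ y := by nlinarith
    linarith
  · rw [Real.sign_of_pos h]
    rw [abs_of_pos h] at hcorner
    have key : 1 - y ≤ w / (c * r) * s + 1 / r * s := by
      rcases le_or_gt 0 A with hA | hA
      · have hX : R - A ≤ s / r := by
          rw [le_div_iff₀ hr, ← hXu]
          exact mul_le_mul_of_nonneg_left (by linarith) (by linarith)
        have : 1 - y ≤ w * (s / r) / c := by
          rw [hy']; gcongr
        have e : w * (s / r) / c = w / (c * r) * s := by field_simp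
        linarith
      · have : 1 ≤ 1 / r * s := by
          rw [one_div, inv_mul_eq_div, le_div_iff₀ hr]; linarith
        linarith
    rw [show (1 + 1 : ℝ) / 8 = 1 / 4 by norm_num, abs_of_nonpos (by nlinarith)]
    nlinarith

/-! ### The limit of the heat kernel term -/

/-- The divergence of the cut-off angular field. -/
def heatKernel (τ : ℝ) (p : Mom) : ℝ := 2 * τ ^ 2 * Real.exp (-(τ * sinSq p)) * cosProd p

@[fun_prop]
theorem continuous_heatKernel (τ : ℝ) : Continuous (heatKernel τ) := by
  unfold heatKernel; fun_prop

/-- From x²/2 ≤ eˣ with x = τs. The bound is uniform in τ, as dominated convergence requires. -/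
theorem abs_heatKernel_le {τ : ℝ} (hτ : 0 ≤ τ) {p : Mom} (hs : 0 < sinSq p) :
    |heatKernel τ p| ≤ 4 * (sinSq p)⁻¹ ^ 2 := by
  have hx : 0 ≤ τ * sinSq p := mul_nonneg hτ hs.le
  have h1 := Real.quadratic_le_exp_of_nonneg hx
  unfold heatKernel
  rw [abs_mul, abs_of_nonneg (by positivity)]
  refine (mul_le_of_le_one_right (by positivity) (abs_cosProd_le p)).trans ?_
  rw [Real.exp_neg, inv_pow, ← div_eq_mul_inv, ← div_eq_mul_inv, div_le_div_iff₀ (Real.exp_pos _)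
    (by positivity)]
  nlinarith

theorem tendsto_heatKernel {p : Mom} (hs : 0 < sinSq p) :
    Tendsto (fun τ => heatKernel τ p) atTop (𝓝 0) := by
  have h1 : Tendsto (fun τ : ℝ => τ * sinSq p) atTop atTop := tendsto_id.atTop_mul_const hs
  have h2 := ((Real.tendsto_pow_mul_exp_neg_atTop_nhds_zero 2).comp h1).const_mul
    (2 / sinSq p ^ 2 * cosProd p)
  rw [mul_zero] at h2
  refine h2.congr fun τ => ?_
  unfold heatKernel
  simp only [Function.comp_apply]
  field_simp

theorem measurable_cell : Measurable cell :=
  measurable_pi_lambda _ fun i => measurable_halfPeriod.comp (measurable_pi_apply i)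

theorem integrableOn_heatKernel_cell (τ : ℝ) (f : (Fin 4 → Fin 2) → ℝ) :
    IntegrableOn (fun p => f (cell p) * heatKernel τ p) brillouinZone := by
  have h1 : IntegrableOn (heatKernel τ) brillouinZone :=
    (continuous_heatKernel τ).continuousOn.integrableOn_compact isCompact_brillouinZone
  refine Integrable.bdd_mul (c := ∑ n, |f n|) h1 ?_ (Eventually.of_forall fun p => ?_)
  · exact ((measurable_of_countable f).comp measurable_cell).aestronglyMeasurable
  · exact Finset.single_le_sum (f := fun n => |f n|) (fun _ _ => abs_nonneg _)
      (Finset.mem_univ (cell p))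

/-- Both the kernel and the indicator of a cell factor over the coordinates, and τ² = (√τ)⁴ is
distributed evenly. -/
theorem integral_heatKernel_cell {τ : ℝ} (hτ : 0 ≤ τ) (n : Fin 4 → Fin 2) :
    ∫ p in brillouinZone, (if cell p = n then (1 : ℝ) else 0) * heatKernel τ p
      = 2 * ∏ i, (Real.sqrt τ * ∫ x in Set.Icc (-Real.pi) Real.pi, heatWeight τ (n i) x) := by
  have h1 : ∀ p, (if cell p = n then (1 : ℝ) else 0) * heatKernel τ p
      = 2 * τ ^ 2 * ∏ i, heatWeight τ (n i) (p i) := by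
    intro p
    unfold heatWeight
    split_ifs with h
    · have h2 : ∀ i, halfPeriod (p i) = n i := fun i => congrFun h i
      simp only [h2, if_true, Finset.prod_mul_distrib, ← Real.exp_sum]
      rw [← Finset.mul_sum, ← sinSq, ← cosProd, heatKernel, one_mul, neg_mul]
      ring
    · obtain ⟨i, hi⟩ := Function.ne_iff.1 h
      rw [Finset.prod_eq_zero (Finset.mem_univ i) (if_neg hi)]
      ring
  simp only [h1]
  rw [integral_const_mul, restrict_brillouinZone,
    integral_fintype_prod_eq_prod (f := fun i x => heatWeight τ (n i) x),
    Finset.prod_mul_distrib, Finset.prod_const, Finset.card_univ, Fintype.card_fin,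
    show Real.sqrt τ ^ 4 = (Real.sqrt τ ^ 2) ^ 2 by ring, Real.sq_sqrt hτ]
  ring

theorem tendsto_integral_heatKernel_cell (n : Fin 4 → Fin 2) :
    Tendsto (fun τ => ∫ p in brillouinZone, (if cell p = n then (1 : ℝ) else 0) * heatKernel τ p)
      atTop (𝓝 (2 * Real.pi ^ 2 * (-1) ^ (∑ i, (n i : ℕ)))) := by
  have h1 := (tendsto_finsetProd Finset.univ
    fun i _ => tendsto_sqrt_mul_integral_heatWeight (n i)).const_mul 2
  have e : 2 * ∏ i, ((-1) ^ (n i : ℕ) * Real.sqrt Real.pi)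
      = 2 * Real.pi ^ 2 * (-1) ^ (∑ i, (n i : ℕ)) := by
    rw [Finset.prod_mul_distrib, Finset.prod_pow_eq_pow_sum, Finset.prod_const, Finset.card_univ,
      Fintype.card_fin, show Real.sqrt Real.pi ^ 4 = (Real.sqrt Real.pi ^ 2) ^ 2 by ring,
      Real.sq_sqrt Real.pi_pos.le]
    ring
  rw [e] at h1
  refine h1.congr' ?_
  filter_upwards [eventually_ge_atTop 0] with τ hτ
  rw [integral_heatKernel_cell hτ]

/-- The primitive is replaced by its corner value on each cell. The error tends to 0 by dominated
convergence with majorant 4C/s, and the piecewise constant part is a finite sum of product Gaussian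
limits. -/
theorem tendsto_integral_prim_heatKernel {m₀ w : ℝ} (hm₀ : m₀ ≠ 0) (hw : 0 < w)
    (hR : ∀ p, 0 < overlapR m₀ p) :
    Tendsto (fun τ => ∫ p in brillouinZone, overlapPrim m₀ w p * heatKernel τ p) atTop
      (𝓝 (2 * Real.pi ^ 2 * ∑ n : Fin 4 → Fin 2,
        (-1) ^ (∑ i, (n i : ℕ)) * overlapPrim m₀ w (corner n))) := by
  have hq : ∀ p, massDenom m₀ w p ≠ 0 := fun p => (massDenom_pos hm₀ hw (hR p)).ne'
  obtain ⟨C, hC⟩ := abs_prim_sub_cell_le hm₀ hw hR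
  have hI : ∀ τ, IntegrableOn (fun p => overlapPrim m₀ w p * heatKernel τ p) brillouinZone :=
    fun τ => ((continuous_overlapPrim hq).mul
      (continuous_heatKernel τ)).continuousOn.integrableOn_compact isCompact_brillouinZone
  have hJ := fun τ => integrableOn_heatKernel_cell τ fun n => overlapPrim m₀ w (corner n)
  have h1 : Tendsto (fun τ => ∫ p in brillouinZone,
      (overlapPrim m₀ w p * heatKernel τ p - overlapPrim m₀ w (corner (cell p)) * heatKernel τ p))
      atTop (𝓝 (∫ _p in brillouinZone, (0 : ℝ))) := by
    refine tendsto_integral_filter_of_dominated_convergence (fun p => C * 4 * (sinSq p)⁻¹)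
      (Eventually.of_forall fun τ => ((hI τ).sub (hJ τ)).aestronglyMeasurable) ?_
      (integrableOn_inv_sinSq.const_mul _) ?_
    · filter_upwards [eventually_ge_atTop 0] with τ hτ
      filter_upwards [ae_sinSq_ne_zero brillouinZone,
        ae_restrict_mem measurableSet_brillouinZone] with p hp hpB
      have hs : 0 < sinSq p := lt_of_le_of_ne (sinSq_nonneg p) (Ne.symm hp)
      rw [← sub_mul, Real.norm_eq_abs, abs_mul]
      calc _ ≤ C * sinSq p * (4 * (sinSq p)⁻¹ ^ 2) :=
            mul_le_mul (hC p hpB) (abs_heatKernel_le hτ hs) (abs_nonneg _)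
              ((abs_nonneg _).trans (hC p hpB))
        _ = _ := by field_simp
    · filter_upwards [ae_sinSq_ne_zero brillouinZone] with p hp
      have hs : 0 < sinSq p := lt_of_le_of_ne (sinSq_nonneg p) (Ne.symm hp)
      simpa [sub_mul] using (tendsto_heatKernel hs).const_mul
        (overlapPrim m₀ w p - overlapPrim m₀ w (corner (cell p)))
  rw [integral_zero] at h1
  have h2 : Tendsto (fun τ => ∫ p in brillouinZone,
      overlapPrim m₀ w (corner (cell p)) * heatKernel τ p) atTop
      (𝓝 (2 * Real.pi ^ 2 * ∑ n : Fin 4 → Fin 2,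
        (-1) ^ (∑ i, (n i : ℕ)) * overlapPrim m₀ w (corner n))) := by
    have h3 := tendsto_finsetSum Finset.univ fun (n : Fin 4 → Fin 2) _ =>
      (tendsto_integral_heatKernel_cell n).const_mul (overlapPrim m₀ w (corner n))
    rw [Finset.mul_sum]
    have e1 : ∑ n : Fin 4 → Fin 2, overlapPrim m₀ w (corner n) *
        (2 * Real.pi ^ 2 * (-1) ^ (∑ i, (n i : ℕ))) = ∑ n : Fin 4 → Fin 2,
        2 * Real.pi ^ 2 * ((-1) ^ (∑ i, (n i : ℕ)) * overlapPrim m₀ w (corner n)) :=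
      Finset.sum_congr rfl fun n _ => by ring
    rw [← e1]
    refine h3.congr fun τ => ?_
    simp only [← integral_const_mul]
    rw [← integral_finsetSum]
    · refine integral_congr_ae (Eventually.of_forall fun p => ?_)
      simp
    · intro n _
      exact (integrableOn_heatKernel_cell τ fun k => if k = n then 1 else 0).const_mul _
  have h4 := h1.add h2
  rw [zero_add] at h4
  refine h4.congr fun τ => ?_
  rw [integral_sub (hI τ) (hJ τ), sub_add_cancel]

theorem sum_cells_comp (h : ℕ → ℝ) :
    ∑ n : Fin 4 → Fin 2, h (∑ i, (n i : ℕ)) = ∑ k ∈ Finset.range 5, (Nat.choose 4 k : ℝ) * h k := by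
  have h1 : ∀ n : Fin 4 → Fin 2, ∑ i, (n i : ℕ) ∈ Finset.range 5 := by decide
  rw [← Finset.sum_fiberwise_of_maps_to (fun n _ => h1 n)]
  refine Finset.sum_congr rfl fun k hk => ?_
  have h2 : ∀ n ∈ Finset.univ.filter (fun n : Fin 4 → Fin 2 => ∑ i, (n i : ℕ) = k),
      h (∑ i, (n i : ℕ)) = h k := fun n hn => by rw [(Finset.mem_filter.1 hn).2]
  rw [Finset.sum_congr rfl h2, Finset.sum_const, nsmul_eq_mul]
  have h3 : ∀ k ∈ Finset.range 5,
      (Finset.univ.filter (fun n : Fin 4 → Fin 2 => ∑ i, (n i : ℕ) = k)).card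
        = Nat.choose 4 k := by decide
  rw [h3 k hk]

/-- The degree of the map `p ↦ g(p)`. -/
def overlapDegree (m₀ : ℝ) : ℝ :=
  -(1 / 2) * ∑ k ∈ Finset.range 5, (-1 : ℝ) ^ k * (Nat.choose 4 k : ℝ) *
    Real.sign (2 * (k : ℝ) - m₀)

theorem integral_density {m₀ w : ℝ} (hm₀ : m₀ ≠ 0) (hw : 0 < w)
    (hR : ∀ p, 0 < overlapR m₀ p) :
    ∫ p in brillouinZone, overlapDensity m₀ w p = Real.pi ^ 2 / (2 * w) * overlapDegree m₀ := by
  have h1 := tendsto_integral_density_cutoff (integrableOn_density hm₀ hw hR)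
  have h2 := tendsto_integral_prim_heatKernel hm₀ hw hR
  have h3 : Tendsto (fun τ => (∫ p in brillouinZone,
      w * overlapDensity m₀ w p * cutoff τ (sinSq p)) +
      ∫ p in brillouinZone, overlapPrim m₀ w p * heatKernel τ p) atTop (𝓝 0) := by
    refine tendsto_const_nhds.congr' ?_
    filter_upwards [eventually_ge_atTop 0] with τ hτ
    exact (integral_density_cutoff hm₀ hw hR hτ).symm
  have h4 := tendsto_nhds_unique (h1.add h2) h3
  have h5 : ∀ n : Fin 4 → Fin 2, (-1 : ℝ) ^ (∑ i, (n i : ℕ)) * overlapPrim m₀ w (corner n)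
      = (fun k : ℕ => (-1 : ℝ) ^ k * ((1 + Real.sign (2 * (k : ℝ) - m₀)) / 8))
        (∑ i, (n i : ℕ)) := by
    intro n
    have hA : overlapA m₀ (corner n) ≠ 0 := by
      have := hR (corner n)
      rw [overlapR_corner] at this
      exact abs_pos.1 this
    rw [overlapPrim_corner hm₀ n hA, overlapA_corner]
  rw [Finset.sum_congr rfl fun n _ => h5 n, sum_cells_comp
    (fun k : ℕ => (-1 : ℝ) ^ k * ((1 + Real.sign (2 * (k : ℝ) - m₀)) / 8))] at h4
  -- The constant 1 in 1 + sign drops out because ∑ (-1)ᵏ C(4, k) = 0.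
  have h6 : ∑ k ∈ Finset.range 5, (Nat.choose 4 k : ℝ) *
      ((-1 : ℝ) ^ k * ((1 + Real.sign (2 * (k : ℝ) - m₀)) / 8)) = -(1 / 4) * overlapDegree m₀ := by
    unfold overlapDegree
    simp only [Finset.sum_range_succ, Finset.sum_range_zero]
    norm_num [Nat.choose]
    ring
  rw [h6] at h4
  field_simp
  linarith


/-! ### Zeros and poles of the Green function -/

/-- A zero of sine is simple, so the zeros of s are isolated. -/
theorem eventually_sinSq_ne_zero (p : Mom) : ∀ᶠ q in 𝓝[≠] p, sinSq q ≠ 0 := by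
  by_cases hs : sinSq p = 0
  · have h1 : ∀ i, ∀ᶠ q : Mom in 𝓝 p, q i ≠ p i → Real.sin (q i) ≠ 0 := by
      intro i
      have h2 : ∀ᶠ x in 𝓝[≠] (p i), Real.sin x ≠ 0 := by
        refine (Real.hasDerivAt_sin (p i)).eventually_ne ?_
        intro h0
        have := Real.sin_sq_add_cos_sq (p i)
        rw [sinSq_eq_zero.1 hs i, h0] at this
        norm_num at this
      rw [eventually_nhdsWithin_iff] at h2
      exact (continuous_apply i).continuousAt.eventually h2
    rw [eventually_nhdsWithin_iff]
    filter_upwards [eventually_all.2 h1] with q hq hne h0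
    obtain ⟨i, hi⟩ := Function.ne_iff.1 hne
    exact hq i hi (sinSq_eq_zero.1 h0 i)
  · exact eventually_nhdsWithin_of_eventually_nhds
      (continuous_sinSq.continuousAt.eventually_ne hs)

theorem sub_ne_zero_of_sinSq {m₀ : ℝ} {p : Mom} (hs : sinSq p ≠ 0) :
    overlapR m₀ p - overlapA m₀ p ≠ 0 := by
  intro h0
  have h := sub_mul_add_overlap m₀ p
  rw [h0, zero_mul] at h
  exact hs h.symm

/-- The Green function in terms of everywhere smooth functions. -/
theorem overlapGreen_eq {γ : Fin 4 → SpinMat} (hγ : IsClifford γ) {m₀ m : ℝ} {p : Mom}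
    (hu : overlapR m₀ p - overlapA m₀ p ≠ 0) (hq : massDenom m₀ (m ^ 2) p ≠ 0) :
    overlapGreen γ m₀ m p = ((massDenom m₀ (m ^ 2) p)⁻¹ : ℂ) •
      (slash γ (fun i => ((2 * m₀ * Real.sin (p i) : ℝ) : ℂ)) +
        (Complex.I * (m : ℂ) * ((overlapR m₀ p - overlapA m₀ p : ℝ) : ℂ)) • 1) := by
  have hsum := sum_overlapG_sq hu (m ^ 2)
  rw [overlapGreen, green_eq hγ _ _ _ (by rw [hsum]; exact div_ne_zero hq hu), hsum]
  have hu' : ((overlapR m₀ p - overlapA m₀ p : ℝ) : ℂ) ≠ 0 := by exact_mod_cast hu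
  set u := overlapR m₀ p - overlapA m₀ p with hu_def
  have e : (fun i => ((overlapG m₀ p i : ℝ) : ℂ))
      = (u : ℂ)⁻¹ • fun i => ((2 * m₀ * Real.sin (p i) : ℝ) : ℂ) := by
    ext i
    rw [overlapG_eq, ← hu_def, Pi.smul_apply, smul_eq_mul, ← Complex.ofReal_inv,
      ← Complex.ofReal_mul, div_eq_inv_mul]
  rw [e, map_smul, smul_add, smul_add, smul_smul, smul_smul, smul_smul, Complex.ofReal_div, inv_div]
  congr 2
  · field_simp
  · field_simp

theorem continuous_slash {X : Type*} [TopologicalSpace X] {n : ℕ} (Γ : Fin n → SpinMat)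
    {f : X → Fin n → ℂ} (hf : Continuous f) : Continuous fun x => slash Γ (f x) := by
  simp only [slash_apply]
  refine continuous_finsetSum _ fun i _ => ?_
  have h : Continuous fun x => f x i := (continuous_apply i).comp hf
  exact h.smul continuous_const

/-- R = A > 0 forces s = 0, and there g tends to infinity. The assigned value g = 0 at the point
itself plays no role, as the limit is taken in the punctured vicinity. -/
theorem isGreenZero_of_sub_eq_zero {γ : Fin 4 → SpinMat} (hγ : IsClifford γ) {m₀ m : ℝ}
    (hm₀ : m₀ ≠ 0) (hm : m ≠ 0) (hR : ∀ p, 0 < overlapR m₀ p) {p : Mom}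
    (hu : overlapR m₀ p - overlapA m₀ p = 0) : IsGreenZero (overlapGreen γ m₀ m) p := by
  have hq : ∀ q, massDenom m₀ (m ^ 2) q ≠ 0 := fun q =>
    (massDenom_pos hm₀ (by positivity) (hR q)).ne'
  have hs : sinSq p = 0 := by rw [← sub_mul_add_overlap m₀ p, hu, zero_mul]
  have hcont : Continuous fun p => ((massDenom m₀ (m ^ 2) p)⁻¹ : ℂ) •
      (slash γ (fun i => ((2 * m₀ * Real.sin (p i) : ℝ) : ℂ)) +
        (Complex.I * (m : ℂ) * ((overlapR m₀ p - overlapA m₀ p : ℝ) : ℂ)) • (1 : SpinMat)) := by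
    have h1 : Continuous fun p : Mom => (fun i => ((2 * m₀ * Real.sin (p i) : ℝ) : ℂ)) := by
      fun_prop
    have h2 : Continuous fun p : Mom =>
        Complex.I * (m : ℂ) * ((overlapR m₀ p - overlapA m₀ p : ℝ) : ℂ) := by
      fun_prop
    have h3 : Continuous fun p : Mom => ((massDenom m₀ (m ^ 2) p)⁻¹ : ℂ) := by
      refine Continuous.inv₀ (by fun_prop) fun q => ?_
      exact_mod_cast hq q
    exact h3.smul ((continuous_slash γ h1).add (h2.smul continuous_const))
  have h1 := hcont.tendsto p
  have h0 : (fun i => ((2 * m₀ * Real.sin (p i) : ℝ) : ℂ)) = 0 := by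
    ext i; simp [sinSq_eq_zero.1 hs i]
  rw [h0, hu, map_zero, Complex.ofReal_zero, mul_zero, zero_smul, add_zero, smul_zero] at h1
  refine (h1.mono_left nhdsWithin_le_nhds).congr' ?_
  filter_upwards [eventually_sinSq_ne_zero p] with q hsq
  exact (overlapGreen_eq hγ (sub_ne_zero_of_sinSq hsq) (hq q)).symm

theorem differentiableAt_overlapG {m₀ : ℝ} {p : Mom} (hR : 0 < overlapR m₀ p)
    (hu : overlapR m₀ p - overlapA m₀ p ≠ 0) (i : Fin 4) :
    DifferentiableAt ℝ (fun q => overlapG m₀ q i) p := by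
  simp only [overlapG_eq, div_eq_mul_inv]
  have h1 := differentiableAt_overlapR hR
  have h2 := differentiable_overlapA m₀ p
  exact DifferentiableAt.fun_mul (by fun_prop) ((h1.fun_sub h2).fun_inv hu)

theorem differentiableAt_slash_entry {Γ : Fin 4 → SpinMat} {f : Mom → Fin 4 → ℝ} {k : Mom → ℂ}
    {p : Mom} (hf : ∀ a, DifferentiableAt ℝ (fun q => f q a) p) (hk : DifferentiableAt ℝ k p)
    (i j : Fin 4) : DifferentiableAt ℝ
      (fun q => (slash Γ (fun a => (f q a : ℂ)) + k q • (1 : SpinMat)) i j) p := by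
  simp only [slash_apply, Matrix.add_apply, Matrix.sum_apply, Matrix.smul_apply, smul_eq_mul]
  refine DifferentiableAt.fun_add (DifferentiableAt.fun_sum fun a _ => ?_) (hk.mul_const _)
  exact (Complex.ofRealCLM.differentiableAt.comp p (hf a)).mul_const _

theorem differentiableAt_overlapGreen_inv {γ : Fin 4 → SpinMat} (hγ : IsClifford γ) {m₀ m : ℝ}
    (hm : m ≠ 0) {p : Mom} (hR : 0 < overlapR m₀ p)
    (hu : overlapR m₀ p - overlapA m₀ p ≠ 0) (i j : Fin 4) :
    DifferentiableAt ℝ (fun q => (overlapGreen γ m₀ m q)⁻¹ i j) p := by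
  have h := differentiableAt_slash_entry (Γ := γ) (k := fun _ => -(Complex.I * (m : ℂ)))
    (differentiableAt_overlapG hR hu) (differentiableAt_const _) i j
  refine h.congr_of_eventuallyEq (Eventually.of_forall fun q => ?_)
  simp only [overlapGreen]
  rw [green_inv hγ _ m q (denom_pos _ hm).ne', neg_smul, sub_eq_add_neg]

theorem differentiableAt_overlapGreen {γ : Fin 4 → SpinMat} (hγ : IsClifford γ) {m₀ m : ℝ}
    (hm : m ≠ 0) {p : Mom} (hR : 0 < overlapR m₀ p)
    (hu : overlapR m₀ p - overlapA m₀ p ≠ 0) (i j : Fin 4) :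
    DifferentiableAt ℝ (fun q => overlapGreen γ m₀ m q i j) p := by
  have hg := differentiableAt_overlapG hR hu
  have hd : DifferentiableAt ℝ (fun q => (∑ i, overlapG m₀ q i ^ 2 + m ^ 2)⁻¹) p :=
    DifferentiableAt.fun_inv ((DifferentiableAt.fun_sum fun a _ => (hg a).fun_pow 2).add_const _)
      (denom_pos _ hm).ne'
  have h := (Complex.ofRealCLM.differentiableAt.comp p hd).fun_mul
    (differentiableAt_slash_entry (Γ := γ) (k := fun _ => Complex.I * (m : ℂ))
      hg (differentiableAt_const _) i j)
  refine h.congr_of_eventuallyEq (Eventually.of_forall fun q => ?_)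
  simp only [overlapGreen]
  rw [green_eq hγ _ m q (denom_pos _ hm).ne']
  simp

/-- Where s ≠ 0, both 𝒢 and 𝒢⁻¹ are continuous and their product is 1, so neither can tend to 0. -/
theorem zerosAndPoles_subset {γ : Fin 4 → SpinMat} (hγ : IsClifford γ) {m₀ m : ℝ}
    (hm : m ≠ 0) (hR : ∀ p, 0 < overlapR m₀ p) :
    zerosAndPoles (overlapGreen γ m₀ m) ⊆ {p | sinSq p = 0} := by
  intro p hp
  by_contra hs
  have hu := sub_ne_zero_of_sinSq (m₀ := m₀) hs
  have hR' := (denom_pos (overlapG m₀ p) hm).ne'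
  have hmul : (overlapGreen γ m₀ m p)⁻¹ * overlapGreen γ m₀ m p = 1 := by
    unfold overlapGreen
    rw [green_inv hγ _ m p hR', green_eq hγ _ m p hR', Matrix.mul_smul, slash_sub_mul hγ,
      ofReal_denom, smul_smul, inv_mul_cancel₀, one_smul]
    exact_mod_cast hR'
  rcases hp with hp | hp
  · have hc : ContinuousAt (overlapGreen γ m₀ m) p :=
      continuousAt_pi.2 fun i => continuousAt_pi.2 fun j =>
        (differentiableAt_overlapGreen hγ hm (hR p) hu i j).continuousAt
    have h0 := tendsto_nhds_unique hp (hc.tendsto.mono_left nhdsWithin_le_nhds)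
    rw [← h0, mul_zero] at hmul
    exact zero_ne_one hmul
  · have hc : ContinuousAt (fun p => (overlapGreen γ m₀ m p)⁻¹) p :=
      continuousAt_pi.2 fun i => continuousAt_pi.2 fun j =>
        (differentiableAt_overlapGreen_inv hγ hm (hR p) hu i j).continuousAt
    have h0 := tendsto_nhds_unique hp (hc.tendsto.mono_left nhdsWithin_le_nhds)
    rw [← h0, zero_mul] at hmul
    exact zero_ne_one hmul

theorem sub_ne_zero_of_notMem {γ : Fin 4 → SpinMat} (hγ : IsClifford γ) {m₀ m : ℝ}
    (hm₀ : m₀ ≠ 0) (hm : m ≠ 0) (hR : ∀ p, 0 < overlapR m₀ p) {p : Mom}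
    (hp : p ∉ zerosAndPoles (overlapGreen γ m₀ m)) : overlapR m₀ p - overlapA m₀ p ≠ 0 :=
  fun hu => hp (Or.inl (isGreenZero_of_sub_eq_zero hγ hm₀ hm hR hu))

theorem isRegular_overlapGreen {γ : Fin 4 → SpinMat} (hγ : IsClifford γ) {m₀ m : ℝ}
    (hm₀ : m₀ ≠ 0) (hm : m ≠ 0) (hR : ∀ p, 0 < overlapR m₀ p) :
    IsRegular (overlapGreen γ m₀ m) := fun p hp i j =>
  have hu := sub_ne_zero_of_notMem hγ hm₀ hm hR hp
  ⟨differentiableAt_overlapGreen hγ hm (hR p) hu i j,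
    differentiableAt_overlapGreen_inv hγ hm (hR p) hu i j⟩

theorem differentiableAt_ghat {m₀ m : ℝ} (hm : m ≠ 0) {p : Mom} (hR : 0 < overlapR m₀ p)
    (hu : overlapR m₀ p - overlapA m₀ p ≠ 0) (a : Fin 5) :
    DifferentiableAt ℝ (ghat (overlapG m₀) (fun _ => m) a) p := by
  have hg := differentiableAt_overlapG hR hu
  have hd : DifferentiableAt ℝ (fun q => Real.sqrt (∑ i, overlapG m₀ q i ^ 2 + m ^ 2)) p :=
    ((DifferentiableAt.fun_sum fun a _ => (hg a).fun_pow 2).add_const _).sqrt (denom_pos _ hm).ne'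
  have hn : DifferentiableAt ℝ (fun q => (Fin.snoc (overlapG m₀ q) m : Fin 5 → ℝ) a) p := by
    refine Fin.lastCases ?_ (fun a => ?_) a
    · simp only [Fin.snoc_last]; exact differentiableAt_const _
    · simp only [Fin.snoc_castSucc]; exact hg a
  unfold ghat
  simp only [div_eq_mul_inv]
  exact hn.fun_mul (hd.fun_inv (Real.sqrt_pos.2 (denom_pos _ hm)).ne')

/-- R = 0 requires s = 0, hence all cosines are ±1, and A = 2k - m₀ = 0 with k the number of cosines
equal to -1. -/
theorem overlapR_pos {m₀ : ℝ} (h0 : m₀ ≠ 0) (h2 : m₀ ≠ 2) (h4 : m₀ ≠ 4) (h6 : m₀ ≠ 6)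
    (h8 : m₀ ≠ 8) (p : Mom) : 0 < overlapR m₀ p := by
  refine Real.sqrt_pos.2 (lt_of_le_of_ne (add_nonneg (sq_nonneg _) (sinSq_nonneg p)) fun h => ?_)
  have hs : sinSq p = 0 := by nlinarith [sinSq_nonneg p, sq_nonneg (overlapA m₀ p)]
  have hA : overlapA m₀ p = 0 := by
    rw [hs, add_zero] at h
    exact pow_eq_zero_iff two_ne_zero |>.1 h.symm
  have hc : ∀ i, Real.cos (p i) = 1 ∨ Real.cos (p i) = -1 := fun i =>
    Real.sin_eq_zero_iff_cos_eq.1 (sinSq_eq_zero.1 hs i)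
  rw [overlapA, Fin.sum_univ_four] at hA
  rcases hc 0 with h' | h' <;> rcases hc 1 with h'' | h'' <;> rcases hc 2 with h''' | h''' <;>
    rcases hc 3 with h'''' | h'''' <;> rw [h', h'', h''', h''''] at hA
  all_goals first
    | exact h0 (by linarith)
    | exact h2 (by linarith)
    | exact h4 (by linarith)
    | exact h6 (by linarith)
    | exact h8 (by linarith)

/-! ### Shrinking vicinities -/

/-- The closure of `S` is null, so the thickenings of `S` have measure tending to 0. Absolute
continuity of ∫ ‖f‖ then bounds the removed part uniformly over all U inside a thickening, which is
independence of shape. -/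
theorem limitOfShrinkingVicinities_of_integrableOn {V : Type*} [NormedAddCommGroup V]
    [NormedSpace ℝ V] {S : Set Mom} (hS : S ⊆ {p | sinSq p = 0}) {f : Mom → V}
    (hf : IntegrableOn f brillouinZone) :
    LimitOfShrinkingVicinities S (fun U => ∫ p in brillouinZone \ U, f p)
      (∫ p in brillouinZone, f p) := by
  intro ε hε
  have hfin : IsFiniteMeasure ((volume : Measure Mom).restrict brillouinZone) :=
    ⟨by rw [Measure.restrict_apply_univ]; exact isCompact_brillouinZone.measure_lt_top⟩
  have h0 : (volume.restrict brillouinZone) (closure S) = 0 := by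
    have h1 : closure S ⊆ {p | sinSq p = 0} := closure_minimal hS isClosed_sinSq_zero
    exact Measure.absolutelyContinuous_of_le Measure.restrict_le_self
      (measure_mono_null h1 volume_sinSq_zero)
  have h1 := tendsto_measure_thickening (μ := volume.restrict brillouinZone) (s := S)
    ⟨1, one_pos, measure_ne_top _ _⟩
  rw [h0] at h1
  have h2 := Integrable.tendsto_setIntegral_nhds_zero (μ := volume.restrict brillouinZone)
    (f := fun p => ‖f p‖) hf.norm h1
  have h3 := (h2.eventually (gt_mem_nhds hε)).and self_mem_nhdsWithin
  obtain ⟨r, hr, hr0⟩ := h3.exists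
  refine ⟨r, hr0, fun U hU hSU hUr => ?_⟩
  have h4 := integral_inter_add_sdiff hU.measurableSet hf
  rw [← h4, sub_add_cancel_right, norm_neg]
  calc ‖∫ p in brillouinZone ∩ U, f p‖ ≤ ∫ p in brillouinZone ∩ U, ‖f p‖ :=
        norm_integral_le_integral_norm _
    _ ≤ ∫ p in Metric.thickening r S, ‖f p‖ ∂(volume.restrict brillouinZone) := by
        rw [Measure.restrict_restrict Metric.isOpen_thickening.measurableSet, Set.inter_comm]
        refine setIntegral_mono_set (IntegrableOn.mono_set hf.norm Set.inter_subset_right)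
          (Eventually.of_forall fun _ => norm_nonneg _) ?_
        exact (Set.inter_subset_inter_left _ hUr).eventuallyLE
    _ < ε := hr

/-! ### One-dimensional integrals -/

theorem integrable_inv_sq_add_sq {a : ℝ} (ha : 0 < a) :
    Integrable fun x : ℝ => (a ^ 2 + x ^ 2)⁻¹ := by
  have h := (integrable_inv_one_add_sq.comp_div ha.ne').const_mul (a ^ 2)⁻¹
  refine h.congr (Eventually.of_forall fun x => ?_)
  simp only
  field_simp

theorem integral_inv_sq_add_sq {a : ℝ} (ha : 0 < a) :
    ∫ x : ℝ, (a ^ 2 + x ^ 2)⁻¹ = Real.pi / a := by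
  have h := Measure.integral_comp_div (fun x : ℝ => (1 + x ^ 2)⁻¹) a
  rw [integral_univ_inv_one_add_sq, abs_of_pos ha, smul_eq_mul] at h
  have e : ∀ x : ℝ, (a ^ 2 + x ^ 2)⁻¹ = (a ^ 2)⁻¹ * (1 + (x / a) ^ 2)⁻¹ := by
    intro x; field_simp
  simp only [e]
  rw [integral_const_mul, h]
  field_simp

theorem integral_inv_sq_add_sq_cube {a : ℝ} (ha : 0 < a) :
    ∫ x : ℝ, ((a ^ 2 + x ^ 2) ^ 3)⁻¹ = 3 * Real.pi / (8 * a ^ 5) := by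
  have hpos : ∀ x : ℝ, 0 < a ^ 2 + x ^ 2 := fun x => by positivity
  have hint : Integrable fun x : ℝ => ((a ^ 2 + x ^ 2) ^ 3)⁻¹ := by
    refine ((integrable_inv_sq_add_sq ha).const_mul (a ^ 4)⁻¹).mono'
      (Continuous.aestronglyMeasurable (Continuous.inv₀ (by fun_prop)
        fun x => (pow_pos (hpos x) 3).ne')) (Eventually.of_forall fun x => ?_)
    rw [Real.norm_of_nonneg (by positivity), ← mul_inv]
    refine inv_anti₀ (mul_pos (by positivity) (hpos x)) ?_
    have h1 : (a ^ 2) ^ 2 ≤ (a ^ 2 + x ^ 2) ^ 2 :=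
      pow_le_pow_left₀ (by positivity) (le_add_of_nonneg_right (sq_nonneg x)) 2
    calc a ^ 4 * (a ^ 2 + x ^ 2) = (a ^ 2) ^ 2 * (a ^ 2 + x ^ 2) := by ring
      _ ≤ (a ^ 2 + x ^ 2) ^ 2 * (a ^ 2 + x ^ 2) := mul_le_mul_of_nonneg_right h1 (hpos x).le
      _ = _ := by ring
  -- The antiderivative comes from applying twice the reduction formula for powers of 1/(a² + x²).
  -- Only its arctangent term has a nonzero limit at infinity.
  have hderiv : ∀ x : ℝ, HasDerivAt (fun x : ℝ => x / (4 * a ^ 2 * (a ^ 2 + x ^ 2) ^ 2) +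
      3 * x / (8 * a ^ 4 * (a ^ 2 + x ^ 2)) + 3 / (8 * a ^ 5) * Real.arctan (x / a))
      ((a ^ 2 + x ^ 2) ^ 3)⁻¹ x := by
    intro x
    have hx := (hpos x).ne'
    have hd : HasDerivAt (fun x : ℝ => a ^ 2 + x ^ 2) (2 * x) x := by
      simpa using ((hasDerivAt_id x).fun_pow 2).const_add (a ^ 2)
    have h1 := (hasDerivAt_id' x).fun_div ((hd.fun_pow 2).const_mul (4 * a ^ 2)) (by positivity)
    have h2 := ((hasDerivAt_id' x).const_mul 3).fun_div (hd.const_mul (8 * a ^ 4)) (by positivity)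
    have h3 := (((hasDerivAt_id' x).div_const a).arctan).const_mul (3 / (8 * a ^ 5))
    refine ((h1.fun_add h2).fun_add h3).congr_deriv ?_
    have : 1 + (x / a) ^ 2 = (a ^ 2 + x ^ 2) / a ^ 2 := by field_simp
    rw [this]
    push_cast
    field_simp
    ring
  have hB : Tendsto (fun x : ℝ => x / (4 * a ^ 2 * (a ^ 2 + x ^ 2) ^ 2) +
      3 * x / (8 * a ^ 4 * (a ^ 2 + x ^ 2))) atTop (𝓝 0) := by
    have h0 : Tendsto (fun x : ℝ => (1 / (4 * a ^ 4) + 3 / (8 * a ^ 4)) * x⁻¹) atTop (𝓝 0) := by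
      have h := (tendsto_inv_atTop_zero (𝕜 := ℝ)).const_mul (1 / (4 * a ^ 4) + 3 / (8 * a ^ 4))
      rwa [mul_zero] at h
    refine squeeze_zero' ?_ ?_ h0
    · filter_upwards [eventually_gt_atTop 0] with x hx
      positivity
    · filter_upwards [eventually_gt_atTop 0] with x hx
      rw [add_mul]
      refine add_le_add ?_ ?_
      · rw [← div_eq_mul_inv, div_div, div_le_div_iff₀ (by positivity) (by positivity)]
        nlinarith [mul_pos (pow_pos ha 2) (pow_pos ha 4), mul_pos (pow_pos ha 4) (pow_pos hx 2),
          mul_pos (pow_pos ha 2) (pow_pos hx 4)]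
      · rw [← div_eq_mul_inv, div_div, div_le_div_iff₀ (by positivity) (by positivity)]
        nlinarith [mul_pos (pow_pos ha 4) (pow_pos ha 2)]
  have hat : Tendsto (fun x : ℝ => Real.arctan (x / a)) atTop (𝓝 (Real.pi / 2)) :=
    (tendsto_nhds_of_tendsto_nhdsWithin Real.tendsto_arctan_atTop).comp
      (tendsto_id.atTop_div_const ha)
  have htop := hB.add (hat.const_mul (3 / (8 * a ^ 5)))
  have hbot : Tendsto (fun x : ℝ => x / (4 * a ^ 2 * (a ^ 2 + x ^ 2) ^ 2) +
      3 * x / (8 * a ^ 4 * (a ^ 2 + x ^ 2)) + 3 / (8 * a ^ 5) * Real.arctan (x / a)) atBot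
      (𝓝 (-(0 + 3 / (8 * a ^ 5) * (Real.pi / 2)))) := by
    refine ((htop.comp tendsto_neg_atBot_atTop).neg).congr fun x => ?_
    simp only [Function.comp_apply, neg_div, Real.arctan_neg, neg_sq]
    ring
  rw [integral_of_hasDerivAt_of_tendsto hderiv hint hbot htop]
  field_simp
  ring


/-! ### Joint integrability in `(p, p₅)` -/

theorem measurable_jointDensity (m₀ m : ℝ) :
    Measurable fun z : ℝ × Mom => overlapDensity m₀ (m ^ 2 + z.1 ^ 2) z.2 := by
  unfold overlapDensity massDenom
  exact Measurable.div (by fun_prop) (by fun_prop)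

theorem exists_overlapR_upper (m₀ : ℝ) : ∃ C > 0, ∀ p ∈ brillouinZone, overlapR m₀ p ≤ C := by
  obtain ⟨C, hC⟩ := isCompact_brillouinZone.exists_bound_of_continuousOn
    (continuous_overlapR m₀).continuousOn
  refine ⟨max C 1, lt_max_of_lt_right one_pos, fun p hp => ?_⟩
  exact ((le_abs_self _).trans (hC p hp)).trans (le_max_left _ _)

/-- `massDenom` has a constant lower bound and one proportional to s(1 + p₅²). The latter alone
would make the density too singular at s = 0, the former alone gives no decay in p₅; an
interpolation of the two gives both. -/
theorem integrable_jointDensity {m₀ m : ℝ} (hm₀ : m₀ ≠ 0) (hm : m ≠ 0)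
    (hR : ∀ p, 0 < overlapR m₀ p) :
    Integrable (fun z : ℝ × Mom => overlapDensity m₀ (m ^ 2 + z.1 ^ 2) z.2)
      (volume.prod (volume.restrict brillouinZone)) := by
  obtain ⟨r, hr, hrR⟩ := exists_overlapR_lower hR
  obtain ⟨T, hT, hTR⟩ := exists_overlapR_upper m₀
  have hm2 : 0 < m ^ 2 := by positivity
  have hmin : 0 < min (4 * m₀ ^ 2) (m ^ 2) := lt_min (by positivity) hm2
  have hmin1 : 0 < min (m ^ 2) 1 := lt_min hm2 one_pos
  set c₀ := 2 * min (4 * m₀ ^ 2) (m ^ 2) * r with hc₀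
  set c₁ := min (m ^ 2) 1 / (2 * T) with hc₁
  have hc₀pos : 0 < c₀ := by positivity
  have hc₁pos : 0 < c₁ := by positivity
  have hx : Integrable fun x : ℝ => (1 + ‖x‖ ^ 2) ^ (-(3 / 2 : ℝ) / 2) :=
    integrable_rpow_neg_one_add_norm_sq (by norm_num)
  have hprod := (hx.mul_prod integrableOn_sinSq_rpow).const_mul
    (32 * m₀ ^ 4 * (12 + |m₀|) * (c₀ ^ (9 / 4 : ℝ) * c₁ ^ (3 / 4 : ℝ))⁻¹)
  refine hprod.mono' (measurable_jointDensity m₀ m).aestronglyMeasurable ?_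
  have hae1 : ∀ᵐ z : ℝ × Mom ∂(volume.prod (volume.restrict brillouinZone)),
      sinSq z.2 ≠ 0 :=
    Measure.quasiMeasurePreserving_snd.ae (ae_sinSq_ne_zero brillouinZone)
  have hae2 : ∀ᵐ z : ℝ × Mom ∂(volume.prod (volume.restrict brillouinZone)),
      z.2 ∈ brillouinZone :=
    Measure.quasiMeasurePreserving_snd.ae (ae_restrict_mem measurableSet_brillouinZone)
  filter_upwards [hae1, hae2] with z hz hzB
  have hs : 0 < sinSq z.2 := lt_of_le_of_ne (sinSq_nonneg _) (Ne.symm hz)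
  have hx1 : 0 < 1 + z.1 ^ 2 := by positivity
  have hq0 : c₀ ≤ massDenom m₀ (m ^ 2 + z.1 ^ 2) z.2 := le_trans
    (mul_le_mul_of_nonneg_left (hrR _ hzB) (by positivity))
    (massDenom_ge (le_add_of_nonneg_right (sq_nonneg _)) z.2)
  have hq1 : c₁ * (sinSq z.2 * (1 + z.1 ^ 2)) ≤ massDenom m₀ (m ^ 2 + z.1 ^ 2) z.2 := by
    have hAR := abs_le.1 (abs_overlapA_le m₀ z.2)
    have hu : sinSq z.2 / (2 * T) ≤ overlapR m₀ z.2 - overlapA m₀ z.2 := by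
      rw [div_le_iff₀ (by positivity), ← sub_mul_add_overlap m₀ z.2]
      refine mul_le_mul_of_nonneg_left ?_ (by linarith)
      linarith [hTR _ hzB]
    have hw : min (m ^ 2) 1 * (1 + z.1 ^ 2) ≤ m ^ 2 + z.1 ^ 2 := by
      have h1 := min_le_left (m ^ 2) 1
      have h2 := min_le_right (m ^ 2) 1
      nlinarith [mul_le_mul_of_nonneg_right h2 (sq_nonneg z.1)]
    have h3 : 0 ≤ 4 * m₀ ^ 2 * (overlapR m₀ z.2 + overlapA m₀ z.2) :=
      mul_nonneg (by positivity) (by linarith)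
    calc c₁ * (sinSq z.2 * (1 + z.1 ^ 2))
        = min (m ^ 2) 1 * (1 + z.1 ^ 2) * (sinSq z.2 / (2 * T)) := by rw [hc₁]; ring
      _ ≤ (m ^ 2 + z.1 ^ 2) * (overlapR m₀ z.2 - overlapA m₀ z.2) := by gcongr
      _ ≤ _ := by unfold massDenom; linarith
  have hqpos := hc₀pos.trans_le hq0
  set q := massDenom m₀ (m ^ 2 + z.1 ^ 2) z.2 with hq
  -- The exponents 9/4 + 3/4 = 3 leave s^{-1-3/4} and (1 + p₅²)^{-3/4}, integrable in four
  -- dimensions and in one dimension respectively.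
  have hcube : c₀ ^ (9 / 4 : ℝ) * (c₁ * (sinSq z.2 * (1 + z.1 ^ 2))) ^ (3 / 4 : ℝ) ≤ q ^ 3 := by
    have e : q ^ 3 = q ^ (9 / 4 : ℝ) * q ^ (3 / 4 : ℝ) := by
      rw [← Real.rpow_add hqpos, ← Real.rpow_natCast]; norm_num
    rw [e]
    gcongr
  have hb := abs_density_le (hR z.2) (by positivity) hcube
  rw [Real.norm_eq_abs]
  refine hb.trans (le_of_eq ?_)
  have e1 : sinSq z.2 ^ (-(7 / 4) : ℝ) = (sinSq z.2)⁻¹ * (sinSq z.2 ^ (3 / 4 : ℝ))⁻¹ := by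
    rw [← Real.rpow_neg hs.le, ← Real.rpow_neg_one, ← Real.rpow_add hs]; norm_num
  have e2 : (1 + ‖z.1‖ ^ 2) ^ (-(3 / 2 : ℝ) / 2) = ((1 + z.1 ^ 2) ^ (3 / 4 : ℝ))⁻¹ := by
    rw [← Real.rpow_neg hx1.le, Real.norm_eq_abs, sq_abs]; norm_num
  simp only [e1, e2]
  rw [Real.mul_rpow hc₁pos.le (by positivity), Real.mul_rpow hs.le hx1.le]
  simp only [mul_inv]
  ring

/-- Integration over the momentum torus comes before that over p₅: the inner value is proportional
to 1/(m² + p₅²), whose integral is π/|m|. The |m| here is the source of sign(m). -/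
theorem integral_integral_density {m₀ m : ℝ} (hm₀ : m₀ ≠ 0) (hm : m ≠ 0)
    (hR : ∀ p, 0 < overlapR m₀ p) :
    ∫ p in brillouinZone, ∫ x : ℝ, overlapDensity m₀ (m ^ 2 + x ^ 2) p
      = Real.pi ^ 3 / (2 * |m|) * overlapDegree m₀ := by
  have hswap := integral_integral_swap (f := fun x p => overlapDensity m₀ (m ^ 2 + x ^ 2) p)
    (integrable_jointDensity hm₀ hm hR)
  rw [← hswap]
  have h1 : ∀ x : ℝ, ∫ p in brillouinZone, overlapDensity m₀ (m ^ 2 + x ^ 2) p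
      = Real.pi ^ 2 / 2 * overlapDegree m₀ * (|m| ^ 2 + x ^ 2)⁻¹ := by
    intro x
    have hx : 0 < m ^ 2 + x ^ 2 := by positivity
    rw [integral_density hm₀ hx hR, sq_abs]
    field_simp
  simp only [h1]
  rw [integral_const_mul, integral_inv_sq_add_sq (abs_pos.2 hm)]
  ring

theorem integral_density_fiber {m₀ m : ℝ} (hm : m ≠ 0) {p : Mom} (hR : 0 < overlapR m₀ p)
    (hs : sinSq p ≠ 0) :
    ∫ x : ℝ, overlapDensity m₀ (m ^ 2 + x ^ 2) p = (Matrix.of (overlapJac m₀ p)).det *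
      (3 * Real.pi / (8 * Real.sqrt (∑ i, overlapG m₀ p i ^ 2 + m ^ 2) ^ 5)) := by
  have hpos := denom_pos (overlapG m₀ p) hm
  rw [← integral_inv_sq_add_sq_cube (Real.sqrt_pos.2 hpos), ← integral_const_mul]
  refine integral_congr_ae (Eventually.of_forall fun x => ?_)
  simp only
  rw [← det_div_eq_density hR hs, Real.sq_sqrt hpos.le, div_eq_mul_inv, add_assoc]

/-! ### The topological invariants of free overlap fermions -/

theorem ae_form4_eq {γ : Fin 4 → SpinMat} (hγ : IsClifford γ) {m₀ m : ℝ} (hm : m ≠ 0)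
    (hR : ∀ p, 0 < overlapR m₀ p) :
    (fun p => ((96 * m ^ 2 * overlapDensity m₀ (m ^ 2) p : ℝ) : ℂ))
      =ᵐ[volume.restrict brillouinZone] form4 γ (overlapGreen γ m₀ m) := by
  filter_upwards [ae_sinSq_ne_zero brillouinZone] with p hs
  rw [overlapGreen, form4_eq hγ hm
    (hasLineDerivAt_overlapG (hR p) (sub_ne_zero_of_sinSq hs)), ← det_div_eq_density (hR p) hs]

theorem hasN4_overlap {γ : Fin 4 → SpinMat} (hγ : IsClifford γ) {m₀ m : ℝ}
    (hm₀ : m₀ ≠ 0) (hm : m ≠ 0) (hR : ∀ p, 0 < overlapR m₀ p) :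
    HasN4 γ (overlapGreen γ m₀ m) (overlapDegree m₀) := by
  have hm2 : 0 < m ^ 2 := by positivity
  have hae := ae_form4_eq (m := m) hγ hm hR
  have hint : IntegrableOn (form4 γ (overlapGreen γ m₀ m)) brillouinZone :=
    (((integrableOn_density hm₀ hm2 hR).const_mul (96 * m ^ 2)).ofReal (𝕜 := ℂ)).congr hae
  refine ⟨isRegular_overlapGreen hγ hm₀ hm hR,
    fun U _ _ => hint.mono_set Set.sdiff_subset, ?_⟩
  have hlim := limitOfShrinkingVicinities_of_integrableOn (zerosAndPoles_subset hγ hm hR)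
    (hint.const_mul (1 / (48 * (Real.pi : ℂ) ^ 2)))
  simp only [integral_const_mul] at hlim
  have hval : 1 / (48 * (Real.pi : ℂ) ^ 2) *
      ∫ p in brillouinZone, form4 γ (overlapGreen γ m₀ m) p = (overlapDegree m₀ : ℂ) := by
    rw [← integral_congr_ae hae, integral_complex_ofReal, integral_const_mul,
      integral_density hm₀ hm2 hR]
    have hpi : (Real.pi : ℂ) ≠ 0 := by exact_mod_cast Real.pi_ne_zero
    have hmc : (m : ℂ) ≠ 0 := by exact_mod_cast hm
    push_cast
    field_simp
    norm_num
  rwa [hval] at hlim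

/-- The sphere form is the fibre integral over p₅ of the density: 24 m · 8/(3π) = 64 m/π. Its
integrability and its integral are thereby inherited from the five-dimensional problem. -/
theorem ae_formSphere_eq {m₀ m : ℝ} (hm : m ≠ 0) (hR : ∀ p, 0 < overlapR m₀ p) :
    (fun p => 64 * m / Real.pi * ∫ x : ℝ, overlapDensity m₀ (m ^ 2 + x ^ 2) p)
      =ᵐ[volume.restrict brillouinZone] formSphere (overlapG m₀) (fun _ => m) := by
  filter_upwards [ae_sinSq_ne_zero brillouinZone] with p hs
  rw [formSphere_eq hm (hasLineDerivAt_overlapG (hR p) (sub_ne_zero_of_sinSq hs)),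
    integral_density_fiber hm (hR p) hs]
  have hpi := Real.pi_ne_zero
  have hN := (Real.sqrt_pos.2 (denom_pos (overlapG m₀ p) hm)).ne'
  field_simp
  ring

theorem self_div_abs {m : ℝ} (hm : m ≠ 0) : m / |m| = Real.sign m := by
  rcases lt_or_gt_of_ne hm with h | h
  · rw [abs_of_neg h, Real.sign_of_neg h, div_neg, div_self hm]
  · rw [abs_of_pos h, Real.sign_of_pos h, div_self hm]

theorem hasN5Sphere_overlap {γ : Fin 4 → SpinMat} (hγ : IsClifford γ) {m₀ m : ℝ}
    (hm₀ : m₀ ≠ 0) (hm : m ≠ 0) (hR : ∀ p, 0 < overlapR m₀ p) :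
    HasN5Sphere γ (overlapG m₀) (fun _ => m) (Real.sign m * overlapDegree m₀) := by
  have hae := ae_formSphere_eq hm hR
  have hint : IntegrableOn (formSphere (overlapG m₀) (fun _ => m)) brillouinZone :=
    ((integrable_jointDensity hm₀ hm hR).integral_prod_right.const_mul
      (64 * m / Real.pi)).congr hae
  refine ⟨fun p hp a => differentiableAt_ghat hm (hR p)
    (sub_ne_zero_of_notMem hγ hm₀ hm hR hp) a, fun U _ _ => hint.mono_set Set.sdiff_subset, ?_⟩
  have hlim := limitOfShrinkingVicinities_of_integrableOn (zerosAndPoles_subset hγ hm hR)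
    (hint.const_mul (3 / (4 * Real.pi ^ 2 * (Nat.factorial 4 : ℝ))))
  simp only [integral_const_mul] at hlim
  have hval : 3 / (4 * Real.pi ^ 2 * (Nat.factorial 4 : ℝ)) *
      ∫ p in brillouinZone, formSphere (overlapG m₀) (fun _ => m) p
        = Real.sign m * overlapDegree m₀ := by
    rw [← integral_congr_ae hae, integral_const_mul, integral_integral_density hm₀ hm hR,
      ← self_div_abs hm]
    have hpi := Real.pi_ne_zero
    have hma := (abs_pos.2 hm).ne'
    simp only [Nat.factorial]
    push_cast
    field_simp
    norm_num
  rwa [hval] at hlim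

/-- Splitting off the last coordinate of `ℝ⁵`. -/
def splitLast : (Fin 5 → ℝ) ≃ᵐ ℝ × Mom := MeasurableEquiv.piFinSuccAbove (fun _ => ℝ) (Fin.last 4)

theorem splitLast_apply (q : Fin 5 → ℝ) : splitLast q = (q 4, fun i => q i.castSucc) := by
  refine Prod.ext rfl ?_
  ext i
  change q ((Fin.last 4).succAbove i) = _
  rw [Fin.succAbove_last]

theorem measurePreserving_splitLast : MeasurePreserving splitLast :=
  volume_preserving_piFinSuccAbove (fun _ => ℝ) (Fin.last 4)

theorem form5_ae_eq {γ : Fin 4 → SpinMat} (hγ : IsClifford γ) {m₀ m : ℝ} (hm : m ≠ 0)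
    (hR : ∀ p, 0 < overlapR m₀ p) :
    (fun q => 480 * Complex.I * (m : ℂ) *
      ((overlapDensity m₀ (m ^ 2 + (splitLast q).1 ^ 2) (splitLast q).2 : ℝ) : ℂ))
      =ᵐ[volume] form5 γ (overlapGreen γ m₀ m) := by
  have h1 : ∀ᵐ z : ℝ × Mom, sinSq z.2 ≠ 0 :=
    Measure.quasiMeasurePreserving_snd.ae (measure_eq_zero_iff_ae_notMem.1 volume_sinSq_zero)
  have h2 := measurePreserving_splitLast.quasiMeasurePreserving.ae h1
  filter_upwards [h2] with q hs
  rw [splitLast_apply] at hs ⊢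
  rw [overlapGreen, form5_eq hγ hm
    (hasLineDerivAt_overlapG (hR _) (sub_ne_zero_of_sinSq hs)),
    ← det_div_eq_density (hR _) hs]

theorem preimage_splitLast (T : Set Mom) :
    {q : Fin 5 → ℝ | (fun i : Fin 4 => q i.castSucc) ∈ T}
      = splitLast ⁻¹' (Set.univ ×ˢ T) := by
  ext q
  simp [splitLast_apply]

theorem hasN5_overlap {γ : Fin 4 → SpinMat} (hγ : IsClifford γ) {m₀ m : ℝ}
    (hm₀ : m₀ ≠ 0) (hm : m ≠ 0) (hR : ∀ p, 0 < overlapR m₀ p) :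
    HasN5 γ (overlapGreen γ m₀ m) (Real.sign m * overlapDegree m₀) := by
  set Φ : ℝ × Mom → ℂ := fun z => 480 * Complex.I * (m : ℂ) *
    ((overlapDensity m₀ (m ^ 2 + z.1 ^ 2) z.2 : ℝ) : ℂ) with hΦ
  have hae : (fun q => Φ (splitLast q)) =ᵐ[volume] form5 γ (overlapGreen γ m₀ m) :=
    form5_ae_eq hγ hm hR
  have hΦint : Integrable Φ (volume.prod (volume.restrict brillouinZone)) :=
    ((integrable_jointDensity hm₀ hm hR).ofReal (𝕜 := ℂ)).const_mul _
  have hrestrict : ∀ T : Set Mom, (volume : Measure (ℝ × Mom)).restrict (Set.univ ×ˢ T)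
      = volume.prod (volume.restrict T) := by
    intro T
    rw [Measure.volume_eq_prod, ← Measure.prod_restrict, Measure.restrict_univ]
  have hΦon : ∀ U : Set Mom, IntegrableOn Φ (Set.univ ×ˢ (brillouinZone \ U)) := by
    intro U
    have : IntegrableOn Φ (Set.univ ×ˢ brillouinZone) := by
      rw [IntegrableOn, hrestrict]; exact hΦint
    exact this.mono_set (Set.prod_mono le_rfl Set.sdiff_subset)
  have hint : ∀ U : Set Mom, IntegrableOn (form5 γ (overlapGreen γ m₀ m))
      {q | (fun i : Fin 4 => q i.castSucc) ∈ brillouinZone \ U} := by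
    intro U
    rw [preimage_splitLast]
    exact ((measurePreserving_splitLast.integrableOn_comp_preimage
      splitLast.measurableEmbedding).2 (hΦon U)).congr (ae_restrict_of_ae hae)
  refine ⟨isRegular_overlapGreen hγ hm₀ hm hR, fun U _ _ => hint U, ?_⟩
  have hfiber : ∀ U : Set Mom,
      ∫ q in {q : Fin 5 → ℝ | (fun i : Fin 4 => q i.castSucc) ∈ brillouinZone \ U},
        form5 γ (overlapGreen γ m₀ m) q = ∫ p in brillouinZone \ U, ∫ x : ℝ, Φ (x, p) := by
    intro U
    rw [preimage_splitLast, ← integral_congr_ae (ae_restrict_of_ae hae),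
      measurePreserving_splitLast.setIntegral_preimage_emb splitLast.measurableEmbedding,
      hrestrict, integral_prod_symm]
    rw [← hrestrict]; exact hΦon U
  simp only [hfiber]
  have hlim := limitOfShrinkingVicinities_of_integrableOn (zerosAndPoles_subset hγ hm hR)
    (hΦint.integral_prod_right.const_mul
      (1 / (2 * (Real.pi : ℂ) ^ 3 * (Nat.factorial 5 : ℂ) * Complex.I)))
  simp only [integral_const_mul _ (fun p => ∫ x : ℝ, Φ (x, p))] at hlim
  have hval : 1 / (2 * (Real.pi : ℂ) ^ 3 * (Nat.factorial 5 : ℂ) * Complex.I) *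
      ∫ p in brillouinZone, ∫ x : ℝ, Φ (x, p) = ((Real.sign m * overlapDegree m₀ : ℝ) : ℂ) := by
    simp only [hΦ, integral_const_mul, integral_complex_ofReal]
    rw [integral_integral_density hm₀ hm hR, ← self_div_abs hm]
    have hpi : (Real.pi : ℂ) ≠ 0 := by exact_mod_cast Real.pi_ne_zero
    have hma : ((|m| : ℝ) : ℂ) ≠ 0 := by exact_mod_cast (abs_pos.2 hm).ne'
    simp only [Nat.factorial]
    push_cast
    field_simp
    norm_num
  rwa [hval] at hlim


/-! ### Behaviour at the corners where `A` vanishes -/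

theorem ncard_overlapA_corner (k : ℕ) (hk : k ≤ 4) :
    {n : Fin 4 → Fin 2 | overlapA (2 * (k : ℝ)) (corner n) = 0}.ncard = Nat.choose 4 k := by
  have h : {n : Fin 4 → Fin 2 | overlapA (2 * (k : ℝ)) (corner n) = 0}
      = ((Finset.univ.filter fun n : Fin 4 → Fin 2 => ∑ i, (n i : ℕ) = k : Finset _) :
        Set (Fin 4 → Fin 2)) := by
    ext n
    rw [Set.mem_ofPred_eq, overlapA_corner, Finset.coe_filter_univ, Set.mem_ofPred_eq,
      ← @Nat.cast_inj ℝ]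
    constructor <;> intro h <;> linarith
  rw [h, Set.ncard_coe_finset]
  interval_cases k <;> decide

theorem sin_corner_add (n : Fin 4 → Fin 2) (δ : Mom) (i : Fin 4) :
    Real.sin ((corner n + δ) i) = (-1) ^ (n i : ℕ) * Real.sin (δ i) := by
  rw [Pi.add_apply, Real.sin_add, sin_corner, cos_corner]
  ring

theorem neg_one_pow_sq (k : ℕ) : ((-1 : ℝ) ^ k) ^ 2 = 1 := by
  rw [← pow_mul, mul_comm, pow_mul, neg_one_sq, one_pow]

theorem sinSq_corner_add (n : Fin 4 → Fin 2) (δ : Mom) : sinSq (corner n + δ) = sinSq δ := by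
  simp only [sinSq, sin_corner_add, mul_pow, neg_one_pow_sq, one_mul]

/-- The cosines are stationary at a corner, so A is of second order there, negligible against √s of
first order. -/
theorem abs_overlapA_corner_add {m₀ : ℝ} {n : Fin 4 → Fin 2} (hA : overlapA m₀ (corner n) = 0)
    (δ : Mom) : |overlapA m₀ (corner n + δ)| ≤ (∑ k, δ k ^ 2) / 2 := by
  have e : overlapA m₀ (corner n + δ) = ∑ i, (-1 : ℝ) ^ (n i : ℕ) * (1 - Real.cos (δ i)) := by
    rw [← sub_zero (overlapA m₀ (corner n + δ)), ← hA, overlapA, overlapA, add_sub_add_left_eq_sub,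
      ← Finset.sum_sub_distrib]
    refine Finset.sum_congr rfl fun i _ => ?_
    rw [Pi.add_apply, Real.cos_add, sin_corner, cos_corner]
    ring
  rw [e, Finset.sum_div]
  refine (Finset.abs_sum_le_sum_abs _ _).trans (Finset.sum_le_sum fun i _ => ?_)
  rw [abs_mul, abs_pow, abs_neg, abs_one, one_pow, one_mul,
    abs_of_nonneg (sub_nonneg.2 (Real.cos_le_one _))]
  linarith [Real.one_sub_sq_div_two_le_cos (x := δ i)]

/-- The Euclidean length `|δp|`. -/
def euclLength (δ : Mom) : ℝ := Real.sqrt (∑ k, δ k ^ 2)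

theorem euclLength_sq (δ : Mom) : euclLength δ ^ 2 = ∑ k, δ k ^ 2 :=
  Real.sq_sqrt (Finset.sum_nonneg fun _ _ => sq_nonneg _)

theorem euclLength_pos {δ : Mom} (hδ : δ ≠ 0) : 0 < euclLength δ := by
  obtain ⟨i, hi⟩ := Function.ne_iff.1 hδ
  refine Real.sqrt_pos.2 (Finset.sum_pos' (fun _ _ => sq_nonneg _) ⟨i, Finset.mem_univ i, ?_⟩)
  exact sq_pos_of_ne_zero hi

theorem abs_le_euclLength (δ : Mom) (i : Fin 4) : |δ i| ≤ euclLength δ :=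
  Real.abs_le_sqrt (Finset.single_le_sum (f := fun k => δ k ^ 2) (fun _ _ => sq_nonneg _)
    (Finset.mem_univ i))

theorem tendsto_euclLength : Tendsto euclLength (𝓝[≠] 0) (𝓝 0) := by
  have h : Continuous euclLength := by unfold euclLength; fun_prop
  have h0 : euclLength 0 = 0 := by simp [euclLength]
  simpa [h0] using (h.tendsto 0).mono_left nhdsWithin_le_nhds

theorem abs_div_euclLength_le (δ : Mom) (i : Fin 4) : |δ i / euclLength δ| ≤ 1 := by
  have hN : 0 ≤ euclLength δ := Real.sqrt_nonneg _
  rw [abs_div, abs_of_nonneg hN]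
  exact div_le_one_of_le₀ (abs_le_euclLength δ i) hN

theorem tendsto_mul_zero_of_abs_le {α : Type*} {l : Filter α} {f v : α → ℝ} {C : ℝ}
    (hf : Tendsto f l (𝓝 0)) (hv : ∀ x, |v x| ≤ C) : Tendsto (fun x => f x * v x) l (𝓝 0) := by
  refine squeeze_zero_norm (a := fun x => |f x| * C) (fun x => ?_) ?_
  · rw [Real.norm_eq_abs, abs_mul]
    exact mul_le_mul_of_nonneg_left (hv x) (abs_nonneg _)
  · simpa using hf.abs.mul_const C

theorem tendsto_sq_sub_sq {α : Type*} {l : Filter α} {f v : α → ℝ} {C : ℝ}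
    (hf : Tendsto (fun x => f x - v x) l (𝓝 0)) (hv : ∀ x, |v x| ≤ C) :
    Tendsto (fun x => f x ^ 2 - v x ^ 2) l (𝓝 0) := by
  have h := (hf.pow 2).add ((tendsto_mul_zero_of_abs_le hf hv).const_mul 2)
  simp only [zero_pow two_ne_zero, mul_zero, add_zero] at h
  refine h.congr fun x => ?_
  ring

theorem tendsto_sin_div_sub (i : Fin 4) :
    Tendsto (fun δ : Mom => Real.sin (δ i) / euclLength δ - δ i / euclLength δ) (𝓝[≠] 0) (𝓝 0) := by
  have h1 : (fun x : ℝ => Real.sin x - x) =o[𝓝 0] fun x => x := by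
    have h := (hasDerivAt_iff_isLittleO_nhds_zero.1 (Real.hasDerivAt_sin 0))
    simpa using h
  have h2 : Tendsto (fun δ : Mom => δ i) (𝓝[≠] 0) (𝓝 0) :=
    ((continuous_apply i).tendsto' (0 : Mom) 0 rfl).mono_left nhdsWithin_le_nhds
  have h3 : (fun δ : Mom => δ i) =O[𝓝[≠] 0] euclLength :=
    Asymptotics.IsBigO.of_bound 1 (Eventually.of_forall fun δ => by
      rw [one_mul, Real.norm_eq_abs, Real.norm_eq_abs]
      exact (abs_le_euclLength δ i).trans (le_abs_self _))
  simpa only [Function.comp_apply, sub_div] using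
    ((h1.comp_tendsto h2).trans_isBigO h3).tendsto_div_nhds_zero

theorem sum_div_euclLength_sq {δ : Mom} (hδ : δ ≠ 0) : ∑ i, (δ i / euclLength δ) ^ 2 = 1 := by
  simp only [div_pow, ← Finset.sum_div]
  rw [← euclLength_sq, div_self (pow_pos (euclLength_pos hδ) 2).ne']

theorem tendsto_sinSq_div : Tendsto (fun δ : Mom => sinSq δ / euclLength δ ^ 2) (𝓝[≠] 0) (𝓝 1) := by
  have h := (tendsto_finsetSum Finset.univ fun i _ =>
    tendsto_sq_sub_sq (tendsto_sin_div_sub i) (abs_div_euclLength_le · i)).add_const 1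
  rw [Finset.sum_const_zero, zero_add] at h
  refine h.congr' ?_
  filter_upwards [self_mem_nhdsWithin] with δ hδ
  rw [Finset.sum_sub_distrib, sum_div_euclLength_sq hδ, sub_add_cancel]
  simp only [div_pow, ← Finset.sum_div, sinSq]

/-- A/|δ| tends to 0 and s/|δ|² to 1, so only the square root of s contributes. -/
theorem tendsto_sub_div {m₀ : ℝ} {n : Fin 4 → Fin 2} (hA : overlapA m₀ (corner n) = 0) :
    Tendsto (fun δ => (overlapR m₀ (corner n + δ) - overlapA m₀ (corner n + δ)) / euclLength δ)
      (𝓝[≠] 0) (𝓝 1) := by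
  have h1 : Tendsto (fun δ => overlapA m₀ (corner n + δ) / euclLength δ) (𝓝[≠] 0) (𝓝 0) := by
    refine squeeze_zero_norm' (a := fun δ => euclLength δ / 2) ?_ ?_
    · filter_upwards [self_mem_nhdsWithin] with δ hδ
      have hN := euclLength_pos hδ
      rw [Real.norm_eq_abs, abs_div, abs_of_pos hN, div_le_iff₀ hN]
      refine (abs_overlapA_corner_add hA δ).trans (le_of_eq ?_)
      rw [← euclLength_sq]; ring
    · simpa using tendsto_euclLength.div_const 2
  have h2 := (((h1.pow 2).add tendsto_sinSq_div).sqrt).sub h1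
  rw [zero_pow two_ne_zero, zero_add, Real.sqrt_one, sub_zero] at h2
  refine h2.congr' ?_
  filter_upwards [self_mem_nhdsWithin] with δ hδ
  have hN := euclLength_pos hδ
  rw [sub_div, overlapR, sinSq_corner_add, div_pow, ← add_div, Real.sqrt_div' _ (sq_nonneg _),
    Real.sqrt_sq hN.le]

/-- The field `2 m₀ (-1)^{nᵢ} δpⁱ / |δp|` of radial vectors. -/
def radialField (m₀ : ℝ) (n : Fin 4 → Fin 2) (δ : Mom) (i : Fin 4) : ℝ :=
  2 * m₀ * ((-1) ^ (n i : ℕ) * (δ i / euclLength δ))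

theorem radialField_neg (m₀ : ℝ) (n : Fin 4 → Fin 2) (δ : Mom) (i : Fin 4) :
    radialField m₀ n (-δ) i = -radialField m₀ n δ i := by
  have : euclLength (-δ) = euclLength δ := by simp [euclLength]
  simp only [radialField, this, Pi.neg_apply]
  ring

theorem sum_radialField_sq (m₀ : ℝ) (n : Fin 4 → Fin 2) {δ : Mom} (hδ : δ ≠ 0) :
    ∑ i, radialField m₀ n δ i ^ 2 = 4 * m₀ ^ 2 := by
  have h : ∀ i, radialField m₀ n δ i ^ 2 = 4 * m₀ ^ 2 * (δ i / euclLength δ) ^ 2 := by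
    intro i
    rw [radialField, mul_pow, mul_pow ((-1 : ℝ) ^ _), neg_one_pow_sq]
    ring
  simp only [h, ← Finset.mul_sum]
  rw [sum_div_euclLength_sq hδ, mul_one]

theorem abs_radialField_le (m₀ : ℝ) (n : Fin 4 → Fin 2) (δ : Mom) (i : Fin 4) :
    |radialField m₀ n δ i| ≤ |2 * m₀| := by
  rw [radialField, abs_mul, abs_mul ((-1 : ℝ) ^ _), abs_pow, abs_neg, abs_one, one_pow, one_mul]
  exact mul_le_of_le_one_right (abs_nonneg _) (abs_div_euclLength_le δ i)

theorem tendsto_overlapG_sub_radialField {m₀ : ℝ} {n : Fin 4 → Fin 2}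
    (hA : overlapA m₀ (corner n) = 0) (i : Fin 4) :
    Tendsto (fun δ => overlapG m₀ (corner n + δ) i - radialField m₀ n δ i) (𝓝[≠] 0) (𝓝 0) := by
  have hD := (tendsto_sub_div hA).inv₀ one_ne_zero
  rw [inv_one] at hD
  have h1 := (tendsto_sin_div_sub i).mul hD
  have h2 := tendsto_mul_zero_of_abs_le (by simpa using hD.sub_const 1)
    (abs_div_euclLength_le · i)
  have h3 := (h1.add h2).const_mul (2 * m₀ * (-1) ^ (n i : ℕ))
  rw [zero_mul, add_zero, mul_zero] at h3
  refine h3.congr' ?_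
  filter_upwards [self_mem_nhdsWithin] with δ hδ
  have hN := (euclLength_pos hδ).ne'
  rw [overlapG_eq, sin_corner_add, radialField, inv_div]
  set D := overlapR m₀ (corner n + δ) - overlapA m₀ (corner n + δ)
  have e : Real.sin (δ i) / euclLength δ * (euclLength δ / D) = Real.sin (δ i) / D := by
    field_simp
  linear_combination (2 * m₀ * (-1) ^ (n i : ℕ)) * e

/-- The limit is positive even for m = 0, so near the corner 𝒢⁻¹ is invertible for every real m. -/
theorem tendsto_denom_corner {m₀ : ℝ} (m : ℝ) {n : Fin 4 → Fin 2}
    (hA : overlapA m₀ (corner n) = 0) :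
    Tendsto (fun δ => ∑ i, overlapG m₀ (corner n + δ) i ^ 2 + m ^ 2) (𝓝[≠] 0)
      (𝓝 (4 * m₀ ^ 2 + m ^ 2)) := by
  have h := (tendsto_finsetSum Finset.univ fun i _ =>
    tendsto_sq_sub_sq (tendsto_overlapG_sub_radialField hA i)
      (abs_radialField_le m₀ n · i)).add_const (4 * m₀ ^ 2 + m ^ 2)
  rw [Finset.sum_const_zero, zero_add] at h
  refine h.congr' ?_
  filter_upwards [self_mem_nhdsWithin] with δ hδ
  rw [Finset.sum_sub_distrib, sum_radialField_sq m₀ n hδ]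
  ring

theorem eventually_denom_corner_ne_zero {m₀ : ℝ} (hm₀ : m₀ ≠ 0) (m : ℝ) {n : Fin 4 → Fin 2}
    (hA : overlapA m₀ (corner n) = 0) :
    ∀ᶠ δ in 𝓝[≠] 0, ∑ i, overlapG m₀ (corner n + δ) i ^ 2 + m ^ 2 ≠ 0 :=
  (tendsto_denom_corner m hA).eventually_ne (by positivity)

theorem tendsto_slash {α : Type*} {l : Filter α} {N : ℕ} (Γ : Fin N → SpinMat)
    {f : α → Fin N → ℝ} (hf : ∀ i, Tendsto (fun x => f x i) l (𝓝 0)) :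
    Tendsto (fun x => slash Γ fun i => (f x i : ℂ)) l (𝓝 0) := by
  have h1 : Tendsto (fun x => fun i => (f x i : ℂ)) l (𝓝 0) :=
    tendsto_pi_nhds.2 fun i => by
      simpa [Function.comp_def] using (Complex.continuous_ofReal.tendsto 0).comp (hf i)
  simpa [Function.comp_def] using ((continuous_slash Γ continuous_id).tendsto 0).comp h1

theorem tendsto_green_inv_corner {γ : Fin 4 → SpinMat} (hγ : IsClifford γ) {m₀ : ℝ} (hm₀ : m₀ ≠ 0)
    (m : ℝ) {n : Fin 4 → Fin 2} (hA : overlapA m₀ (corner n) = 0) :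
    Tendsto (fun δ => (overlapGreen γ m₀ m (corner n + δ))⁻¹ -
      (slash γ (fun i => ((1 * radialField m₀ n δ i : ℝ) : ℂ)) + (-(Complex.I * (m : ℂ))) • 1))
      (𝓝[≠] 0) (𝓝 0) := by
  refine (tendsto_slash γ fun i => tendsto_overlapG_sub_radialField hA i).congr' ?_
  filter_upwards [eventually_denom_corner_ne_zero hm₀ m hA] with δ hδ
  rw [overlapGreen, green_inv hγ _ _ _ hδ, neg_smul, ← sub_eq_add_neg, sub_sub_sub_cancel_right,
    ← map_sub]
  congr 1
  ext i
  simp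

/-- The model is written in the shape c · radial field + constant scalar, which
`not_tendsto_of_radial` takes as input; the same shape serves 𝒢⁻¹ with c = 1. -/
theorem tendsto_green_corner {γ : Fin 4 → SpinMat} (hγ : IsClifford γ) {m₀ : ℝ} (hm₀ : m₀ ≠ 0)
    (m : ℝ) {n : Fin 4 → Fin 2} (hA : overlapA m₀ (corner n) = 0) :
    Tendsto (fun δ => overlapGreen γ m₀ m (corner n + δ) -
      (slash γ (fun i => (((4 * m₀ ^ 2 + m ^ 2)⁻¹ * radialField m₀ n δ i : ℝ) : ℂ)) +
        (((4 * m₀ ^ 2 + m ^ 2)⁻¹ : ℝ) * (Complex.I * (m : ℂ))) • 1))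
      (𝓝[≠] 0) (𝓝 0) := by
  have hb : (4 * m₀ ^ 2 + m ^ 2) ≠ 0 := by positivity
  have ha := (tendsto_denom_corner m hA).inv₀ hb
  have hab := ha.sub_const (4 * m₀ ^ 2 + m ^ 2)⁻¹
  rw [sub_self] at hab
  have h1 : ∀ i, Tendsto (fun δ => (∑ i, overlapG m₀ (corner n + δ) i ^ 2 + m ^ 2)⁻¹ *
      overlapG m₀ (corner n + δ) i - (4 * m₀ ^ 2 + m ^ 2)⁻¹ * radialField m₀ n δ i)
      (𝓝[≠] 0) (𝓝 0) := by
    intro i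
    have h := (ha.mul (tendsto_overlapG_sub_radialField hA i)).add
      (tendsto_mul_zero_of_abs_le hab (abs_radialField_le m₀ n · i))
    rw [mul_zero, add_zero] at h
    refine h.congr fun δ => ?_
    ring
  have h2 : Tendsto (fun δ => ((((∑ i, overlapG m₀ (corner n + δ) i ^ 2 + m ^ 2)⁻¹ -
      (4 * m₀ ^ 2 + m ^ 2)⁻¹ : ℝ) : ℂ) * (Complex.I * (m : ℂ))) • (1 : SpinMat))
      (𝓝[≠] 0) (𝓝 0) := by
    have h := (((Complex.continuous_ofReal.tendsto 0).comp hab).mul_const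
      (Complex.I * (m : ℂ))).smul_const (1 : SpinMat)
    simpa using h
  have h3 := (tendsto_slash γ h1).add h2
  rw [add_zero] at h3
  refine h3.congr' ?_
  filter_upwards [eventually_denom_corner_ne_zero hm₀ m hA] with δ hδ
  rw [overlapGreen, green_eq hγ _ _ _ hδ, smul_add, ← map_smul, smul_smul, add_sub_add_comm,
    ← map_sub, ← sub_smul]
  congr 2
  · ext i
    simp
  · push_cast
    ring

theorem unparticlePropagator_eq {γ : Fin 4 → SpinMat} (hγ : IsClifford γ) {m₀ : ℝ} (hm₀ : m₀ ≠ 0)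
    (m : ℝ) (n : Fin 4 → Fin 2) {δ : Mom} (hδ : δ ≠ 0) :
    unparticlePropagator γ m₀ m n δ =
      slash γ (fun i => (((4 * m₀ ^ 2 + m ^ 2)⁻¹ * radialField m₀ n δ i : ℝ) : ℂ)) +
        (((4 * m₀ ^ 2 + m ^ 2)⁻¹ : ℝ) * (Complex.I * (m : ℂ))) • 1 := by
  have hpos : 0 < 4 * m₀ ^ 2 + m ^ 2 := by positivity
  have hm₀c : (m₀ : ℂ) ≠ 0 := by exact_mod_cast hm₀
  have hsum : ∑ i, ((-1 : ℝ) ^ (n i : ℕ) * (δ i / euclLength δ)) ^ 2 = 1 := by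
    simp only [mul_pow ((-1 : ℝ) ^ _), neg_one_pow_sq, one_mul]
    exact sum_div_euclLength_sq hδ
  have e : ∑ i, (((-1 : ℝ) ^ (n i : ℕ) * (δ i / euclLength δ) : ℝ) : ℂ) *
      (((-1 : ℝ) ^ (n i : ℕ) * (δ i / euclLength δ) : ℝ) : ℂ) -
        (Complex.I * (m : ℂ) / (2 * (m₀ : ℂ))) ^ 2
      = (((4 * m₀ ^ 2 + m ^ 2) / (4 * m₀ ^ 2) : ℝ) : ℂ) := by
    have h : Complex.I * (m : ℂ) / (2 * (m₀ : ℂ)) = Complex.I * ((m / (2 * m₀) : ℝ) : ℂ) := by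
      push_cast; ring
    rw [h, ofReal_denom, hsum]
    congr 1
    field_simp
    ring
  have hne : (((4 * m₀ ^ 2 + m ^ 2) / (4 * m₀ ^ 2) : ℝ) : ℂ) ≠ 0 := by
    rw [Ne, Complex.ofReal_eq_zero]; positivity
  unfold unparticlePropagator
  rw [← euclLength, ← slash_apply (v := fun i => (((-1 : ℝ) ^ (n i : ℕ) * (δ i / euclLength δ) : ℝ) : ℂ)),
    slash_sub_inv hγ _ _ (by rw [e]; exact hne), e, smul_smul, smul_add, ← map_smul, smul_smul]
  have hb : (4 * (m₀ : ℂ) ^ 2 + (m : ℂ) ^ 2) ≠ 0 := by exact_mod_cast hpos.ne'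
  congr 2
  · ext i
    simp only [Pi.smul_apply, smul_eq_mul, radialField]
    push_cast
    field_simp
    ring
  · push_cast
    field_simp
    ring

theorem tendsto_add_nhdsNE_zero (p : Mom) : Tendsto (fun δ => p + δ) (𝓝[≠] 0) (𝓝[≠] p) := by
  refine tendsto_nhdsWithin_iff.2 ⟨?_, ?_⟩
  · exact ((continuous_const.add continuous_id).tendsto' 0 p (by simp)).mono_left
      nhdsWithin_le_nhds
  · filter_upwards [self_mem_nhdsWithin] with δ hδ
    simpa using hδ

theorem tendsto_neg_nhdsNE_zero : Tendsto (fun δ : Mom => -δ) (𝓝[≠] 0) (𝓝[≠] 0) := by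
  refine tendsto_nhdsWithin_iff.2 ⟨?_, ?_⟩
  · exact (continuous_neg.tendsto' 0 0 neg_zero).mono_left nhdsWithin_le_nhds
  · filter_upwards [self_mem_nhdsWithin] with δ hδ
    simpa using hδ

/-- A function asymptotic to a multiple of the radial field has different limits along `δ` and
`-δ`. -/
theorem not_tendsto_of_radial {γ : Fin 4 → SpinMat} (hγ : IsClifford γ) {m₀ c : ℝ} (hm₀ : m₀ ≠ 0)
    (hc : c ≠ 0) {d : ℂ} {n : Fin 4 → Fin 2} {F : Mom → SpinMat} {p : Mom}
    (h : Tendsto (fun δ => F (p + δ) -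
      (slash γ (fun i => ((c * radialField m₀ n δ i : ℝ) : ℂ)) + d • 1)) (𝓝[≠] 0) (𝓝 0)) :
    ¬ ∃ L, Tendsto F (𝓝[≠] p) (𝓝 L) := by
  rintro ⟨L, hL⟩
  have h1 := hL.comp (tendsto_add_nhdsNE_zero p)
  -- The hypothetical limit L and the scalar part cancel between δ and -δ, leaving twice the radial
  -- part tending to 0. By `slash_sq` its square is the constant 4c² · 4m₀², a contradiction.
  have h2 := (h1.sub h).sub ((h1.sub h).comp tendsto_neg_nhdsNE_zero)
  rw [sub_zero, sub_self] at h2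
  have h3 := h2.mul h2
  rw [mul_zero] at h3
  have h4 : Tendsto (fun _ : Mom => (((2 * c) ^ 2 * (4 * m₀ ^ 2) : ℝ) : ℂ) • (1 : SpinMat))
      (𝓝[≠] 0) (𝓝 0) := by
    refine h3.congr' ?_
    filter_upwards [self_mem_nhdsWithin] with δ hδ
    simp only [Function.comp_apply, sub_sub_cancel, add_sub_add_right_eq_sub]
    rw [← map_sub, slash_sq hγ, ← sum_radialField_sq m₀ n hδ, Finset.mul_sum]
    congr 1
    push_cast
    refine Finset.sum_congr rfl fun i _ => ?_
    simp only [Pi.sub_apply, radialField_neg]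
    push_cast
    ring
  have h5 := tendsto_nhds_unique tendsto_const_nhds h4
  rw [smul_eq_zero, Complex.ofReal_eq_zero] at h5
  rcases h5 with h5 | h5
  · have : (2 * c) ^ 2 * (4 * m₀ ^ 2) ≠ 0 := by positivity
    exact this h5
  · exact one_ne_zero h5

theorem not_analytic_of_not_tendsto {G : Mom → SpinMat} {q : Mom}
    (h : ¬ ∃ L, Tendsto G (𝓝[≠] q) (𝓝 L)) :
    ¬ ∃ F : Mom → SpinMat, (∀ i j, AnalyticAt ℝ (fun p => F p i j) q) ∧ F =ᶠ[𝓝[≠] q] G := by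
  rintro ⟨F, hF, hFG⟩
  refine h ⟨F q, Tendsto.congr' hFG ?_⟩
  refine Tendsto.mono_left ?_ nhdsWithin_le_nhds
  exact tendsto_pi_nhds.2 fun i => tendsto_pi_nhds.2 fun j => (hF i j).continuousAt

theorem not_tendsto_overlapGreen_corner {γ : Fin 4 → SpinMat} (hγ : IsClifford γ) {m₀ : ℝ}
    (hm₀ : m₀ ≠ 0) (m : ℝ) {n : Fin 4 → Fin 2} (hA : overlapA m₀ (corner n) = 0) :
    ¬ ∃ L, Tendsto (overlapGreen γ m₀ m) (𝓝[≠] (corner n)) (𝓝 L) :=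
  not_tendsto_of_radial hγ hm₀ (by positivity) (tendsto_green_corner hγ hm₀ m hA)

theorem isGeneralizedUnparticle_corner {γ : Fin 4 → SpinMat} (hγ : IsClifford γ) {m₀ : ℝ}
    (hm₀ : m₀ ≠ 0) (m : ℝ) {n : Fin 4 → Fin 2} (hA : overlapA m₀ (corner n) = 0) :
    IsGeneralizedUnparticle (overlapGreen γ m₀ m) (corner n) :=
  ⟨not_analytic_of_not_tendsto (not_tendsto_overlapGreen_corner hγ hm₀ m hA),
    not_analytic_of_not_tendsto (not_tendsto_of_radial hγ hm₀ one_ne_zero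
      (F := fun p => (overlapGreen γ m₀ m p)⁻¹) (tendsto_green_inv_corner hγ hm₀ m hA))⟩

theorem tendsto_sub_unparticlePropagator {γ : Fin 4 → SpinMat} (hγ : IsClifford γ) {m₀ : ℝ}
    (hm₀ : m₀ ≠ 0) (m : ℝ) {n : Fin 4 → Fin 2} (hA : overlapA m₀ (corner n) = 0) :
    Tendsto (fun δ : Mom => overlapGreen γ m₀ m (corner n + δ) - unparticlePropagator γ m₀ m n δ)
      (𝓝[≠] 0) (𝓝 0) := by
  refine (tendsto_green_corner hγ hm₀ m hA).congr' ?_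
  filter_upwards [self_mem_nhdsWithin] with δ hδ
  rw [unparticlePropagator_eq hγ hm₀ m n hδ]

/-! ### Values of the degree -/

theorem overlapDegree_eq (m₀ : ℝ) : overlapDegree m₀ = -(1 / 2) * (Real.sign (0 - m₀)
    - 4 * Real.sign (2 - m₀) + 6 * Real.sign (4 - m₀) - 4 * Real.sign (6 - m₀)
    + Real.sign (8 - m₀)) := by
  simp only [overlapDegree, Finset.sum_range_succ, Finset.sum_range_zero, Nat.choose]
  norm_num
  ring

theorem overlapDegree_of_neg {m₀ : ℝ} (h : m₀ < 0) :
    overlapDegree m₀ = 0 := by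
  rw [overlapDegree_eq, Real.sign_of_pos (by linarith : 0 < 0 - m₀),
    Real.sign_of_pos (by linarith : 0 < 2 - m₀),
    Real.sign_of_pos (by linarith : 0 < 4 - m₀),
    Real.sign_of_pos (by linarith : 0 < 6 - m₀),
    Real.sign_of_pos (by linarith : 0 < 8 - m₀)]
  norm_num

theorem overlapDegree_of_lt_two {m₀ : ℝ} (h : 0 < m₀) (h' : m₀ < 2) :
    overlapDegree m₀ = 1 := by
  rw [overlapDegree_eq, Real.sign_of_neg (by linarith : 0 - m₀ < 0),
    Real.sign_of_pos (by linarith : 0 < 2 - m₀),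
    Real.sign_of_pos (by linarith : 0 < 4 - m₀),
    Real.sign_of_pos (by linarith : 0 < 6 - m₀),
    Real.sign_of_pos (by linarith : 0 < 8 - m₀)]
  norm_num

theorem overlapDegree_of_lt_four {m₀ : ℝ} (h : 2 < m₀) (h' : m₀ < 4) :
    overlapDegree m₀ = -3 := by
  rw [overlapDegree_eq, Real.sign_of_neg (by linarith : 0 - m₀ < 0),
    Real.sign_of_neg (by linarith : 2 - m₀ < 0),
    Real.sign_of_pos (by linarith : 0 < 4 - m₀),
    Real.sign_of_pos (by linarith : 0 < 6 - m₀),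
    Real.sign_of_pos (by linarith : 0 < 8 - m₀)]
  norm_num

theorem overlapDegree_of_lt_six {m₀ : ℝ} (h : 4 < m₀) (h' : m₀ < 6) :
    overlapDegree m₀ = 3 := by
  rw [overlapDegree_eq, Real.sign_of_neg (by linarith : 0 - m₀ < 0),
    Real.sign_of_neg (by linarith : 2 - m₀ < 0),
    Real.sign_of_neg (by linarith : 4 - m₀ < 0),
    Real.sign_of_pos (by linarith : 0 < 6 - m₀),
    Real.sign_of_pos (by linarith : 0 < 8 - m₀)]
  norm_num

theorem overlapDegree_of_lt_eight {m₀ : ℝ} (h : 6 < m₀) (h' : m₀ < 8) :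
    overlapDegree m₀ = -1 := by
  rw [overlapDegree_eq, Real.sign_of_neg (by linarith : 0 - m₀ < 0),
    Real.sign_of_neg (by linarith : 2 - m₀ < 0),
    Real.sign_of_neg (by linarith : 4 - m₀ < 0),
    Real.sign_of_neg (by linarith : 6 - m₀ < 0),
    Real.sign_of_pos (by linarith : 0 < 8 - m₀)]
  norm_num

theorem overlapDegree_of_eight_lt {m₀ : ℝ} (h : 8 < m₀) :
    overlapDegree m₀ = 0 := by
  rw [overlapDegree_eq, Real.sign_of_neg (by linarith : 0 - m₀ < 0),
    Real.sign_of_neg (by linarith : 2 - m₀ < 0),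
    Real.sign_of_neg (by linarith : 4 - m₀ < 0),
    Real.sign_of_neg (by linarith : 6 - m₀ < 0),
    Real.sign_of_neg (by linarith : 8 - m₀ < 0)]
  norm_num

end OverlapFermion

end

/-! ### The main theorem. -/

theorem mainTheorem4 (γ : Fin 4 → OverlapFermion.SpinMat)
    (hγ : OverlapFermion.IsEuclideanGamma γ) (m₀ m : ℝ) :
    (m ≠ 0 → m₀ ≠ 0 → m₀ ≠ 2 → m₀ ≠ 4 → m₀ ≠ 6 → m₀ ≠ 8 →
      ∃ N₄ N₅ : ℝ,
        OverlapFermion.HasN4 γ (OverlapFermion.overlapGreen γ m₀ m) N₄ ∧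
        OverlapFermion.HasN5 γ (OverlapFermion.overlapGreen γ m₀ m) N₅ ∧
        OverlapFermion.HasN5Sphere γ (OverlapFermion.overlapG m₀) (fun _ => m) N₅ ∧
        N₅ = -(1 / 2) * Real.sign m *
          ∑ k ∈ Finset.range 5, (-1 : ℝ) ^ k * (Nat.choose 4 k : ℝ) *
            Real.sign (2 * (k : ℝ) - m₀) ∧
        N₄ = N₅ * Real.sign m ∧
        N₄ = -(1 / 2) *
          ∑ k ∈ Finset.range 5, (-1 : ℝ) ^ k * (Nat.choose 4 k : ℝ) *
            Real.sign (2 * (k : ℝ) - m₀) ∧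
        (m₀ < 0 → N₄ = 0 ∧ N₅ = 0) ∧
        (0 < m₀ → m₀ < 2 → N₄ = 1 ∧ N₅ = Real.sign m) ∧
        (2 < m₀ → m₀ < 4 → N₄ = -3 ∧ N₅ = -3 * Real.sign m) ∧
        (4 < m₀ → m₀ < 6 → N₄ = 3 ∧ N₅ = 3 * Real.sign m) ∧
        (6 < m₀ → m₀ < 8 → N₄ = -1 ∧ N₅ = -Real.sign m) ∧
        (8 < m₀ → N₄ = 0 ∧ N₅ = 0)) ∧
    (∀ k : ℕ, 1 ≤ k → k ≤ 4 → m₀ = 2 * (k : ℝ) →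
      {n : Fin 4 → Fin 2 |
        OverlapFermion.overlapA m₀ (OverlapFermion.corner n) = 0}.ncard = Nat.choose 4 k ∧
      ∀ n : Fin 4 → Fin 2, OverlapFermion.overlapA m₀ (OverlapFermion.corner n) = 0 →
        (¬ ∃ L : OverlapFermion.SpinMat,
          Filter.Tendsto (OverlapFermion.overlapGreen γ m₀ m)
            (nhdsWithin (OverlapFermion.corner n) {OverlapFermion.corner n}ᶜ) (nhds L)) ∧
        OverlapFermion.IsGeneralizedUnparticle (OverlapFermion.overlapGreen γ m₀ m)
          (OverlapFermion.corner n) ∧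
        Filter.Tendsto
          (fun δ : OverlapFermion.Mom =>
            OverlapFermion.overlapGreen γ m₀ m (OverlapFermion.corner n + δ) -
              OverlapFermion.unparticlePropagator γ m₀ m n δ)
          (nhdsWithin 0 {0}ᶜ) (nhds 0)) := by
  -- The two predicates agree by unfolding; `IsClifford` also covers the family of five matrices.
  have hγ' : OverlapFermion.IsClifford γ := hγ
  refine ⟨fun hm h0 h2 h4 h6 h8 => ?_, fun k hk1 hk4 hk => ?_⟩
  · have hR := OverlapFermion.overlapR_pos h0 h2 h4 h6 h8
    have hsq : Real.sign m * Real.sign m = 1 := by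
      rcases Real.sign_apply_eq_of_ne_zero m hm with h | h <;> rw [h] <;> norm_num
    refine ⟨OverlapFermion.overlapDegree m₀, Real.sign m * OverlapFermion.overlapDegree m₀,
      OverlapFermion.hasN4_overlap hγ' h0 hm hR, OverlapFermion.hasN5_overlap hγ' h0 hm hR,
      OverlapFermion.hasN5Sphere_overlap hγ' h0 hm hR, ?_, ?_, rfl, ?_, ?_, ?_, ?_, ?_, ?_⟩
    · rw [OverlapFermion.overlapDegree]; ring
    -- sign(m)² = 1, which requires m ≠ 0.
    · linear_combination -OverlapFermion.overlapDegree m₀ * hsq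
    · intro h
      simp [OverlapFermion.overlapDegree_of_neg h]
    · intro h h'
      simp [OverlapFermion.overlapDegree_of_lt_two h h']
    · intro h h'
      simp [OverlapFermion.overlapDegree_of_lt_four h h', mul_comm]
    · intro h h'
      simp [OverlapFermion.overlapDegree_of_lt_six h h', mul_comm]
    · intro h h'
      simp [OverlapFermion.overlapDegree_of_lt_eight h h']
    · intro h
      simp [OverlapFermion.overlapDegree_of_eight_lt h]
  · have h0 : m₀ ≠ 0 := by
      have : (1 : ℝ) ≤ k := by exact_mod_cast hk1
      linarith
    refine ⟨hk ▸ OverlapFermion.ncard_overlapA_corner k hk4, fun n hA => ⟨?_, ?_, ?_⟩⟩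
    · exact OverlapFermion.not_tendsto_overlapGreen_corner hγ' h0 m hA
    · exact OverlapFermion.isGeneralizedUnparticle_corner hγ' h0 m hA
    · exact OverlapFermion.tendsto_sub_unparticlePropagator hγ' h0 m hA
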